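/- **Setting.** Let $E,E_1,E_2$ be sequentially complete locally convex Hausdorff spaces over $\mathbb C$, and let $\cdot\colon E_1\times E_2\to E$ be a bilinear map such that for every continuous seminorm $p$ on $E$ there are continuous seminorms $q$ on $E_1$, $r$ on $E_2$ and $D>0$ with $p(x\cdot y)\le D\,q(x)\,r(y)$ for all $x\in E_1$, $y\in E_2$. For compact $K\subset\overline{\mathbb R}=[-\infty,\infty]$ and $n\in\mathbb N=\{1,2,\dots\}$ let $U_n(K)$ be the union of $\{z\in\mathbb C: \operatorname{dist}(z,K\cap\mathbb C)<\frac1n\}$ (empty if $K\cap\mathbb C=\emptyset$), of $]n,\infty[+i]-\frac1n,\frac1n[$ if $\infty\in K$, and of $]-\infty,-n[+i]-\frac1n,\frac1n[$ if $-\infty\in K$. Put $S_n(K)=(\mathbb C\setminus\overline{U_n(K)})\cap\{|\operatorname{Im}z|<n\}$. Let $\mathcal O^{exp}(\overline{\mathbb C}\setminus K,E)$ be the space of holomorphic $F\colon\mathbb C\setminus K\to E$ with $\sup_{z\in S_n(K)}p(F(z))e^{-|\operatorname{Re}z|/n}<\infty$ for all $n\in\mathbb N$ and all continuous seminorms $p$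 on $E$, and let $bv_K(E)=\mathcal O^{exp}(\overline{\mathbb C}\setminus K,E)/\mathcal O^{exp}(\overline{\mathbb C},E)$, where $\mathcal O^{exp}(\overline{\mathbb C},E)$ is the case $K=\emptyset$. All integrals are Pettis integrals. For a non-empty closed interval $[c,d]\subsetneq\overline{\mathbb R}$ ($c,d\in\overline{\mathbb R}$) and $\varepsilon>0$ let $\gamma_{[c,d]}^{\varepsilon}$ be the boundary, oriented clockwise, of $\{z:\operatorname{dist}(z,[c,d]\cap\mathbb C)<\varepsilon\}$ if $[c,d]\cap\mathbb C\ne\emptyset$, and of the half-strip $]\frac1\varepsilon,\infty[+i]-\varepsilon,\varepsilon[$, resp. $]-\infty,-\frac1\varepsilon[+i]-\varepsilon,\varepsilon[$, if $[c,d]=\{\infty\}$, resp. $\{-\infty\}$. The Fourier transform of $f=[F]\in bv_{[c,d]}(E)$ is $$\mathcal F(f)(\zeta)=\int_{\gamma_{[c,d]}^{\varepsilon}}F(z)e^{-iz\zeta}\,dz,$$ which does not depend on $\varepsilon>0$ or on the representative $F$; here $\zeta$ ranges over $\mathbb C$ if $[c,d]\subset\mathbb R$, over the lower half-plane $\{\operatorname{Im}\zeta<0\}$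 if $d=\infty$, and over the upper half-plane $\{\operatorname{Im}\zeta>0\}$ if $c=-\infty$. **Statement.** Let $a\le b$ be real numbers and let $\emptyset\neq[c,d]\subsetneq\overline{\mathbb R}$ be a closed interval with $c,d\in\overline{\mathbb R}$. For $[F]\in bv_{[a,b]}(E_1)$ and $[G]\in bv_{[c,d]}(E_2)$ put $$(F\circledast G)(z)=\int_{\gamma_{[a,b]}^{1/(2n)}}F(w)\cdot G(z-w)\,dw\qquad\text{for } n\in\mathbb N,\ z\in S_n([a+c,b+d]).$$ Then: 1. The integrals exist and, for given $z$, do not depend on $n$; the function $F\circledast G$ so defined belongs to $\mathcal O^{exp}(\overline{\mathbb C}\setminus[a+c,b+d],E)$, and its class $[F]\circledast[G]:=[F\circledast G]\in bv_{[a+c,b+d]}(E)$ depends only on the classes $[F]$ and $[G]$. 2. $[F]\circledast[G]$ equals the Fourier-defined convolution $[F]*[G]=\mathcal F^{-1}\bigl(\mathcal F([F])\cdot\mathcal F([G])\bigr)$, that is, it is the one and only $h\in bv_{[a+c,b+d]}(E)$ with $\mathcal F(h)(\zeta)=\mathcal F([F])(\zeta)\cdot\mathcal F([G])(\zeta)$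 for all $\zeta$ in the domain of $\mathcal F(h)$. -/

import Mathlib

open Set Filter Topology MeasureTheory

namespace FourierHyperfunction

section Geometry

/-- `K ∩ ℂ`: the points of `K ⊆ [-∞, ∞]` that are finite, as a subset of the real axis in `ℂ`. -/
def finitePart (K : Set EReal) : Set ℂ :=
  {z | z.im = 0 ∧ (z.re : EReal) ∈ K}

/-- `U_n(K)`: the open `1/n`-neighbourhood of `K ∩ ℂ`, together with the half-strip
`]n, ∞[ + i ]-1/n, 1/n[` if `∞ ∈ K` and the half-strip `]-∞, -n[ + i ]-1/n, 1/n[` if `-∞ ∈ K`.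
(Distances to the empty set are infinite, as in `Metric.thickening`.) -/
def U (n : ℕ) (K : Set EReal) : Set ℂ :=
  Metric.thickening (1 / (n : ℝ)) (finitePart K)
    ∪ {z | ⊤ ∈ K ∧ (n : ℝ) < z.re ∧ |z.im| < 1 / (n : ℝ)}
    ∪ {z | ⊥ ∈ K ∧ z.re < -(n : ℝ) ∧ |z.im| < 1 / (n : ℝ)}

/-- `S_n(K) = (ℂ ∖ closure U_n(K)) ∩ {|Im z| < n}`. -/
def S (n : ℕ) (K : Set EReal) : Set ℂ :=
  (closure (U n K))ᶜ ∩ {z | |z.im| < (n : ℝ)}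

end Geometry

section Spaces

variable {E : Type*} [AddCommGroup E] [Module ℂ E] [TopologicalSpace E]

/-- Holomorphy of a vector-valued function: the difference quotients converge in `E` at every
point of the open set `Ω`. -/
def HolomorphicOn (f : ℂ → E) (Ω : Set ℂ) : Prop :=
  ∀ z ∈ Ω, ∃ f' : E, Tendsto (slope f z) (𝓝[≠] z) (𝓝 f')

/-- Slow exponential growth away from `K`: for all `n ≥ 1` and all continuous seminorms `p`,
`sup_{z ∈ S_n(K)} p (f z) e^{-|Re z| / n} < ∞`. -/
def SlowGrowth (K : Set EReal) (f : ℂ → E) : Prop :=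
  ∀ n : ℕ, 1 ≤ n → ∀ p : Seminorm ℂ E, Continuous p →
    ∃ C : ℝ, ∀ z ∈ S n K, p (f z) * Real.exp (-(1 / (n : ℝ)) * |z.re|) ≤ C

variable (E) [IsTopologicalAddGroup E] [ContinuousSMul ℂ E]

/-- `O^exp(ℂ̄ ∖ K, E)`, the slowly increasing `E`-valued holomorphic functions outside `K`.
Its elements are represented by functions on all of `ℂ`; the values on `K ∩ ℂ` are not constrained
and are forgotten in the quotient `BV` below. -/
def Oexp (K : Set EReal) : Submodule ℂ (ℂ → E) where
  carrier := {f | HolomorphicOn f (finitePart K)ᶜ ∧ SlowGrowth K f}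
  zero_mem' := by
    refine ⟨fun z _ => ⟨0, ?_⟩, fun n _ p _ => ⟨0, fun z _ => ?_⟩⟩
    · have h : slope (0 : ℂ → E) z = fun _ => 0 := by
        funext w
        simp [slope]
      rw [h]
      exact tendsto_const_nhds
    · simp
  add_mem' := by
    rintro f g ⟨hf, hf'⟩ ⟨hg, hg'⟩
    refine ⟨fun z hz => ?_, fun n hn p hp => ?_⟩
    · obtain ⟨u, hu⟩ := hf z hz
      obtain ⟨v, hv⟩ := hg z hz
      refine ⟨u + v, ?_⟩
      have h : slope (f + g) z = fun w => slope f z w + slope g z w := by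
        funext w
        simp only [slope, vsub_eq_sub, Pi.add_apply, ← smul_add]
        congr 1
        abel
      rw [h]
      exact hu.add hv
    · obtain ⟨C, hC⟩ := hf' n hn p hp
      obtain ⟨D, hD⟩ := hg' n hn p hp
      refine ⟨C + D, fun z hz => ?_⟩
      calc p ((f + g) z) * Real.exp (-(1 / (n : ℝ)) * |z.re|)
          ≤ (p (f z) + p (g z)) * Real.exp (-(1 / (n : ℝ)) * |z.re|) :=
            mul_le_mul_of_nonneg_right (map_add_le_add p _ _) (Real.exp_pos _).le
        _ ≤ C + D := by
            rw [add_mul]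
            exact add_le_add (hC z hz) (hD z hz)
  smul_mem' := by
    rintro c f ⟨hf, hf'⟩
    refine ⟨fun z hz => ?_, fun n hn p hp => ?_⟩
    · obtain ⟨u, hu⟩ := hf z hz
      refine ⟨c • u, ?_⟩
      have h : slope (c • f) z = fun w => c • slope f z w := by
        funext w
        simp only [slope, vsub_eq_sub, Pi.smul_apply, ← smul_sub]
        rw [smul_comm]
      rw [h]
      exact hu.const_smul c
    · obtain ⟨C, hC⟩ := hf' n hn p hp
      refine ⟨‖c‖ * C, fun z hz => ?_⟩
      rw [Pi.smul_apply, map_smul_eq_mul, mul_assoc]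
      exact mul_le_mul_of_nonneg_left (hC z hz) (norm_nonneg c)

/-- `O^exp(ℂ̄, E)` inside `O^exp(ℂ̄ ∖ K, E)`: the elements that agree off `K` with an entire
function in `O^exp(ℂ̄ ∖ ∅, E)`. -/
def entirePart (K : Set EReal) : Submodule ℂ (Oexp E K) where
  carrier := {F | ∃ H ∈ Oexp E ∅, ∀ z ∉ finitePart K, (F : ℂ → E) z = H z}
  zero_mem' := ⟨0, Submodule.zero_mem _, fun _ _ => rfl⟩
  add_mem' := by
    rintro F G ⟨H, hH, hF⟩ ⟨I, hI, hG⟩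
    exact ⟨H + I, Submodule.add_mem _ hH hI, fun z hz => by simp [hF z hz, hG z hz]⟩
  smul_mem' := by
    rintro c F ⟨H, hH, hF⟩
    exact ⟨c • H, Submodule.smul_mem _ c hH, fun z hz => by simp [hF z hz]⟩

/-- `bv_K(E) = O^exp(ℂ̄ ∖ K, E) / O^exp(ℂ̄, E)`. -/
abbrev BV (K : Set EReal) : Type _ := Oexp E K ⧸ entirePart E K

variable {E}

/-- The class `[F] ∈ bv_K(E)` of `F ∈ O^exp(ℂ̄ ∖ K, E)`. -/
abbrev BV.mk {K : Set EReal} (F : Oexp E K) : BV E K := (entirePart E K).mkQ F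

end Spaces

section Contours

/-- A smooth piece of a contour: a parameter interval and a path, traversed in the direction of
increasing parameter. -/
structure Arc where
  dom : Set ℝ
  path : ℝ → ℂ

/-- The horizontal piece of `∂U` at height `ε`, from left to right. -/
noncomputable def topArc (lo hi : EReal) (ε : ℝ) : Arc where
  dom := {t | lo ≤ (t : EReal) ∧ (t : EReal) ≤ hi}
  path := fun t => (t : ℂ) + ε * Complex.I

/-- The horizontal piece of `∂U` at height `-ε`, from right to left. -/
noncomputable def bottomArc (lo hi : EReal) (ε : ℝ) : Arc where
  dom := {t | lo ≤ ((-t : ℝ) : EReal) ∧ ((-t : ℝ) : EReal) ≤ hi}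
  path := fun t => -(t : ℂ) - ε * Complex.I

open Classical in
/-- The left end of the contour around `[c, d]`, traversed upwards: a half-circle around `c` if `c`
is finite, the vertical segment over `1/ε` if `c = ∞`, and nothing if `c = -∞`. -/
noncomputable def leftEnd (c : EReal) (ε : ℝ) : List Arc :=
  if c = ⊥ then []
  else if c = ⊤ then [⟨Icc (-ε) ε, fun t => ((1 / ε : ℝ) : ℂ) + t * Complex.I⟩]
  else [⟨Icc (Real.pi / 2) (3 * Real.pi / 2),
    fun t => (c.toReal : ℂ) + ε * Complex.exp (-(t * Complex.I))⟩]

open Classical in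
/-- The right end of the contour around `[c, d]`, traversed downwards: a half-circle around `d` if
`d` is finite, the vertical segment over `-1/ε` if `d = -∞`, and nothing if `d = ∞`. -/
noncomputable def rightEnd (d : EReal) (ε : ℝ) : List Arc :=
  if d = ⊤ then []
  else if d = ⊥ then [⟨Icc (-ε) ε, fun t => ((-(1 / ε) : ℝ) : ℂ) - t * Complex.I⟩]
  else [⟨Icc (-(Real.pi / 2)) (Real.pi / 2),
    fun t => (d.toReal : ℂ) + ε * Complex.exp (-(t * Complex.I))⟩]

open Classical in
/-- The contour `γ_{[c,d]}` of width `ε` around the interval `[c, d] ⊆ [-∞, ∞]`, oriented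
clockwise: the boundary of `{z | dist z ([c, d] ∩ ℂ) < ε}` if `[c, d]` meets `ℂ`, the boundary of
the half-strip `]1/ε, ∞[ + i ]-ε, ε[` if `c = d = ∞`, and the boundary of the half-strip
`]-∞, -1/ε[ + i ]-ε, ε[` if `c = d = -∞`. -/
noncomputable def contour (c d : EReal) (ε : ℝ) : List Arc :=
  let lo : EReal := if c = ⊤ then ((1 / ε : ℝ) : EReal) else c
  let hi : EReal := if d = ⊥ then ((-(1 / ε) : ℝ) : EReal) else d
  leftEnd c ε ++ [topArc lo hi ε] ++ rightEnd d ε ++ [bottomArc lo hi ε]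

variable {E : Type*} [AddCommGroup E] [Module ℂ E] [TopologicalSpace E]

/-- `∫_γ f(z) dz = v` as a Pettis integral: for every continuous linear functional `e'` the scalar
function `e' ∘ f` is absolutely integrable along `γ`, with integral `e' v`. -/
def HasContourIntegral (γ : List Arc) (f : ℂ → E) (v : E) : Prop :=
  ∀ e' : E →L[ℂ] ℂ,
    (∀ A ∈ γ, IntegrableOn (fun t => deriv A.path t * e' (f (A.path t))) A.dom) ∧
    (γ.map fun A => ∫ t in A.dom, deriv A.path t * e' (f (A.path t))).sum = e' v

end Contours

section Transforms

variable {E : Type*} [AddCommGroup E] [Module ℂ E] [TopologicalSpace E]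
  [IsTopologicalAddGroup E] [ContinuousSMul ℂ E]
variable {E₁ : Type*} [AddCommGroup E₁] [Module ℂ E₁] [TopologicalSpace E₁]
  [IsTopologicalAddGroup E₁] [ContinuousSMul ℂ E₁]
variable {E₂ : Type*} [AddCommGroup E₂] [Module ℂ E₂] [TopologicalSpace E₂]
  [IsTopologicalAddGroup E₂] [ContinuousSMul ℂ E₂]

/-- The domain of Fourier transforms of elements of `bv_{[c,d]}`, for `[c, d] ≠ [-∞, ∞]`: the lower
half-plane if `d = ∞`, the upper half-plane if `c = -∞`, and `ℂ` if `[c, d] ⊆ ℝ`. -/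
def fourierDomain (c d : EReal) : Set ℂ :=
  {ζ | (d = ⊤ → ζ.im < 0) ∧ (c = ⊥ → 0 < ζ.im)}

/-- `φ = F(f)`, the Fourier transform of `f = [F] ∈ bv_{[c,d]}(E)`:
`φ(ζ) = ∫_{γ_{[c,d]}} F(z) e^{-izζ} dz` for `ζ` in the Fourier domain, for every representative `F`
and every width of the contour. -/
def IsFourierTransform {c d : EReal} (f : BV E (Icc c d)) (φ : ℂ → E) : Prop :=
  ∀ F : Oexp E (Icc c d), BV.mk F = f → ∀ ε : ℝ, 0 < ε → ∀ ζ ∈ fourierDomain c d,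
    HasContourIntegral (contour c d ε)
      (fun z => Complex.exp (-(Complex.I * z * ζ)) • (F : ℂ → E) z) (φ ζ)

/-- `h` is a value of `F⁻¹(F(f) · F(g))`: the functions `F(f)`, `F(g)` exist and the Fourier
transform of `h` is their pointwise product. -/
def IsFourierConvolution {a b c d a' b' : EReal} (B : E₁ →ₗ[ℂ] E₂ →ₗ[ℂ] E)
    (f : BV E₁ (Icc a b)) (g : BV E₂ (Icc c d)) (h : BV E (Icc a' b')) : Prop :=
  ∃ (φ : ℂ → E₁) (ψ : ℂ → E₂), IsFourierTransform f φ ∧ IsFourierTransform g ψ ∧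
    IsFourierTransform h fun ζ => B (φ ζ) (ψ ζ)

/-- `H(z) = ∫_{γ_{[a,b],2n}} F(w) · G(z - w) dw` for all `n ≥ 1` and `z ∈ S_n([a+c, b+d])`, where
`γ_{[a,b],2n}` is the boundary of `U_{2n}([a, b])`, oriented clockwise. -/
def IsContourConvolution (B : E₁ →ₗ[ℂ] E₂ →ₗ[ℂ] E) (a b c d : EReal)
    (F : ℂ → E₁) (G : ℂ → E₂) (H : ℂ → E) : Prop :=
  ∀ n : ℕ, 1 ≤ n → ∀ z ∈ S n (Icc (a + c) (b + d)),
    HasContourIntegral (contour a b (1 / (2 * n : ℝ))) (fun w => B (F w) (G (z - w))) (H z)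

end Transforms

end FourierHyperfunction

/-- Sequential completeness: every Cauchy sequence converges. -/
def IsSequentiallyComplete (E : Type*) [UniformSpace E] : Prop :=
  ∀ u : ℕ → E, CauchySeq u → ∃ x : E, Tendsto u atTop (𝓝 x)

/-!
Everything is reduced to scalar contour integrals by composing with continuous linear functionals
`e`: by Hahn–Banach a continuous seminorm `p` satisfies `p x = sup ‖e x‖` over the functionals
dominated by `p` (`seminorm_le_of_dual`), so that a scalar estimate which is uniform in `e` is a
vector-valued one. Pettis integrals of continuous functions exist by sequential completeness
(`exists_weakIntegral`), and a weakly holomorphic, locally bounded function is holomorphic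
(`holomorphicOn_of_weak`).

The contours around `[c, d]` are replaced by boundaries of rectangles or half-strips `openBox`
around `[c, d]` (`Around`); Cauchy's theorem shows that the integral of a function that is
holomorphic off `[c, d]` and exponentially decreasing towards infinity does not depend on the box
(`rectInt_eq_of_nested`, `cint_contour_eq_rectInt`). In particular the Fourier transform is well
defined, and may be computed over any box (`isFourierTransform_iff`).

The contour convolution `F ⊛ G` exists, does not depend on the width of the contour, and belongs to
`O^exp` (`exists_isContourConvolution`): if `z` runs through `S_n([a + c, b + d])` and `w` through
the contour of width `1 / (2n)` around `[a, b]`, then `z - w` stays in a fixed `S_m([c, d])`.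
Moving both contours to large boxes, exchanging the integrals and substituting `z = u + w` gives
`𝓕(F ⊛ G) = 𝓕 F · 𝓕 G` (`IsContourConvolution.isFourierTransform`).

What remains is the injectivity of the Fourier transform (`IsFourierTransform.eq_of_eqOn`), from
which both the independence of the representatives and the uniqueness of the convolution follow.
Suppose that the Fourier transform of `[F]` vanishes. Writing `1 / (w - z)` as an integral of
`e^{∓iξ(w - z)}` over `ξ > 0`, one sees that the Cauchy integral of `F` with the kernel
`e^{-δ(w - z)} / (w - z)` over the boundary of a box vanishes at all `z` above or below the box
(`cint_cauchyKernel_mul_eq_zero`); here the sign of `δ` is such that the kernel decreases at the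
infinite end of `[c, d]`. Hence in Cauchy's formula for a nonreal `z` lying between a flat box and
a larger one the inner contour does not contribute (`cint_cauchyKernel_mul`), and the integral over
the outer contour extends `F` across `[c, d]`. The extension is bounded by a multiple of
`e^{δ Re z}` in a smaller box and does not depend on `δ`, so that it belongs to `O^exp(ℂ̄, E)`.
-/

namespace FourierHyperfunction

/-! ### Continuous seminorms, functionals and weak integrals -/

section LocallyConvex

/-- A complex vector space that is locally convex over `ℝ` has its topology defined by complex
seminorms. -/
theorem polynormableSpace_complex (E : Type*) [AddCommGroup E] [Module ℂ E] [TopologicalSpace E]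
    [IsTopologicalAddGroup E] [ContinuousSMul ℂ E] [LocallyConvexSpace ℝ E] :
    PolynormableSpace ℂ E := by
  have : ContinuousSMul ℝ E := IsScalarTower.continuousSMul ℂ
  open scoped ComplexOrder in
  have : LocallyConvexSpace ℂ E := by
    refine ⟨fun x => (LocallyConvexSpace.convex_basis (𝕜 := ℝ) x).to_hasBasis ?_ ?_⟩
    · rintro s ⟨hs, hc⟩
      exact ⟨s, ⟨hs, convex_of_nonneg_surjective_algebraMap _
        (fun _ h => RCLike.nonneg_iff_exists_ofReal.mp h) hc⟩, subset_rfl⟩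
    · rintro s ⟨hs, hc⟩
      exact ⟨s, ⟨hs, hc.lift ℝ⟩, subset_rfl⟩
  exact LocallyConvexSpace.toPolynormableSpace

theorem seminorm_dual_continuous {E : Type*} [AddCommGroup E] [Module ℂ E] [TopologicalSpace E]
    (e : E →L[ℂ] ℂ) : ∃ p : Seminorm ℂ E, Continuous p ∧ ∀ x, p x = ‖e x‖ :=
  ⟨(normSeminorm ℂ ℂ).comp e.toLinearMap, e.continuous.norm, fun _ => rfl⟩

section Topological

variable {E : Type*} [AddCommGroup E] [Module ℂ E] [TopologicalSpace E] [PolynormableSpace ℂ E]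

/-- A continuous seminorm is the supremum of the moduli of the functionals that it dominates. -/
theorem exists_dual_eq_seminorm {p : Seminorm ℂ E} (hp : Continuous p) (x : E) :
    ∃ e : E →L[ℂ] ℂ, (∀ y, ‖e y‖ ≤ p y) ∧ e x = p x := by
  by_cases hx : x = 0
  · exact ⟨0, by simp, by simp [hx]⟩
  have key : ∀ y : Submodule.span ℂ {x}, ∃ t : ℂ, t • x = y := fun y =>
    Submodule.mem_span_singleton.1 y.2
  let f : Module.Dual ℂ (Submodule.span ℂ {x}) :=
    (p x : ℂ) • (LinearEquiv.toSpanNonzeroSingleton ℂ E x hx).symm.toLinearMap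
  have hf : ∀ t : ℂ, ∀ h : t • x ∈ Submodule.span ℂ {x}, f ⟨t • x, h⟩ = t * p x := by
    intro t h
    have h1 : (LinearEquiv.toSpanNonzeroSingleton ℂ E x hx).symm ⟨t • x, h⟩ = t := by
      rw [LinearEquiv.symm_apply_eq]
      rfl
    simp only [f, LinearMap.smul_apply, LinearEquiv.coe_coe, h1, smul_eq_mul, mul_comm]
  obtain ⟨e, he, hle⟩ := Module.Dual.exists_continuous_extension_of_le_seminorm
    (Submodule.span ℂ {x}) f hp (by
      rintro ⟨y, hy⟩
      obtain ⟨t, rfl⟩ := Submodule.mem_span_singleton.1 hy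
      rw [hf]
      simp [map_smul_eq_mul, abs_of_nonneg (apply_nonneg p x)])
  refine ⟨e, hle, ?_⟩
  have h := he ⟨x, Submodule.mem_span_singleton_self x⟩
  have h2 := hf 1 (by simp)
  simp only [one_smul, one_mul] at h2
  rw [← h2, ← h]

theorem seminorm_le_of_dual {p : Seminorm ℂ E} (hp : Continuous p) {x : E} {C : ℝ}
    (h : ∀ e : E →L[ℂ] ℂ, (∀ y, ‖e y‖ ≤ p y) → ‖e x‖ ≤ C) : p x ≤ C := by
  obtain ⟨e, he, hx⟩ := exists_dual_eq_seminorm hp x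
  have := h e he
  rwa [hx, Complex.norm_real, Real.norm_of_nonneg (apply_nonneg p x)] at this

theorem eq_of_dual_eq [T2Space E] {x y : E} (h : ∀ e : E →L[ℂ] ℂ, e x = e y) : x = y := by
  by_contra hxy
  obtain ⟨⟨p, hp⟩, hpx⟩ := (PolynormableSpace.withSeminorms ℂ E).separating_of_T1 (x - y)
    (sub_ne_zero.2 hxy)
  obtain ⟨e, -, he⟩ := exists_dual_eq_seminorm hp (x - y)
  apply hpx
  rw [map_sub, h e, sub_self] at he
  exact_mod_cast he.symm

end Topological

variable {E : Type*} [AddCommGroup E] [Module ℂ E] [UniformSpace E] [IsUniformAddGroup E]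
  [PolynormableSpace ℂ E]

theorem tendsto_iff_seminorm {ι : Type*} {u : ι → E} {l : Filter ι} {x : E} :
    Tendsto u l (𝓝 x) ↔ ∀ p : Seminorm ℂ E, Continuous p →
      Tendsto (fun i => p (u i - x)) l (𝓝 0) := by
  constructor
  · intro h p hp
    have h1 : Tendsto (fun i => u i - x) l (𝓝 0) := by
      simpa using h.sub_const x
    have h2 := (hp.tendsto 0).comp h1
    simpa [Function.comp_def] using h2
  · intro h
    rw [(PolynormableSpace.withSeminorms ℂ E).tendsto_nhds]
    rintro ⟨p, hp⟩ ε hε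
    exact (h p hp).eventually (gt_mem_nhds hε)

theorem cauchySeq_of_seminorm {u : ℕ → E}
    (h : ∀ p : Seminorm ℂ E, Continuous p → ∀ ε > 0, ∃ N, ∀ n ≥ N, ∀ m ≥ N, p (u n - u m) < ε) :
    CauchySeq u := by
  rw [cauchySeq_iff_tendsto, uniformity_eq_comap_nhds_zero, tendsto_comap_iff,
    (PolynormableSpace.withSeminorms ℂ E).tendsto_nhds]
  rintro ⟨p, hp⟩ ε hε
  obtain ⟨N, hN⟩ := h p hp ε hε
  filter_upwards [eventually_ge_atTop (N, N)] with x hx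
  simpa [Function.comp_def] using hN x.2 hx.2 x.1 hx.1

end LocallyConvex

section WeakIntegral

variable {E : Type*} [AddCommGroup E] [Module ℂ E] [UniformSpace E] [IsUniformAddGroup E]
  [PolynormableSpace ℂ E]

/-- Riemann sums: a continuous function on a compact subset of the line has a weak integral in a
sequentially complete space. -/
theorem exists_weakIntegral_of_isCompact (hE : IsSequentiallyComplete E) {s : Set ℝ}
    (hs : IsCompact s) {f : ℝ → E} (hf : ContinuousOn f s) :
    ∃ v : E, ∀ e : E →L[ℂ] ℂ, ∫ t in s, e (f t) = e v := by
  classical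
  obtain ⟨N, hN⟩ : ∃ N : ℕ, ∀ t ∈ s, |t| ≤ N := by
    obtain ⟨R, hR⟩ := hs.isBounded.exists_norm_le
    obtain ⟨N, hN⟩ := exists_nat_ge R
    exact ⟨N, fun t ht => (hR t ht).trans hN⟩
  have hsm : MeasurableSet s := hs.measurableSet
  have hsμ : volume s ≠ ⊤ := hs.measure_lt_top.ne
  -- a tag in `s` for each cell of the mesh `1 / n` that meets `s`
  let tag : ℕ → ℤ → ℝ := fun n i =>
    if h : ∃ t ∈ s, ⌊(n : ℝ) * t⌋ = i then h.choose else 0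
  have htag : ∀ n : ℕ, 0 < n → ∀ t ∈ s, tag n ⌊(n : ℝ) * t⌋ ∈ s ∧
      |tag n ⌊(n : ℝ) * t⌋ - t| ≤ 1 / n := by
    intro n hn t ht
    have h : ∃ t' ∈ s, ⌊(n : ℝ) * t'⌋ = ⌊(n : ℝ) * t⌋ := ⟨t, ht, rfl⟩
    have h1 : tag n ⌊(n : ℝ) * t⌋ = h.choose := dif_pos h
    rw [h1]
    refine ⟨h.choose_spec.1, ?_⟩
    have h2 := Int.abs_sub_lt_one_of_floor_eq_floor h.choose_spec.2
    have hn' : (0 : ℝ) < n := by exact_mod_cast hn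
    rw [← mul_sub, abs_mul, abs_of_pos hn'] at h2
    rw [le_div_iff₀ hn']
    linarith
  let J : ℕ → Finset ℤ := fun n => Finset.Icc (-(n * N : ℤ)) (n * N)
  let cell : ℕ → ℤ → Set ℝ := fun n i => {t | ⌊(n : ℝ) * t⌋ = i}
  have hcell : ∀ n i, MeasurableSet (cell n i) := fun n i =>
    (Int.measurable_floor.comp (measurable_const_mul (n : ℝ))) (measurableSet_singleton i)
  -- the Riemann sums; `e (u n)` is the integral of the step function `t ↦ e (f (tag of t))`
  let u : ℕ → E := fun n =>
    ∑ i ∈ J n, ((volume.real (s ∩ cell n i) : ℝ) : ℂ) • f (tag n i)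
  have hu : ∀ n, ∀ e : E →L[ℂ] ℂ, IntegrableOn (fun t => e (f (tag n ⌊(n : ℝ) * t⌋))) s ∧
      ∫ t in s, e (f (tag n ⌊(n : ℝ) * t⌋)) = e (u n) := by
    intro n e
    have h1 : ∀ t ∈ s, e (f (tag n ⌊(n : ℝ) * t⌋)) =
        ∑ i ∈ J n, (cell n i).indicator (fun _ => e (f (tag n i))) t := by
      intro t ht
      have hmem : ⌊(n : ℝ) * t⌋ ∈ J n := by
        have h2 := abs_le.1 (hN t ht)
        have hn : (0 : ℝ) ≤ n := Nat.cast_nonneg n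
        rw [Finset.mem_Icc]
        constructor
        · rw [Int.le_floor]; push_cast; nlinarith [h2.1]
        · have : (⌊(n : ℝ) * t⌋ : ℝ) ≤ n * N := (Int.floor_le _).trans (by nlinarith [h2.2])
          exact_mod_cast this
      rw [Finset.sum_eq_single_of_mem _ hmem]
      · rw [indicator_of_mem]; rfl
      · intro i _ hi
        rw [indicator_of_notMem]
        exact fun h => hi h.symm
    have h3 : ∀ i ∈ J n, IntegrableOn
        (fun t => (cell n i).indicator (fun _ => e (f (tag n i))) t) s := fun i _ =>
      (integrableOn_const hsμ).indicator (hcell n i)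
    refine ⟨?_, ?_⟩
    · exact (integrable_finsetSum _ h3).congr
        ((ae_restrict_iff' hsm).2 (ae_of_all _ fun t ht => (h1 t ht).symm))
    · rw [setIntegral_congr_fun hsm h1, integral_finsetSum _ h3, map_sum]
      refine Finset.sum_congr rfl fun i _ => ?_
      rw [integral_indicator_const _ (hcell n i), map_smul, measureReal_restrict_apply (hcell n i),
        inter_comm]
      simp
  have hint : ∀ e : E →L[ℂ] ℂ, IntegrableOn (fun t => e (f t)) s := fun e =>
    (e.continuous.comp_continuousOn hf).integrableOn_compact hs
  have hM : 0 < volume.real s + 1 := by positivity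
  -- Uniform continuity bounds the error of the Riemann sums uniformly in the functionals dominated
  -- by `p`; hence the sums form a Cauchy sequence.
  have happrox : ∀ p : Seminorm ℂ E, Continuous p → ∀ ε > 0, ∃ N₀, ∀ n ≥ N₀, ∀ e : E →L[ℂ] ℂ,
      (∀ y, ‖e y‖ ≤ p y) → ‖e (u n) - ∫ t in s, e (f t)‖ ≤ ε := by
    intro p hp ε hε
    have huc := hs.uniformContinuousOn_of_continuous hf
    have hU : {x : E × E | p (x.2 - x.1) < ε / (volume.real s + 1)} ∈ uniformity E := by
      rw [uniformity_eq_comap_nhds_zero]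
      refine ⟨{x | p x < ε / (volume.real s + 1)}, ?_, fun x hx => hx⟩
      exact (isOpen_lt hp continuous_const).mem_nhds (by simp; positivity)
    obtain ⟨δ, hδ, hδ'⟩ : ∃ δ > 0, ∀ ⦃x y : ℝ⦄, dist x y < δ → (x, y) ∈ s ×ˢ s →
        p (f y - f x) < ε / (volume.real s + 1) := by
      have := huc hU
      rw [mem_map, mem_inf_principal, Metric.mem_uniformity_dist] at this
      exact this
    obtain ⟨N₀, hN₀⟩ := exists_nat_one_div_lt hδ
    refine ⟨N₀ + 1, fun n hn e he => ?_⟩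
    rw [← (hu n e).2, ← integral_sub (hu n e).1 (hint e)]
    have hn0 : 0 < n := by omega
    have hb : ∀ t ∈ s, ‖e (f (tag n ⌊(n : ℝ) * t⌋)) - e (f t)‖ ≤ ε / (volume.real s + 1) := by
      intro t ht
      obtain ⟨h1, h2⟩ := htag n hn0 t ht
      rw [← map_sub]
      refine (he _).trans (le_of_lt ?_)
      refine @hδ' t (tag n ⌊(n : ℝ) * t⌋) ?_ ⟨ht, h1⟩
      rw [dist_comm, Real.dist_eq]
      refine h2.trans_lt (lt_of_le_of_lt ?_ hN₀)
      apply one_div_le_one_div_of_le (by positivity)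
      exact_mod_cast hn
    refine (norm_setIntegral_le_of_norm_le_const hs.measure_lt_top hb).trans ?_
    rw [div_mul_eq_mul_div, div_le_iff₀ hM]
    nlinarith [measureReal_nonneg (μ := volume) (s := s)]
  obtain ⟨v, hv⟩ := hE u (cauchySeq_of_seminorm fun p hp ε hε => by
    obtain ⟨N₀, hN₀⟩ := happrox p hp (ε / 4) (by positivity)
    refine ⟨N₀, fun n hn m hm => lt_of_le_of_lt (seminorm_le_of_dual hp (C := ε / 2) fun e he => ?_)
      (by linarith)⟩
    have h1 := hN₀ n hn e he
    have h2 := hN₀ m hm e he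
    rw [map_sub]
    calc ‖e (u n) - e (u m)‖
        = ‖(e (u n) - ∫ t in s, e (f t)) - (e (u m) - ∫ t in s, e (f t))‖ := by
          congr 1; ring
      _ ≤ _ := norm_sub_le _ _
      _ ≤ ε / 2 := by linarith)
  refine ⟨v, fun e => ?_⟩
  obtain ⟨p, hp, hpe⟩ := seminorm_dual_continuous e
  have h1 : Tendsto (fun n => e (u n)) atTop (𝓝 (e v)) := (e.continuous.tendsto v).comp hv
  refine tendsto_nhds_unique ?_ h1
  rw [Metric.tendsto_atTop]
  intro ε hε
  obtain ⟨N₀, hN₀⟩ := happrox p hp (ε / 2) (by positivity)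
  refine ⟨N₀, fun n hn => ?_⟩
  rw [dist_eq_norm]
  have := hN₀ n hn e (fun y => (hpe y).ge)
  linarith

/-- A continuous function on a closed subset of the line, dominated in each continuous seminorm by
an integrable function, has a weak integral in a sequentially complete space. -/
theorem exists_weakIntegral (hE : IsSequentiallyComplete E) {s : Set ℝ} (hs : IsClosed s)
    {f : ℝ → E} (hf : ContinuousOn f s)
    (hdom : ∀ p : Seminorm ℂ E, Continuous p →
      ∃ g : ℝ → ℝ, IntegrableOn g s ∧ ∀ t ∈ s, p (f t) ≤ g t) :
    ∃ v : E, ∀ e : E →L[ℂ] ℂ, IntegrableOn (fun t => e (f t)) s ∧ ∫ t in s, e (f t) = e v := by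
  have hsm := hs.measurableSet
  have hint : ∀ e : E →L[ℂ] ℂ, IntegrableOn (fun t => e (f t)) s := by
    intro e
    obtain ⟨p, hp, hpe⟩ := seminorm_dual_continuous e
    obtain ⟨g, hg, hgf⟩ := hdom p hp
    refine Integrable.mono' hg
      ((e.continuous.comp_continuousOn hf).aestronglyMeasurable hsm) ?_
    exact (ae_restrict_iff' hsm).2 (ae_of_all _ fun t ht => (hpe _).ge.trans (hgf t ht))
  -- Exhaust `s` by compact sets; the difference of two of the integrals is controlled by `g`.
  let K : ℕ → Set ℝ := fun n => s ∩ Icc (-(n : ℝ)) n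
  have hKc : ∀ n, IsCompact (K n) := fun n => isCompact_Icc.inter_left hs
  have hKmono : Monotone K := fun m n hmn => inter_subset_inter_right _
    (Icc_subset_Icc (by simpa using hmn) (by simpa using hmn))
  have hKU : ⋃ n, K n = s := by
    rw [← inter_iUnion]
    refine inter_eq_left.2 fun t _ => ?_
    obtain ⟨n, hn⟩ := exists_nat_ge |t|
    exact mem_iUnion.2 ⟨n, abs_le.1 hn⟩
  have hlim : ∀ {F : Type} [NormedAddCommGroup F] [NormedSpace ℝ F] (h : ℝ → F),
      IntegrableOn h s → Tendsto (fun n => ∫ t in K n, h t) atTop (𝓝 (∫ t in s, h t)) := by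
    intro F _ _ h hh
    have := tendsto_setIntegral_of_monotone (μ := volume) (f := h)
      (fun n => (hKc n).measurableSet) hKmono (by rwa [hKU])
    rwa [hKU] at this
  choose u hu using fun n => exists_weakIntegral_of_isCompact hE (hKc n)
    (hf.mono inter_subset_left)
  obtain ⟨v, hv⟩ := hE u (cauchySeq_of_seminorm fun p hp ε hε => by
    obtain ⟨g, hg, hgf⟩ := hdom p hp
    have hc := (hlim g hg).cauchySeq
    obtain ⟨N, hN⟩ := Metric.cauchySeq_iff.1 hc (ε / 2) (by positivity)
    have key : ∀ n ≥ N, ∀ m ≥ N, m ≤ n → p (u n - u m) ≤ ε / 2 := by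
      intro n hn m hm hmn
      refine seminorm_le_of_dual hp fun e he => ?_
      rw [map_sub, ← hu n e, ← hu m e]
      have h1 : ∀ {F : Type} [NormedAddCommGroup F] [NormedSpace ℝ F] (h : ℝ → F),
          IntegrableOn h s → (∫ t in K n, h t) - ∫ t in K m, h t = ∫ t in K n \ K m, h t := by
        intro F _ _ h hh
        rw [setIntegral_sdiff (hKc m).measurableSet (hh.mono_set inter_subset_left) (hKmono hmn)]
      have h2 := hN n hn m hm
      rw [Real.dist_eq, h1 g hg] at h2
      rw [h1 _ (hint e)]
      have hmeas : MeasurableSet (K n \ K m) := (hKc n).measurableSet.diff (hKc m).measurableSet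
      have hsub : K n \ K m ⊆ s := sdiff_subset.trans inter_subset_left
      refine (norm_integral_le_of_norm_le (hg.mono_set hsub)
        ((ae_restrict_iff' hmeas).2 (ae_of_all _ fun t ht => ?_))).trans
          ((le_abs_self _).trans h2.le)
      exact (he _).trans (hgf t (hsub ht))
    refine ⟨N, fun n hn m hm => ?_⟩
    rcases le_total m n with h | h
    · exact (key n hn m hm h).trans_lt (by linarith)
    · have := key m hm n hn h
      rw [map_sub_rev]
      linarith)
  refine ⟨v, fun e => ⟨hint e, ?_⟩⟩
  refine tendsto_nhds_unique (hlim _ (hint e)) ?_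
  simp_rw [hu]
  exact (e.continuous.tendsto v).comp hv

end WeakIntegral

/-! ### Weak and strong holomorphy -/

section Holomorphy

theorem HolomorphicOn.differentiableAt_dual {E : Type*} [AddCommGroup E] [Module ℂ E]
    [TopologicalSpace E] {f : ℂ → E} {Ω : Set ℂ} (hf : HolomorphicOn f Ω) (e : E →L[ℂ] ℂ) {z : ℂ}
    (hz : z ∈ Ω) : DifferentiableAt ℂ (fun w => e (f w)) z := by
  obtain ⟨f', hf'⟩ := hf z hz
  have h : HasDerivAt (fun w => e (f w)) (e f') z := by
    rw [hasDerivAt_iff_tendsto_slope]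
    have h1 := (e.continuous.tendsto f').comp hf'
    refine h1.congr fun w => ?_
    simp [slope]
  exact h.differentiableAt

theorem HolomorphicOn.continuousAt {E : Type*} [AddCommGroup E] [Module ℂ E]
    [TopologicalSpace E] [IsTopologicalAddGroup E] [ContinuousSMul ℂ E] {f : ℂ → E} {Ω : Set ℂ}
    (hf : HolomorphicOn f Ω) {z : ℂ} (hz : z ∈ Ω) : ContinuousAt f z := by
  obtain ⟨f', hf'⟩ := hf z hz
  rw [continuousAt_iff_punctured_nhds]
  have h1 : Tendsto (fun w => (w - z) • slope f z w + f z) (𝓝[≠] z) (𝓝 ((z - z) • f' + f z)) :=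
    (((continuous_id.sub continuous_const).tendsto z |>.mono_left nhdsWithin_le_nhds).smul
      hf').add_const (f z)
  simp only [sub_self, zero_smul, zero_add] at h1
  refine h1.congr fun w => ?_
  rw [sub_smul_slope]
  simp

/-- The difference quotients of a bounded holomorphic function on a disc are Lipschitz near the
centre, with a constant that depends only on the bound and the radius. -/
theorem norm_dslope_sub_dslope_le {g : ℂ → ℂ} {z : ℂ} {r C : ℝ} (hr : 0 < r)
    (hg : DifferentiableOn ℂ g (Metric.ball z r)) (hC : ∀ w ∈ Metric.ball z r, ‖g w‖ ≤ C)
    {w₁ w₂ : ℂ} (h₁ : w₁ ∈ Metric.ball z (r / 4)) (h₂ : w₂ ∈ Metric.ball z (r / 4)) :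
    ‖dslope g z w₁ - dslope g z w₂‖ ≤ 32 * C / r ^ 2 * ‖w₁ - w₂‖ := by
  have cauchy : ∀ {h : ℂ → ℂ} {ρ M : ℝ}, 0 < ρ → DifferentiableOn ℂ h (Metric.ball z (2 * ρ)) →
      (∀ w ∈ Metric.ball z (2 * ρ), ‖h w‖ ≤ M) → ∀ w ∈ Metric.ball z ρ,
      ‖deriv h w‖ ≤ 2 * M / ρ := by
    intro h ρ M hρ hh hM w hw
    have hsub : Metric.closedBall w (ρ / 2) ⊆ Metric.ball z (2 * ρ) := by
      intro x hx
      rw [Metric.mem_closedBall] at hx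
      rw [Metric.mem_ball] at hw ⊢
      linarith [dist_triangle x w z]
    have h1 := Complex.norm_deriv_le_of_forall_mem_sphere_norm_le (f := h) (c := w) (R := ρ / 2)
      (C := M) (by positivity)
      ((hh.mono hsub).diffContOnCl_ball subset_rfl)
      (fun x hx => hM x (hsub (Metric.sphere_subset_closedBall hx)))
    calc ‖deriv h w‖ ≤ M / (ρ / 2) := h1
      _ = 2 * M / ρ := by field_simp
  have h2 : 2 * (r / 2) = r := by ring
  have h4 : 2 * (r / 4) = r / 2 := by ring
  have hz : Metric.ball z r ∈ 𝓝 z := Metric.ball_mem_nhds z hr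
  have hd : DifferentiableOn ℂ (dslope g z) (Metric.ball z r) :=
    (Complex.differentiableOn_dslope hz).2 hg
  have hg1 : ∀ w ∈ Metric.ball z (r / 2), ‖deriv g w‖ ≤ 2 * C / (r / 2) :=
    cauchy (by positivity) (by rwa [h2]) (by rwa [h2])
  have hd1 : ∀ w ∈ Metric.ball z (r / 2), ‖dslope g z w‖ ≤ 4 * C / r := by
    intro w hw
    have hzz : z ∈ Metric.ball z (r / 2) := Metric.mem_ball_self (by positivity)
    have h4 : 2 * C / (r / 2) = 4 * C / r := by field_simp; ring
    rcases eq_or_ne w z with rfl | hne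
    · rw [dslope_same, ← h4]
      exact hg1 _ hzz
    · rw [dslope_of_ne _ hne, slope_def_field, norm_div, div_le_iff₀ (norm_pos_iff.2
        (sub_ne_zero.2 hne)), ← h4]
      refine (convex_ball z (r / 2)).norm_image_sub_le_of_norm_deriv_le (fun x hx => ?_)
        (fun x hx => hg1 x hx) hzz hw
      exact hg.differentiableAt (Metric.isOpen_ball.mem_nhds
        (Metric.ball_subset_ball (by linarith) hx))
  have hd2 : ∀ w ∈ Metric.ball z (r / 4), ‖deriv (dslope g z) w‖ ≤ 2 * (4 * C / r) / (r / 4) :=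
    cauchy (by positivity) (hd.mono (Metric.ball_subset_ball (by linarith)))
      (by rwa [h4])
  have h5 : 2 * (4 * C / r) / (r / 4) = 32 * C / r ^ 2 := by field_simp; ring
  rw [← h5]
  refine (convex_ball z (r / 4)).norm_image_sub_le_of_norm_deriv_le (fun x hx => ?_)
    (fun x hx => hd2 x hx) h₂ h₁
  exact hd.differentiableAt (Metric.isOpen_ball.mem_nhds
    (Metric.ball_subset_ball (by linarith) hx))

/-- In a sequentially complete space, a locally bounded weakly holomorphic function is
holomorphic. -/
theorem holomorphicOn_of_weak {E : Type*} [AddCommGroup E] [Module ℂ E] [UniformSpace E]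
    [IsUniformAddGroup E] [PolynormableSpace ℂ E] (hE : IsSequentiallyComplete E) {f : ℂ → E}
    {Ω : Set ℂ} (hΩ : IsOpen Ω)
    (hf : ∀ e : E →L[ℂ] ℂ, DifferentiableOn ℂ (fun w => e (f w)) Ω)
    (hb : ∀ p : Seminorm ℂ E, Continuous p → ∀ z ∈ Ω, ∃ C : ℝ, ∀ᶠ w in 𝓝 z, p (f w) ≤ C) :
    HolomorphicOn f Ω := by
  intro z hz
  -- The difference quotients are Lipschitz in each seminorm, uniformly in the functionals, so they
  -- converge along a sequence tending to `z`, and then also as a whole.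
  have key : ∀ p : Seminorm ℂ E, Continuous p → ∃ r > 0, ∃ L : ℝ, 0 ≤ L ∧
      ∀ w₁ ∈ Metric.ball z r, ∀ w₂ ∈ Metric.ball z r, w₁ ≠ z → w₂ ≠ z →
        p (slope f z w₁ - slope f z w₂) ≤ L * ‖w₁ - w₂‖ := by
    intro p hp
    obtain ⟨C, hC⟩ := hb p hp z hz
    obtain ⟨r, hr, hrs⟩ := Metric.mem_nhds_iff.1 (inter_mem hC (hΩ.mem_nhds hz))
    have hC0 : 0 ≤ C := (apply_nonneg p _).trans (hrs (Metric.mem_ball_self hr)).1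
    refine ⟨r / 4, by positivity, 32 * C / r ^ 2, by positivity,
      fun w₁ h₁ w₂ h₂ hn₁ hn₂ => seminorm_le_of_dual hp fun e he => ?_⟩
    have h := norm_dslope_sub_dslope_le hr ((hf e).mono fun w hw => (hrs hw).2)
      (fun w hw => (he _).trans (hrs hw).1) h₁ h₂
    rw [dslope_of_ne _ hn₁, dslope_of_ne _ hn₂] at h
    convert h using 2
    simp [slope, mul_sub]
  let w : ℕ → ℂ := fun n => z + ((1 / ((n : ℝ) + 1) : ℝ) : ℂ)
  have hwz : ∀ n, w n ≠ z := by
    intro n h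
    have h1 : ((1 / ((n : ℝ) + 1) : ℝ) : ℂ) = 0 := by simpa [w] using h
    have h2 : (1 / ((n : ℝ) + 1) : ℝ) = 0 := by exact_mod_cast h1
    have : (0 : ℝ) < 1 / ((n : ℝ) + 1) := by positivity
    linarith
  have hwt : Tendsto w atTop (𝓝 z) := by
    have h1 : Tendsto (fun n : ℕ => ((1 / ((n : ℝ) + 1) : ℝ) : ℂ)) atTop (𝓝 ((0 : ℝ) : ℂ)) :=
      (Complex.continuous_ofReal.tendsto 0).comp tendsto_one_div_add_atTop_nhds_zero_nat
    simpa [w] using h1.const_add z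
  obtain ⟨f', hf'⟩ := hE (fun n => slope f z (w n)) (cauchySeq_of_seminorm fun p hp ε hε => by
    obtain ⟨r, hr, L, hL, h⟩ := key p hp
    have hε' : 0 < ε / (2 * (L + 1)) := by positivity
    obtain ⟨N, hN⟩ := Metric.tendsto_atTop.1 hwt (min r (ε / (2 * (L + 1)))) (lt_min hr hε')
    refine ⟨N, fun n hn m hm => ?_⟩
    have h1 := hN n hn
    have h2 := hN m hm
    have h3 := h (w n) (h1.trans_le (min_le_left _ _)) (w m) (h2.trans_le (min_le_left _ _))
      (hwz n) (hwz m)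
    have h4 : ‖w n - w m‖ < ε / (L + 1) := by
      rw [← dist_eq_norm]
      have h5 : ε / (2 * (L + 1)) + ε / (2 * (L + 1)) = ε / (L + 1) := by field_simp; ring
      linarith [dist_triangle_right (w n) (w m) z, min_le_right r (ε / (2 * (L + 1)))]
    refine h3.trans_lt ?_
    rw [lt_div_iff₀ (by positivity)] at h4
    nlinarith [norm_nonneg (w n - w m)])
  refine ⟨f', tendsto_iff_seminorm.2 fun p hp => ?_⟩
  obtain ⟨r, hr, L, hL, h⟩ := key p hp
  have hle : ∀ x ∈ Metric.ball z r, x ≠ z → p (slope f z x - f') ≤ L * ‖x - z‖ := by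
    intro x hx hxz
    have h1 : Tendsto (fun n => p (slope f z x - slope f z (w n))) atTop
        (𝓝 (p (slope f z x - f'))) := (hp.tendsto _).comp (hf'.const_sub _)
    have h2 : Tendsto (fun n => L * ‖x - w n‖) atTop (𝓝 (L * ‖x - z‖)) :=
      ((hwt.const_sub x).norm).const_mul L
    refine le_of_tendsto_of_tendsto h1 h2 ?_
    filter_upwards [hwt (Metric.ball_mem_nhds z hr)] with n hn
    exact h x hx (w n) hn hxz (hwz n)
  have h0 : Tendsto (fun x => L * ‖x - z‖) (𝓝[≠] z) (𝓝 0) := by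
    have h1 : Continuous fun x : ℂ => L * ‖x - z‖ := by fun_prop
    have h2 := h1.tendsto z
    simp only [sub_self, norm_zero, mul_zero] at h2
    exact h2.mono_left nhdsWithin_le_nhds
  refine tendsto_of_tendsto_of_tendsto_of_le_of_le' tendsto_const_nhds h0
    (Eventually.of_forall fun _ => apply_nonneg p _) ?_
  filter_upwards [self_mem_nhdsWithin, nhdsWithin_le_nhds (Metric.ball_mem_nhds z hr)] with x hx hx'
  exact hle x hx' hx

end Holomorphy

/-! ### Integration along lists of arcs -/

section ArcIntegrals

/-- The integral of a scalar function along an arc. -/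
noncomputable def arcInt (A : Arc) (f : ℂ → ℂ) : ℂ :=
  ∫ t in A.dom, deriv A.path t * f (A.path t)

/-- The integral of a scalar function along a list of arcs. -/
noncomputable def cint (γ : List Arc) (f : ℂ → ℂ) : ℂ :=
  (γ.map fun A => arcInt A f).sum

/-- The set of points traversed by a list of arcs. -/
def support (γ : List Arc) : Set ℂ :=
  {z | ∃ A ∈ γ, ∃ t ∈ A.dom, A.path t = z}

/-- An arc along which every continuous function that decays exponentially in the real direction
is integrable. -/
structure Arc.Tame (A : Arc) : Prop where
  isClosed_dom : IsClosed A.dom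
  contDiff : ContDiff ℝ 1 A.path
  deriv_le : ∃ L : ℝ, ∀ t, ‖deriv A.path t‖ ≤ L
  integrable : ∀ δ : ℝ, 0 < δ → IntegrableOn (fun t => Real.exp (-δ * |(A.path t).re|)) A.dom

/-- All arcs in the list are tame. -/
def TameContour (γ : List Arc) : Prop := ∀ A ∈ γ, A.Tame

theorem Arc.Tame.continuous_deriv {A : Arc} (hA : A.Tame) : Continuous (deriv A.path) :=
  hA.contDiff.continuous_deriv le_rfl

theorem mem_support {γ : List Arc} {A : Arc} (hA : A ∈ γ) {t : ℝ} (ht : t ∈ A.dom) :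
    A.path t ∈ support γ := ⟨A, hA, t, ht, rfl⟩

theorem Arc.Tame.continuousOn_integrand {A : Arc} (hA : A.Tame) {f : ℂ → ℂ}
    (hf : ContinuousOn f (A.path '' A.dom)) :
    ContinuousOn (fun t => deriv A.path t * f (A.path t)) A.dom :=
  hA.continuous_deriv.continuousOn.mul
    (hf.comp hA.contDiff.continuous.continuousOn (mapsTo_image _ _))

theorem Arc.Tame.integrableOn {A : Arc} (hA : A.Tame) {f : ℂ → ℂ}
    (hf : ContinuousOn f (A.path '' A.dom)) {C δ : ℝ} (hδ : 0 < δ)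
    (hb : ∀ t ∈ A.dom, ‖f (A.path t)‖ ≤ C * Real.exp (-δ * |(A.path t).re|)) :
    IntegrableOn (fun t => deriv A.path t * f (A.path t)) A.dom := by
  obtain ⟨L, hL⟩ := hA.deriv_le
  refine Integrable.mono' (((hA.integrable δ hδ).const_mul C).const_mul L)
    ((hA.continuousOn_integrand hf).aestronglyMeasurable hA.isClosed_dom.measurableSet)
    ((ae_restrict_iff' hA.isClosed_dom.measurableSet).2 (ae_of_all _ fun t ht => ?_))
  rw [norm_mul]
  exact mul_le_mul (hL t) (hb t ht) (norm_nonneg _) ((norm_nonneg _).trans (hL t))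

theorem cint_congr {γ : List Arc} (hγ : TameContour γ) {f g : ℂ → ℂ}
    (h : ∀ z ∈ support γ, f z = g z) : cint γ f = cint γ g := by
  unfold cint
  congr 1
  refine List.map_congr_left fun A hA => ?_
  exact setIntegral_congr_fun (hγ A hA).isClosed_dom.measurableSet fun t ht => by
    simp only [h _ (mem_support hA ht)]

theorem cint_const_mul (γ : List Arc) (c : ℂ) (f : ℂ → ℂ) :
    cint γ (fun z => c * f z) = c * cint γ f := by
  unfold cint
  rw [← List.sum_map_mul_left]
  congr 1
  refine List.map_congr_left fun A _ => ?_
  unfold arcInt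
  rw [← integral_const_mul]
  congr 1
  funext t
  ring

/-- A bound that makes a function integrable along tame contours. -/
def ExpDecayOn (f : ℂ → ℂ) (Z : Set ℂ) : Prop :=
  ∃ C δ : ℝ, 0 < δ ∧ ∀ z ∈ Z, ‖f z‖ ≤ C * Real.exp (-δ * |z.re|)

theorem ExpDecayOn.mono {f : ℂ → ℂ} {Z W : Set ℂ} (h : ExpDecayOn f W) (hZ : Z ⊆ W) :
    ExpDecayOn f Z := by
  obtain ⟨C, δ, hδ, hC⟩ := h
  exact ⟨C, δ, hδ, fun z hz => hC z (hZ hz)⟩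

theorem integrableOn_of_expDecayOn {γ : List Arc} (hγ : TameContour γ) {f : ℂ → ℂ}
    (hf : ContinuousOn f (support γ)) (hd : ExpDecayOn f (support γ)) :
    ∀ A ∈ γ, IntegrableOn (fun t => deriv A.path t * f (A.path t)) A.dom := by
  intro A hA
  obtain ⟨C, δ, hδ, h⟩ := hd
  refine (hγ A hA).integrableOn (hf.mono ?_) hδ fun t ht => h _ (mem_support hA ht)
  rintro _ ⟨t, ht, rfl⟩
  exact mem_support hA ht

theorem cint_sub {γ : List Arc} {f g : ℂ → ℂ}
    (hf : ∀ A ∈ γ, IntegrableOn (fun t => deriv A.path t * f (A.path t)) A.dom)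
    (hg : ∀ A ∈ γ, IntegrableOn (fun t => deriv A.path t * g (A.path t)) A.dom) :
    cint γ (fun z => f z - g z) = cint γ f - cint γ g := by
  induction γ with
  | nil => simp [cint]
  | cons A γ ih =>
    have ih := ih (fun A' h => hf A' (List.mem_cons_of_mem _ h))
      (fun A' h => hg A' (List.mem_cons_of_mem _ h))
    have h : arcInt A (fun z => f z - g z) = arcInt A f - arcInt A g := by
      unfold arcInt
      simp only [mul_sub]
      exact integral_sub (hf A List.mem_cons_self) (hg A List.mem_cons_self)
    simp only [cint, List.map_cons, List.sum_cons] at ih ⊢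
    rw [h, ih]
    ring

/-- The total mass of `e^{-δ |Re z|} |dz|` along a contour. -/
noncomputable def expMass (γ : List Arc) (δ : ℝ) : ℝ :=
  (γ.map fun A => ∫ t in A.dom, ‖deriv A.path t‖ * Real.exp (-δ * |(A.path t).re|)).sum

theorem expMass_nonneg (γ : List Arc) (δ : ℝ) : 0 ≤ expMass γ δ := by
  refine List.sum_nonneg fun x hx => ?_
  obtain ⟨A, -, rfl⟩ := List.mem_map.1 hx
  exact integral_nonneg fun t => by positivity

theorem norm_cint_le {γ : List Arc} (hγ : TameContour γ) {f : ℂ → ℂ} {C δ : ℝ} (hδ : 0 < δ)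
    (hb : ∀ z ∈ support γ, ‖f z‖ ≤ C * Real.exp (-δ * |z.re|)) :
    ‖cint γ f‖ ≤ C * expMass γ δ := by
  induction γ with
  | nil => simp [cint, expMass]
  | cons A γ ih =>
    have ih := ih (fun A' h => hγ A' (List.mem_cons_of_mem _ h)) (by
      rintro z ⟨A', h, t, ht, rfl⟩
      exact hb _ (mem_support (List.mem_cons_of_mem _ h) ht))
    have hA := hγ A List.mem_cons_self
    have h : ‖arcInt A f‖ ≤
        C * ∫ t in A.dom, ‖deriv A.path t‖ * Real.exp (-δ * |(A.path t).re|) := by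
      unfold arcInt
      rw [← integral_const_mul]
      obtain ⟨L, hL⟩ := hA.deriv_le
      refine norm_integral_le_of_norm_le ?_
        ((ae_restrict_iff' hA.isClosed_dom.measurableSet).2 (ae_of_all _ fun t ht => ?_))
      · refine Integrable.const_mul ?_ C
        refine Integrable.mono' ((hA.integrable δ hδ).const_mul L) ?_ ?_
        · refine Continuous.aestronglyMeasurable ?_
          have := hA.continuous_deriv
          have := hA.contDiff.continuous
          fun_prop
        · refine ae_of_all _ fun t => ?_
          rw [Real.norm_of_nonneg (by positivity)]
          exact mul_le_mul_of_nonneg_right (hL t) (Real.exp_pos _).le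
      · rw [norm_mul]
        have := mul_le_mul_of_nonneg_left (hb _ (mem_support List.mem_cons_self ht))
          (norm_nonneg (deriv A.path t))
        linarith
    simp only [cint, expMass, List.map_cons, List.sum_cons, mul_add] at ih ⊢
    exact (norm_add_le _ _).trans (add_le_add h ih)

theorem HasContourIntegral.cint_eq {E : Type*} [AddCommGroup E] [Module ℂ E]
    [TopologicalSpace E] {γ : List Arc} {F : ℂ → E} {v : E}
    (h : HasContourIntegral γ F v) (e : E →L[ℂ] ℂ) : cint γ (fun z => e (F z)) = e v := (h e).2

/-- A continuous function that decays exponentially in each continuous seminorm has an integral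
along a tame contour, provided that the space is sequentially complete. -/
theorem exists_hasContourIntegral {E : Type*} [AddCommGroup E] [Module ℂ E] [UniformSpace E]
    [IsUniformAddGroup E] [ContinuousSMul ℂ E] [PolynormableSpace ℂ E]
    (hE : IsSequentiallyComplete E)
    {γ : List Arc} (hγ : TameContour γ) {F : ℂ → E} (hF : ContinuousOn F (support γ))
    (hb : ∀ p : Seminorm ℂ E, Continuous p → ∃ C δ : ℝ, 0 < δ ∧
      ∀ z ∈ support γ, p (F z) ≤ C * Real.exp (-δ * |z.re|)) :
    ∃ v, HasContourIntegral γ F v := by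
  induction γ with
  | nil => exact ⟨0, fun e => by simp⟩
  | cons A γ ih =>
    have hsub : support γ ⊆ support (A :: γ) := by
      rintro z ⟨A', h, t, ht, rfl⟩
      exact mem_support (List.mem_cons_of_mem _ h) ht
    obtain ⟨v, hv⟩ := ih (fun A' h => hγ A' (List.mem_cons_of_mem _ h)) (hF.mono hsub)
      (fun p hp => by
        obtain ⟨C, δ, hδ, h⟩ := hb p hp
        exact ⟨C, δ, hδ, fun z hz => h z (hsub hz)⟩)
    have hA := hγ A List.mem_cons_self
    have hcont : ContinuousOn (fun t => deriv A.path t • F (A.path t)) A.dom :=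
      hA.continuous_deriv.continuousOn.smul (hF.comp hA.contDiff.continuous.continuousOn
        fun t ht => mem_support List.mem_cons_self ht)
    obtain ⟨w, hw⟩ := exists_weakIntegral hE hA.isClosed_dom hcont (fun p hp => by
      obtain ⟨C, δ, hδ, h⟩ := hb p hp
      obtain ⟨L, hL⟩ := hA.deriv_le
      refine ⟨fun t => L * (C * Real.exp (-δ * |(A.path t).re|)),
        ((hA.integrable δ hδ).const_mul C).const_mul L, fun t ht => ?_⟩
      rw [map_smul_eq_mul]
      exact mul_le_mul (hL t) (h _ (mem_support List.mem_cons_self ht)) (apply_nonneg _ _)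
        ((norm_nonneg _).trans (hL t)))
    simp only [map_smul, smul_eq_mul] at hw
    refine ⟨w + v, fun e => ⟨?_, ?_⟩⟩
    · intro A' hA'
      rcases List.mem_cons.1 hA' with rfl | h
      · exact (hw e).1
      · exact (hv e).1 A' h
    · rw [List.map_cons, List.sum_cons, (hw e).2, (hv e).2, map_add]

theorem HasContourIntegral.seminorm_le {E : Type*} [AddCommGroup E] [Module ℂ E]
    [TopologicalSpace E] [PolynormableSpace ℂ E] {γ : List Arc} (hγ : TameContour γ) {F : ℂ → E}
    {v : E} (h : HasContourIntegral γ F v) {p : Seminorm ℂ E} (hp : Continuous p) {C δ : ℝ}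
    (hδ : 0 < δ)
    (hb : ∀ z ∈ support γ, p (F z) ≤ C * Real.exp (-δ * |z.re|)) :
    p v ≤ C * expMass γ δ :=
  seminorm_le_of_dual hp fun e he => by
    rw [← h.cint_eq]
    exact norm_cint_le hγ hδ fun z hz => (he _).trans (hb z hz)

/-- Contour integrals depend holomorphically on a parameter. -/
theorem differentiableOn_cint {γ : List Arc} (hγ : TameContour γ) {g : ℂ → ℂ → ℂ} {Ω : Set ℂ}
    (hΩ : IsOpen Ω) (hd : ∀ w ∈ support γ, DifferentiableOn ℂ (fun z => g z w) Ω)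
    (hc : ∀ z ∈ Ω, ContinuousOn (g z) (support γ))
    (hb : ∀ z₀ ∈ Ω, ∃ C δ : ℝ, 0 < δ ∧ ∀ᶠ z in 𝓝 z₀, ∀ w ∈ support γ,
      ‖g z w‖ ≤ C * Real.exp (-δ * |w.re|)) :
    DifferentiableOn ℂ (fun z => cint γ (g z)) Ω := by
  have arc : ∀ A ∈ γ, DifferentiableOn ℂ (fun z => arcInt A (g z)) Ω := by
    intro A hA z₀ hz₀
    have hT := hγ A hA
    have hm := hT.isClosed_dom.measurableSet
    obtain ⟨L, hL⟩ := hT.deriv_le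
    obtain ⟨C, δ, hδ, hC⟩ := hb z₀ hz₀
    obtain ⟨r, hr, hrs⟩ := Metric.mem_nhds_iff.1 (inter_mem hC (hΩ.mem_nhds hz₀))
    have hcont : ∀ z ∈ Ω, ContinuousOn (g z) (A.path '' A.dom) := fun z hz => (hc z hz).mono (by
      rintro _ ⟨t, ht, rfl⟩
      exact mem_support hA ht)
    have hmeas : ∀ z ∈ Ω, AEStronglyMeasurable
        (fun t => deriv A.path t * g z (A.path t)) (volume.restrict A.dom) := fun z hz =>
      (hT.continuousOn_integrand (hcont z hz)).aestronglyMeasurable hm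
    have hdiff : ∀ t ∈ A.dom, ∀ z ∈ Metric.ball z₀ r,
        HasDerivAt (fun z => deriv A.path t * g z (A.path t))
          (deriv A.path t * deriv (fun z => g z (A.path t)) z) z := by
      intro t ht z hz
      exact ((hd _ (mem_support hA ht)).differentiableAt
        (hΩ.mem_nhds (hrs hz).2)).hasDerivAt.const_mul _
    -- By Cauchy's estimate the derivative in `z` has the same decay in `w` as the function itself.
    have hbd : ∀ t ∈ A.dom, ∀ z ∈ Metric.ball z₀ (r / 2),
        ‖deriv A.path t * deriv (fun z => g z (A.path t)) z‖ ≤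
          L * (C * Real.exp (-δ * |(A.path t).re|) / (r / 2)) := by
      intro t ht z hz
      have hsub : Metric.closedBall z (r / 2) ⊆ Metric.ball z₀ r := by
        intro x hx
        rw [Metric.mem_closedBall] at hx
        rw [Metric.mem_ball] at hz ⊢
        linarith [dist_triangle x z z₀]
      have h1 := Complex.norm_deriv_le_of_forall_mem_sphere_norm_le
        (f := fun z => g z (A.path t)) (c := z) (R := r / 2)
        (C := C * Real.exp (-δ * |(A.path t).re|)) (by positivity)
        (((hd _ (mem_support hA ht)).mono fun x hx => (hrs (hsub hx)).2).diffContOnCl_ball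
          subset_rfl)
        (fun x hx => (hrs (hsub (Metric.sphere_subset_closedBall hx))).1 _ (mem_support hA ht))
      rw [norm_mul]
      exact mul_le_mul (hL t) h1 (norm_nonneg _) ((norm_nonneg _).trans (hL t))
    -- The derivative is measurable in `t` as a limit of difference quotients along a sequence.
    have hmeas' : AEStronglyMeasurable
        (fun t => deriv A.path t * deriv (fun z => g z (A.path t)) z₀)
        (volume.restrict A.dom) := by
      let z : ℕ → ℂ := fun n => z₀ + ((r / 2 / ((n : ℝ) + 1) : ℝ) : ℂ)
      have hzpos : ∀ n : ℕ, 0 < r / 2 / ((n : ℝ) + 1) := fun n => by positivity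
      have hzb : ∀ n, z n ∈ Metric.ball z₀ r := by
        intro n
        rw [Metric.mem_ball, dist_eq_norm]
        simp only [z, add_sub_cancel_left, Complex.norm_real, Real.norm_of_nonneg (hzpos n).le]
        refine lt_of_le_of_lt (div_le_self (by positivity) ?_) (by linarith : r / 2 < r)
        linarith [(Nat.cast_nonneg n : (0 : ℝ) ≤ n)]
      have hzne : ∀ n, z n ≠ z₀ := by
        intro n h
        have h1 : ((r / 2 / ((n : ℝ) + 1) : ℝ) : ℂ) = 0 := by simpa [z] using h
        have h2 : (r / 2 / ((n : ℝ) + 1) : ℝ) = 0 := by exact_mod_cast h1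
        linarith [hzpos n]
      have hzt : Tendsto z atTop (𝓝[≠] z₀) := by
        refine tendsto_nhdsWithin_iff.2 ⟨?_, Eventually.of_forall hzne⟩
        have h1 : Tendsto (fun n : ℕ => r / 2 * (1 / ((n : ℝ) + 1))) atTop (𝓝 (r / 2 * 0)) :=
          tendsto_one_div_add_atTop_nhds_zero_nat.const_mul _
        have h2 := ((Complex.continuous_ofReal.tendsto _).comp h1).const_add z₀
        simpa [z, Function.comp_def, div_eq_mul_inv] using h2
      refine aestronglyMeasurable_of_tendsto_ae atTop
        (f := fun n t => slope (fun z => deriv A.path t * g z (A.path t)) z₀ (z n)) ?_ ?_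
      · intro n
        simp only [slope, vsub_eq_sub]
        exact AEStronglyMeasurable.const_smul
          ((hmeas _ (hrs (hzb n)).2).sub (hmeas _ hz₀)) ((z n - z₀)⁻¹ : ℂ)
      · refine (ae_restrict_iff' hm).2 (ae_of_all _ fun t ht => ?_)
        exact (hasDerivAt_iff_tendsto_slope.1
          (hdiff t ht z₀ (Metric.mem_ball_self hr))).comp hzt
    have := hasDerivAt_integral_of_dominated_loc_of_deriv_le (μ := volume.restrict A.dom)
      (F := fun z t => deriv A.path t * g z (A.path t))
      (F' := fun z t => deriv A.path t * deriv (fun z => g z (A.path t)) z)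
      (bound := fun t => L * (C * Real.exp (-δ * |(A.path t).re|) / (r / 2)))
      (x₀ := z₀) (Metric.ball_mem_nhds z₀ (half_pos hr))
      (by
        filter_upwards [hΩ.mem_nhds hz₀] with z hz using hmeas z hz)
      (hT.integrableOn (hcont z₀ hz₀) hδ fun t ht =>
        (hrs (Metric.mem_ball_self hr)).1 _ (mem_support hA ht))
      hmeas'
      ((ae_restrict_iff' hm).2 (ae_of_all _ hbd))
      ((((hT.integrable δ hδ).const_mul C).div_const (r / 2)).const_mul L)
      ((ae_restrict_iff' hm).2 (ae_of_all _ fun t ht z hz =>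
        hdiff t ht z (Metric.ball_subset_ball (by linarith) hz)))
    exact this.2.differentiableAt.differentiableWithinAt
  clear hd hc hb hγ
  induction γ with
  | nil => simp [cint]
  | cons A γ ih =>
    simp only [cint, List.map_cons, List.sum_cons]
    exact (arc A List.mem_cons_self).add (ih fun A' h => arc A' (List.mem_cons_of_mem _ h))

/-- Fubini's theorem for contour integrals. -/
theorem cint_cint_swap {γ η : List Arc} (hγ : TameContour γ) (hη : TameContour η) {g : ℂ → ℂ → ℂ}
    (hc : ContinuousOn (fun x : ℂ × ℂ => g x.1 x.2) (support γ ×ˢ support η)) {C δ : ℝ}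
    (hδ : 0 < δ) (hb : ∀ z ∈ support γ, ∀ w ∈ support η,
      ‖g z w‖ ≤ C * Real.exp (-δ * |z.re|) * Real.exp (-δ * |w.re|)) :
    cint γ (fun z => cint η (g z)) = cint η (fun w => cint γ fun z => g z w) := by
  have hprod : ∀ A ∈ γ, ∀ A' ∈ η, Integrable (fun x : ℝ × ℝ =>
      deriv A.path x.1 * (deriv A'.path x.2 * g (A.path x.1) (A'.path x.2)))
      ((volume.restrict A.dom).prod (volume.restrict A'.dom)) := by
    intro A hA A' hA'
    have hT := hγ A hA
    have hT' := hη A' hA'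
    obtain ⟨L, hL⟩ := hT.deriv_le
    obtain ⟨L', hL'⟩ := hT'.deriv_le
    have hL0 := (norm_nonneg _).trans (hL 0)
    have hL0' := (norm_nonneg _).trans (hL' 0)
    have hm := hT.isClosed_dom.measurableSet.prod hT'.isClosed_dom.measurableSet
    refine Integrable.mono' (g := fun x : ℝ × ℝ => L * L' * C *
      (Real.exp (-δ * |(A.path x.1).re|) * Real.exp (-δ * |(A'.path x.2).re|))) ?_ ?_ ?_
    · exact ((hT.integrable δ hδ).mul_prod (hT'.integrable δ hδ)).const_mul _
    · rw [Measure.prod_restrict]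
      refine ContinuousOn.aestronglyMeasurable ?_ hm
      have c1 := hT.continuous_deriv
      have c2 := hT'.continuous_deriv
      have c3 := hT.contDiff.continuous
      have c4 := hT'.contDiff.continuous
      have c5 : Continuous fun x : ℝ × ℝ => deriv A.path x.1 := by fun_prop
      have c6 : Continuous fun x : ℝ × ℝ => deriv A'.path x.2 := by fun_prop
      have c7 : Continuous fun x : ℝ × ℝ => (A.path x.1, A'.path x.2) := by fun_prop
      exact c5.continuousOn.mul (c6.continuousOn.mul (hc.comp c7.continuousOn
        fun x hx => ⟨mem_support hA hx.1, mem_support hA' hx.2⟩))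
    · rw [Measure.prod_restrict]
      refine (ae_restrict_iff' hm).2 (ae_of_all _ fun x hx => ?_)
      rw [norm_mul, norm_mul]
      have h1 := hb _ (mem_support hA hx.1) _ (mem_support hA' hx.2)
      have h2 : ‖deriv A'.path x.2‖ * ‖g (A.path x.1) (A'.path x.2)‖ ≤
          L' * (C * Real.exp (-δ * |(A.path x.1).re|) * Real.exp (-δ * |(A'.path x.2).re|)) :=
        mul_le_mul (hL' _) h1 (norm_nonneg _) hL0'
      have h3 := mul_le_mul (hL x.1) h2 (by positivity) hL0
      linarith
  have hcomm : ∀ A ∈ γ, ∀ A' ∈ η,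
      arcInt A (fun z => arcInt A' (g z)) = arcInt A' (fun w => arcInt A fun z => g z w) := by
    intro A hA A' hA'
    unfold arcInt
    simp only [← integral_const_mul]
    rw [integral_integral_swap (hprod A hA A' hA')]
    congr 1
    funext t
    congr 1
    funext s
    ring
  have hleft : ∀ A ∈ γ, ∀ A' ∈ η, IntegrableOn
      (fun t => deriv A.path t * arcInt A' (g (A.path t))) A.dom := by
    intro A hA A' hA'
    have := (hprod A hA A' hA').integral_prod_left
    simp only [integral_const_mul] at this
    exact this
  have hright : ∀ A ∈ γ, ∀ A' ∈ η, IntegrableOn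
      (fun t => deriv A'.path t * arcInt A (fun z => g z (A'.path t))) A'.dom := by
    intro A hA A' hA'
    have := (hprod A hA A' hA').integral_prod_right
    refine this.congr (ae_of_all _ fun s => ?_)
    simp only [arcInt, ← integral_const_mul]
    congr 1
    funext t
    ring
  have sum_out : ∀ (A : Arc) (κ : List Arc) (k : Arc → ℂ → ℂ),
      (∀ A' ∈ κ, IntegrableOn (fun t => deriv A.path t * k A' (A.path t)) A.dom) →
      IntegrableOn (fun t => deriv A.path t * (κ.map fun A' => k A' (A.path t)).sum) A.dom ∧
      arcInt A (fun z => (κ.map fun A' => k A' z).sum) = (κ.map fun A' => arcInt A (k A')).sum := by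
    intro A κ k hk
    induction κ with
    | nil => simp [arcInt]
    | cons A₁ κ ih =>
      obtain ⟨i1, i2⟩ := ih fun A' h => hk A' (List.mem_cons_of_mem _ h)
      have i3 := hk A₁ List.mem_cons_self
      simp only [List.map_cons, List.sum_cons, mul_add]
      refine ⟨i3.add i1, ?_⟩
      rw [← i2]
      unfold arcInt
      simp only [mul_add]
      exact integral_add i3 i1
  have e1 : cint γ (fun z => cint η (g z)) =
      (γ.map fun A => (η.map fun A' => arcInt A fun z => arcInt A' (g z)).sum).sum := by
    unfold cint
    congr 1
    refine List.map_congr_left fun A hA => ?_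
    exact (sum_out A η (fun A' z => arcInt A' (g z)) fun A' hA' => hleft A hA A' hA').2
  have e2 : cint η (fun w => cint γ fun z => g z w) =
      (η.map fun A' => (γ.map fun A => arcInt A' fun w => arcInt A fun z => g z w).sum).sum := by
    unfold cint
    congr 1
    refine List.map_congr_left fun A' hA' => ?_
    exact (sum_out A' γ (fun A w => arcInt A fun z => g z w) fun A hA => hright A hA A' hA').2
  have e3 : (γ.map fun A => (η.map fun A' => arcInt A fun z => arcInt A' (g z)).sum).sum =
      (γ.map fun A => (η.map fun A' => arcInt A' fun w => arcInt A fun z => g z w).sum).sum := by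
    congr 1
    refine List.map_congr_left fun A hA => ?_
    congr 1
    exact List.map_congr_left fun A' hA' => hcomm A hA A' hA'
  rw [e1, e2, e3]
  simpa using Multiset.sum_map_sum_map (γ : Multiset Arc) (η : Multiset Arc)

end ArcIntegrals

/-! ### Cauchy's theorem for rectangles and half-strips -/

section Rectangles

open Complex (I)

/-- The closed rectangle, or half-strip if one of `lo`, `hi` is infinite. -/
def closedBox (lo hi : EReal) (y₀ y₁ : ℝ) : Set ℂ :=
  {z | lo ≤ (z.re : EReal) ∧ (z.re : EReal) ≤ hi ∧ y₀ ≤ z.im ∧ z.im ≤ y₁}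

/-- The open rectangle, or half-strip if one of `lo`, `hi` is infinite. -/
def openBox (lo hi : EReal) (y₀ y₁ : ℝ) : Set ℂ :=
  {z | lo < (z.re : EReal) ∧ (z.re : EReal) < hi ∧ y₀ < z.im ∧ z.im < y₁}

open Classical in
/-- The boundary of `openBox lo hi y₀ y₁`, oriented clockwise; there is no vertical side at an
infinite end. -/
noncomputable def rectContour (lo hi : EReal) (y₀ y₁ : ℝ) : List Arc :=
  (if lo = ⊥ then [] else [⟨Icc y₀ y₁, fun t => (lo.toReal : ℂ) + t * I⟩]) ++
    [topArc lo hi y₁] ++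
    (if hi = ⊤ then [] else [⟨Icc (-y₁) (-y₀), fun t => (hi.toReal : ℂ) - t * I⟩]) ++
    [bottomArc lo hi (-y₀)]

/-- The part of the real line between two extended reals. -/
def realPart (lo hi : EReal) : Set ℝ := {t | lo ≤ (t : EReal) ∧ (t : EReal) ≤ hi}

open Classical in
/-- The integral over the upward vertical side over `x`, read as `0` if `x` is infinite. -/
noncomputable def vert (f : ℂ → ℂ) (y₀ y₁ : ℝ) (x : EReal) : ℂ :=
  if x = ⊥ ∨ x = ⊤ then 0 else I * ∫ s in y₀..y₁, f ((x.toReal : ℂ) + s * I)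

/-- The integral over the horizontal side at height `y`, from left to right. -/
noncomputable def horiz (f : ℂ → ℂ) (lo hi : EReal) (y : ℝ) : ℂ :=
  ∫ t in realPart lo hi, f ((t : ℂ) + y * I)

theorem isClosed_realPart (lo hi : EReal) : IsClosed (realPart lo hi) :=
  (isClosed_Icc (a := lo) (b := hi)).preimage continuous_coe_real_ereal

theorem vert_coe (f : ℂ → ℂ) (y₀ y₁ x : ℝ) :
    vert f y₀ y₁ (x : EReal) = I * ∫ s in y₀..y₁, f ((x : ℂ) + s * I) := by
  simp [vert]

theorem vert_top (f : ℂ → ℂ) (y₀ y₁ : ℝ) : vert f y₀ y₁ ⊤ = 0 := by simp [vert]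

theorem vert_bot (f : ℂ → ℂ) (y₀ y₁ : ℝ) : vert f y₀ y₁ ⊥ = 0 := by simp [vert]

theorem arcInt_topArc (f : ℂ → ℂ) (lo hi : EReal) (y : ℝ) :
    arcInt (topArc lo hi y) f = horiz f lo hi y := by
  have h : ∀ t : ℝ, deriv (topArc lo hi y).path t = 1 := fun t => by
    have : HasDerivAt (fun t : ℝ => (t : ℂ) + y * I) 1 t :=
      (Complex.ofRealCLM.hasDerivAt).add_const _
    exact this.deriv
  simp only [arcInt, h, one_mul]
  rfl

theorem arcInt_bottomArc (f : ℂ → ℂ) (lo hi : EReal) (y : ℝ) :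
    arcInt (bottomArc lo hi y) f = -horiz f lo hi (-y) := by
  have h : ∀ t : ℝ, deriv (bottomArc lo hi y).path t = -1 := fun t => by
    have : HasDerivAt (fun t : ℝ => -(t : ℂ) - y * I) (-1) t :=
      ((Complex.ofRealCLM.hasDerivAt).neg).sub_const _
    exact this.deriv
  simp only [arcInt, h, neg_one_mul, integral_neg, horiz]
  congr 1
  have := (Measure.measurePreserving_neg (volume : Measure ℝ)).setIntegral_preimage_emb
    (MeasurableEquiv.neg ℝ).measurableEmbedding (fun t : ℝ => f ((t : ℂ) + (-y : ℝ) * I))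
    (realPart lo hi)
  rw [← this]
  have hs : (bottomArc lo hi y).dom = (fun x : ℝ => -x) ⁻¹' realPart lo hi := rfl
  rw [hs]
  congr 1
  funext t
  congr 1
  simp only [bottomArc]
  push_cast
  ring

theorem arcInt_up (f : ℂ → ℂ) {y₀ y₁ : ℝ} (h : y₀ ≤ y₁) (x : ℝ) :
    arcInt ⟨Icc y₀ y₁, fun t => (x : ℂ) + t * I⟩ f = vert f y₀ y₁ x := by
  have hd : ∀ t : ℝ, deriv (fun t : ℝ => (x : ℂ) + t * I) t = I := fun t => by
    have : HasDerivAt (fun t : ℝ => (x : ℂ) + t * I) (1 * I) t :=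
      ((Complex.ofRealCLM.hasDerivAt).mul_const I).const_add _
    simpa using this.deriv
  simp only [arcInt, hd, vert_coe]
  rw [intervalIntegral.integral_of_le h, ← integral_Icc_eq_integral_Ioc, integral_const_mul]

theorem arcInt_down (f : ℂ → ℂ) {y₀ y₁ : ℝ} (h : y₀ ≤ y₁) (x : ℝ) :
    arcInt ⟨Icc (-y₁) (-y₀), fun t => (x : ℂ) - t * I⟩ f = -vert f y₀ y₁ x := by
  have hd : ∀ t : ℝ, deriv (fun t : ℝ => (x : ℂ) - t * I) t = -I := fun t => by
    have : HasDerivAt (fun t : ℝ => (x : ℂ) - t * I) (-(1 * I)) t :=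
      ((Complex.ofRealCLM.hasDerivAt).mul_const I).const_sub _
    simpa using this.deriv
  have hneg := intervalIntegral.integral_comp_neg (a := -y₁) (b := -y₀)
    fun s : ℝ => f ((x : ℂ) + s * I)
  simp only [neg_neg, Complex.ofReal_neg, neg_mul, ← sub_eq_add_neg] at hneg
  simp only [arcInt, hd, vert_coe]
  rw [integral_Icc_eq_integral_Ioc, ← intervalIntegral.integral_of_le (by linarith),
    intervalIntegral.integral_const_mul, hneg, neg_mul]

theorem cint_rectContour (f : ℂ → ℂ) {lo hi : EReal} {y₀ y₁ : ℝ} (h : y₀ ≤ y₁) (hlo : lo ≠ ⊤)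
    (hhi : hi ≠ ⊥) : cint (rectContour lo hi y₀ y₁) f =
      vert f y₀ y₁ lo + horiz f lo hi y₁ - vert f y₀ y₁ hi - horiz f lo hi y₀ := by
  have h1 : (((if lo = ⊥ then [] else [⟨Icc y₀ y₁, fun t => (lo.toReal : ℂ) + t * I⟩] :
      List Arc)).map fun A => arcInt A f).sum = vert f y₀ y₁ lo := by
    split_ifs with h'
    · simp [h', vert_bot]
    · lift lo to ℝ using ⟨hlo, h'⟩
      simp [arcInt_up f h]
  have h2 : (((if hi = ⊤ then [] else [⟨Icc (-y₁) (-y₀), fun t => (hi.toReal : ℂ) - t * I⟩] :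
      List Arc)).map fun A => arcInt A f).sum = -vert f y₀ y₁ hi := by
    split_ifs with h'
    · simp [h', vert_top]
    · lift hi to ℝ using ⟨h', hhi⟩
      simp [arcInt_down f h]
  simp only [cint, rectContour, List.map_append, List.sum_append, h1, h2, List.map_cons,
    List.map_nil, List.sum_cons, List.sum_nil, arcInt_topArc, arcInt_bottomArc, neg_neg]
  ring

/-! ### Moving the sides of a rectangle -/

theorem continuousOn_line {f : ℂ → ℂ} {s : Set ℝ} {y : ℝ}
    (hf : ∀ t ∈ s, DifferentiableAt ℂ f ((t : ℂ) + y * I)) :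
    ContinuousOn (fun t : ℝ => f ((t : ℂ) + y * I)) s := fun t ht => by
  have h1 : ContinuousAt (fun t : ℝ => (t : ℂ) + y * I) t := by fun_prop
  exact (ContinuousAt.comp (g := f) (f := fun t : ℝ => (t : ℂ) + y * I) (hf t ht).continuousAt
    h1).continuousWithinAt

theorem integrable_exp_neg_abs {δ : ℝ} (hδ : 0 < δ) :
    Integrable fun t : ℝ => Real.exp (-δ * |t|) := by
  have h1 : IntegrableOn (fun t : ℝ => Real.exp (-δ * |t|)) (Ioi 0) := by
    refine (exp_neg_integrableOn_Ioi 0 hδ).congr_fun (fun t ht => ?_) measurableSet_Ioi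
    rw [abs_of_pos ht]
  have h2 : IntegrableOn (fun t : ℝ => Real.exp (-δ * |t|)) (Iic 0) := by
    refine (integrableOn_exp_mul_Iic hδ 0).congr_fun (fun t ht => ?_) measurableSet_Iic
    simp only [abs_of_nonpos (mem_Iic.1 ht)]
    congr 1
    ring
  rw [← integrableOn_univ, ← Iic_union_Ioi (a := (0 : ℝ))]
  exact h2.union h1

theorem integrableOn_line {f : ℂ → ℂ} {s : Set ℝ} (hs : IsClosed s) {y : ℝ}
    (hf : ∀ t ∈ s, DifferentiableAt ℂ f ((t : ℂ) + y * I)) {C δ : ℝ} (hδ : 0 < δ)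
    (hb : ∀ t ∈ s, ‖f ((t : ℂ) + y * I)‖ ≤ C * Real.exp (-δ * |t|)) :
    IntegrableOn (fun t : ℝ => f ((t : ℂ) + y * I)) s :=
  Integrable.mono' ((integrable_exp_neg_abs hδ).const_mul C).integrableOn
    ((continuousOn_line hf).aestronglyMeasurable hs.measurableSet)
    ((ae_restrict_iff' hs.measurableSet).2 (ae_of_all _ hb))

/-- Cauchy's theorem for a rectangle or half-strip, in terms of the integrals over its sides. -/
theorem horiz_add_vert_eq {f : ℂ → ℂ} {lo hi : EReal} (hle : lo ≤ hi) (hlo : lo ≠ ⊤) (hhi : hi ≠ ⊥)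
    {y y' : ℝ} (hy : y ≤ y') (hf : ∀ z ∈ closedBox lo hi y y', DifferentiableAt ℂ f z)
    (hd : ExpDecayOn f (closedBox lo hi y y')) :
    horiz f lo hi y' + vert f y y' lo = horiz f lo hi y + vert f y y' hi := by
  obtain ⟨C, δ, hδ, hC⟩ := hd
  have hmem : ∀ t ∈ realPart lo hi, ∀ s ∈ Icc y y', (t : ℂ) + s * I ∈ closedBox lo hi y y' := by
    intro t ht s hs
    simpa [closedBox] using ⟨ht.1, ht.2, hs.1, hs.2⟩
  let T : ℕ → Set ℝ := fun n => realPart lo hi ∩ Icc (-(n : ℝ)) n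
  have hTmono : Monotone T := fun m n hmn => inter_subset_inter_right _
    (Icc_subset_Icc (by simpa using hmn) (by simpa using hmn))
  have hTU : ⋃ n, T n = realPart lo hi := by
    rw [← inter_iUnion]
    refine inter_eq_left.2 fun t _ => ?_
    obtain ⟨n, hn⟩ := exists_nat_ge |t|
    exact mem_iUnion.2 ⟨n, abs_le.1 hn⟩
  have hlim : ∀ s ∈ Icc y y',
      Tendsto (fun n => ∫ t in T n, f ((t : ℂ) + s * I)) atTop (𝓝 (horiz f lo hi s)) := by
    intro s hs
    have hint : IntegrableOn (fun t : ℝ => f ((t : ℂ) + s * I)) (realPart lo hi) :=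
      integrableOn_line (isClosed_realPart lo hi) (fun t ht => hf _ (hmem t ht s hs)) hδ
        (fun t ht => by simpa using hC _ (hmem t ht s hs))
    have := tendsto_setIntegral_of_monotone (μ := volume) (f := fun t : ℝ => f ((t : ℂ) + s * I))
      (fun n => ((isClosed_realPart lo hi).inter isClosed_Icc).measurableSet) hTmono (by rwa [hTU])
    rwa [hTU] at this
  -- the truncated interval has the end points `x₀ n` and `x₁ n`
  classical
  let x₀ : ℕ → ℝ := fun n => if lo = ⊥ then -(n : ℝ) else lo.toReal
  let x₁ : ℕ → ℝ := fun n => if hi = ⊤ then (n : ℝ) else hi.toReal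
  have hx : ∀ᶠ n : ℕ in atTop, x₀ n ≤ x₁ n ∧ T n = Icc (x₀ n) (x₁ n) := by
    obtain ⟨N, hN⟩ := exists_nat_ge (max |lo.toReal| |hi.toReal|)
    filter_upwards [eventually_ge_atTop N] with n hn
    have hn' : (N : ℝ) ≤ n := by exact_mod_cast hn
    have hl := abs_le.1 ((le_max_left _ _).trans (hN.trans hn'))
    have hh := abs_le.1 ((le_max_right _ _).trans (hN.trans hn'))
    have hn0 : (0 : ℝ) ≤ n := Nat.cast_nonneg n
    induction lo with
    | bot =>
      induction hi with
      | bot => exact absurd rfl hhi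
      | top =>
        refine ⟨by simp [x₀, x₁], ?_⟩
        ext t; simp [T, realPart, x₀, x₁]
      | coe b =>
        simp only [EReal.toReal_coe] at hh
        refine ⟨by simpa [x₀, x₁] using hh.1, ?_⟩
        ext t
        simp only [T, realPart, x₀, x₁, mem_inter_iff, mem_ofPred_eq, mem_Icc, bot_le, true_and,
          EReal.coe_le_coe_iff, if_true, EReal.coe_ne_top, if_false, EReal.toReal_coe]
        exact ⟨fun h => ⟨h.2.1, h.1⟩, fun h => ⟨h.2, h.1, h.2.trans hh.2⟩⟩
    | top => exact absurd rfl hlo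
    | coe a =>
      simp only [EReal.toReal_coe] at hl
      induction hi with
      | bot => exact absurd rfl hhi
      | top =>
        refine ⟨by simpa [x₀, x₁] using hl.2, ?_⟩
        ext t
        simp only [T, realPart, x₀, x₁, mem_inter_iff, mem_ofPred_eq, mem_Icc, le_top, and_true,
          EReal.coe_le_coe_iff, if_true, EReal.coe_ne_bot, if_false, EReal.toReal_coe]
        exact ⟨fun h => ⟨h.1, h.2.2⟩, fun h => ⟨h.1, hl.1.trans h.1, h.2⟩⟩
      | coe b =>
        simp only [EReal.toReal_coe] at hh
        refine ⟨by simpa [x₀, x₁] using hle, ?_⟩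
        ext t
        simp only [T, realPart, x₀, x₁, mem_inter_iff, mem_ofPred_eq, mem_Icc,
          EReal.coe_le_coe_iff, EReal.coe_ne_bot, EReal.coe_ne_top, if_false, EReal.toReal_coe]
        exact ⟨fun h => h.1, fun h => ⟨h, hl.1.trans h.1, h.2.trans hh.2⟩⟩
  have hcauchy : ∀ᶠ n in atTop,
      (∫ t in T n, f ((t : ℂ) + y' * I)) + I * ∫ s in y..y', f ((x₀ n : ℂ) + s * I) =
      (∫ t in T n, f ((t : ℂ) + y * I)) + I * ∫ s in y..y', f ((x₁ n : ℂ) + s * I) := by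
    filter_upwards [hx] with n hn
    obtain ⟨hle', hT⟩ := hn
    have h1 := Complex.integral_boundary_rect_eq_zero_of_differentiableOn f
      ((x₀ n : ℂ) + y * I) ((x₁ n : ℂ) + y' * I) (fun z hz => by
        simp only [Complex.add_re, Complex.ofReal_re, Complex.mul_re, Complex.I_re, mul_zero,
          Complex.ofReal_im, Complex.I_im, mul_one, sub_self, add_zero, Complex.add_im,
          Complex.mul_im, zero_add] at hz
        rw [uIcc_of_le hle', uIcc_of_le hy, ← hT] at hz
        have hz1 : z.re ∈ T n := hz.1
        have hz2 : z.im ∈ Icc y y' := hz.2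
        have := hmem _ hz1.1 _ hz2
        rw [Complex.re_add_im] at this
        exact (hf z this).differentiableWithinAt)
    simp only [Complex.add_re, Complex.ofReal_re, Complex.mul_re, Complex.I_re, mul_zero,
      Complex.ofReal_im, Complex.I_im, mul_one, sub_self, add_zero, Complex.add_im,
      Complex.mul_im, zero_add, smul_eq_mul] at h1
    rw [hT, integral_Icc_eq_integral_Ioc, integral_Icc_eq_integral_Ioc,
      ← intervalIntegral.integral_of_le hle', ← intervalIntegral.integral_of_le hle']
    linear_combination -h1
  have hvan : ∀ x : ℕ → ℝ, (∀ᶠ n in atTop, x n ∈ realPart lo hi) → (∀ᶠ n : ℕ in atTop, |x n| = n) →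
      Tendsto (fun n => I * ∫ s in y..y', f ((x n : ℂ) + s * I)) atTop (𝓝 0) := by
    intro x hx hxn
    have h0 : Tendsto (fun n : ℕ => C * Real.exp (-δ * n) * |y' - y|) atTop
        (𝓝 (C * 0 * |y' - y|)) := by
      refine Tendsto.mul_const _ (Tendsto.const_mul _ ?_)
      refine Real.tendsto_exp_atBot.comp ?_
      exact tendsto_natCast_atTop_atTop.const_mul_atTop_of_neg (by linarith)
    simp only [mul_zero, zero_mul] at h0
    refine squeeze_zero_norm' ?_ h0
    filter_upwards [hx, hxn] with n hn hn'
    rw [norm_mul, Complex.norm_I, one_mul]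
    refine intervalIntegral.norm_integral_le_of_norm_le_const fun s hs => ?_
    rw [uIoc_of_le hy] at hs
    have := hC _ (hmem _ hn s ⟨hs.1.le, hs.2⟩)
    simpa [hn'] using this
  have hv0 : Tendsto (fun n => I * ∫ s in y..y', f ((x₀ n : ℂ) + s * I)) atTop
      (𝓝 (vert f y y' lo)) := by
    by_cases hb : lo = ⊥
    · rw [hb, vert_bot]
      refine hvan x₀ ?_ ?_
      · filter_upwards [hx] with n hn
        have : x₀ n ∈ T n := by rw [hn.2]; exact ⟨le_rfl, hn.1⟩
        exact this.1
      · filter_upwards with n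
        simp [x₀, hb]
    · refine tendsto_const_nhds.congr fun n => ?_
      simp [vert, hb, hlo, x₀]
  have hv1 : Tendsto (fun n => I * ∫ s in y..y', f ((x₁ n : ℂ) + s * I)) atTop
      (𝓝 (vert f y y' hi)) := by
    by_cases hb : hi = ⊤
    · rw [hb, vert_top]
      refine hvan x₁ ?_ ?_
      · filter_upwards [hx] with n hn
        have : x₁ n ∈ T n := by rw [hn.2]; exact ⟨hn.1, le_rfl⟩
        exact this.1
      · filter_upwards with n
        simp [x₁, hb]
    · refine tendsto_const_nhds.congr fun n => ?_
      simp [vert, hb, hhi, x₁]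
  exact tendsto_nhds_unique_of_eventuallyEq ((hlim y' ⟨hy, le_rfl⟩).add hv0)
    ((hlim y ⟨le_rfl, hy⟩).add hv1) hcauchy

end Rectangles

section Deformation

open Complex (I)

/-- The value of the integral over `rectContour lo hi y₀ y₁`. -/
noncomputable def rectInt (f : ℂ → ℂ) (lo hi : EReal) (y₀ y₁ : ℝ) : ℂ :=
  vert f y₀ y₁ lo + horiz f lo hi y₁ - vert f y₀ y₁ hi - horiz f lo hi y₀

theorem horiz_add_horiz {f : ℂ → ℂ} {lo hi : EReal} {m y : ℝ} (h1 : lo ≤ m) (h2 : (m : EReal) ≤ hi)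
    (hf : IntegrableOn (fun t : ℝ => f ((t : ℂ) + y * I)) (realPart lo hi)) :
    horiz f lo hi y = horiz f lo m y + horiz f m hi y := by
  have hU : realPart lo hi = realPart lo m ∪ realPart m hi := by
    ext t
    simp only [realPart, mem_union, mem_ofPred_eq]
    constructor
    · rintro ⟨h3, h4⟩
      rcases le_total (t : EReal) m with h | h
      · exact Or.inl ⟨h3, h⟩
      · exact Or.inr ⟨h, h4⟩
    · rintro (⟨h3, h4⟩ | ⟨h3, h4⟩)
      · exact ⟨h3, h4.trans h2⟩
      · exact ⟨h1.trans h3, h4⟩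
  have hdisj : AEDisjoint volume (realPart lo m) (realPart m hi) := by
    refine measure_mono_null (t := {m}) ?_ (by simp)
    rintro t ⟨⟨-, h3⟩, ⟨h4, -⟩⟩
    exact le_antisymm (EReal.coe_le_coe_iff.1 h3) (EReal.coe_le_coe_iff.1 h4)
  unfold horiz
  rw [hU] at hf ⊢
  exact setIntegral_union₀ hdisj (isClosed_realPart _ _).measurableSet.nullMeasurableSet
    (hf.mono_set subset_union_left) (hf.mono_set subset_union_right)

theorem vert_add_vert {f : ℂ → ℂ} {x : EReal} {y₀ y₁ y₂ : ℝ} (h01 : y₀ ≤ y₁) (h12 : y₁ ≤ y₂)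
    (hf : ∀ z ∈ closedBox x x y₀ y₂, DifferentiableAt ℂ f z) :
    vert f y₀ y₂ x = vert f y₀ y₁ x + vert f y₁ y₂ x := by
  induction x with
  | bot => simp [vert_bot]
  | top => simp [vert_top]
  | coe x =>
    simp only [vert_coe]
    have hc : ContinuousOn (fun s : ℝ => f ((x : ℂ) + s * I)) (Icc y₀ y₂) := by
      intro s hs
      have h1 : ContinuousAt (fun s : ℝ => (x : ℂ) + s * I) s := by fun_prop
      refine (ContinuousAt.comp (g := f) (f := fun s : ℝ => (x : ℂ) + s * I)
        (hf _ ?_).continuousAt h1).continuousWithinAt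
      simpa [closedBox] using hs
    rw [← mul_add, intervalIntegral.integral_add_adjacent_intervals]
    · exact (hc.mono (Icc_subset_Icc le_rfl h12)).intervalIntegrable_of_Icc h01
    · exact (hc.mono (Icc_subset_Icc h01 le_rfl)).intervalIntegrable_of_Icc h12

theorem integrableOn_realPart {f : ℂ → ℂ} {lo hi : EReal} {y : ℝ} {Z : Set ℂ}
    (hZ : ∀ t ∈ realPart lo hi, (t : ℂ) + y * I ∈ Z) (hf : ∀ z ∈ Z, DifferentiableAt ℂ f z)
    (hd : ExpDecayOn f Z) :
    IntegrableOn (fun t : ℝ => f ((t : ℂ) + y * I)) (realPart lo hi) := by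
  obtain ⟨C, δ, hδ, hC⟩ := hd
  exact integrableOn_line (isClosed_realPart lo hi) (fun t ht => hf _ (hZ t ht)) hδ
    (fun t ht => by simpa using hC _ (hZ t ht))

/-- The integrals over the boundaries of two nested boxes agree if the function is holomorphic
between them. -/
theorem rectInt_eq_of_nested {f : ℂ → ℂ} {lo lo' hi hi' : EReal} {y₀ y₀' y₁ y₁' : ℝ}
    (hlo : lo' ≤ lo) (hhi : hi ≤ hi') (hle : lo ≤ hi) (hlt : lo ≠ ⊤) (hhb : hi ≠ ⊥)
    (hy₀ : y₀' ≤ y₀) (hy : y₀ ≤ y₁) (hy₁ : y₁ ≤ y₁')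
    (hf : ∀ z ∈ closedBox lo' hi' y₀' y₁' \ openBox lo hi y₀ y₁, DifferentiableAt ℂ f z)
    (hd : ExpDecayOn f (closedBox lo' hi' y₀' y₁' \ openBox lo hi y₀ y₁)) :
    rectInt f lo' hi' y₀' y₁' = rectInt f lo hi y₀ y₁ := by
  have hlt' : lo' ≠ ⊤ := fun h => hlt (top_le_iff.1 (h ▸ hlo))
  have hhb' : hi' ≠ ⊥ := fun h => hhb (le_bot_iff.1 (h ▸ hhi))
  have hle' : lo' ≤ hi' := hlo.trans (hle.trans hhi)
  have hint : ∀ y, (y = y₀ ∨ y = y₁) →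
      IntegrableOn (fun t : ℝ => f ((t : ℂ) + y * I)) (realPart lo' hi') := by
    intro y hyy
    refine integrableOn_realPart (fun t ht => ?_) hf hd
    refine ⟨?_, ?_⟩
    · rcases hyy with rfl | rfl <;>
      simpa [closedBox] using ⟨ht.1, ht.2, by linarith, by linarith⟩
    · rintro ⟨-, -, h3, h4⟩
      rcases hyy with rfl | rfl <;> simp at h3 h4
  have hint' : ∀ y, (y = y₀ ∨ y = y₁) →
      IntegrableOn (fun t : ℝ => f ((t : ℂ) + y * I)) (realPart lo' hi) := fun y hyy =>
    (hint y hyy).mono_set fun t ht => ⟨ht.1, ht.2.trans hhi⟩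
  -- The sides are moved one at a time: left, right, top, bottom. Each step is Cauchy's theorem for
  -- the box swept by the side.
  have s1 : rectInt f lo' hi y₀ y₁ = rectInt f lo hi y₀ y₁ := by
    rcases eq_or_ne lo' lo with rfl | hne
    · rfl
    have hb : lo ≠ ⊥ := fun h => hne (le_antisymm hlo (h ▸ bot_le))
    lift lo to ℝ using ⟨hlt, hb⟩
    have hsub : closedBox lo' lo y₀ y₁ ⊆ closedBox lo' hi' y₀' y₁' \ openBox lo hi y₀ y₁ := by
      rintro z ⟨h1, h2, h3, h4⟩
      exact ⟨⟨h1, h2.trans (hle.trans hhi), hy₀.trans h3, h4.trans hy₁⟩,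
        fun h => absurd h.1 (not_lt.2 h2)⟩
    have := horiz_add_vert_eq hlo hlt' (EReal.coe_ne_bot lo) hy (fun z hz => hf z (hsub hz))
      (hd.mono hsub)
    simp only [rectInt, horiz_add_horiz hlo hle (hint' y₁ (Or.inr rfl)),
      horiz_add_horiz hlo hle (hint' y₀ (Or.inl rfl))]
    linear_combination this
  have s2 : rectInt f lo' hi' y₀ y₁ = rectInt f lo' hi y₀ y₁ := by
    rcases eq_or_ne hi hi' with rfl | hne
    · rfl
    have hb : hi ≠ ⊤ := fun h => hne (le_antisymm hhi (h ▸ le_top))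
    lift hi to ℝ using ⟨hb, hhb⟩
    have hsub : closedBox hi hi' y₀ y₁ ⊆ closedBox lo' hi' y₀' y₁' \ openBox lo hi y₀ y₁ := by
      rintro z ⟨h1, h2, h3, h4⟩
      exact ⟨⟨(hlo.trans hle).trans h1, h2, hy₀.trans h3, h4.trans hy₁⟩,
        fun h => absurd h.2.1 (not_lt.2 h1)⟩
    have := horiz_add_vert_eq hhi (EReal.coe_ne_top hi) hhb' hy (fun z hz => hf z (hsub hz))
      (hd.mono hsub)
    simp only [rectInt, horiz_add_horiz (hlo.trans hle) hhi (hint y₁ (Or.inr rfl)),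
      horiz_add_horiz (hlo.trans hle) hhi (hint y₀ (Or.inl rfl))]
    linear_combination this
  -- the two vertical sides of the large box avoid the small one
  have hside : ∀ x, (x = lo' ∨ x = hi') →
      closedBox x x y₀' y₁' ⊆ closedBox lo' hi' y₀' y₁' \ openBox lo hi y₀ y₁ := by
    rintro x hx z ⟨h1, h2, h3, h4⟩
    rcases hx with rfl | rfl
    · exact ⟨⟨h1, h2.trans hle', h3, h4⟩, fun h => absurd h.1 (not_lt.2 (h2.trans hlo))⟩
    · exact ⟨⟨hle'.trans h1, h2, h3, h4⟩, fun h => absurd h.2.1 (not_lt.2 (hhi.trans h1))⟩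
  have hv : ∀ x, (x = lo' ∨ x = hi') → ∀ {s₀ s₁ s₂ : ℝ}, y₀' ≤ s₀ → s₀ ≤ s₁ → s₁ ≤ s₂ →
      s₂ ≤ y₁' → vert f s₀ s₂ x = vert f s₀ s₁ x + vert f s₁ s₂ x := by
    intro x hx s₀ s₁ s₂ h0 h1 h2 h3
    exact vert_add_vert h1 h2 fun z hz => hf z (hside x hx
      ⟨hz.1, hz.2.1, h0.trans hz.2.2.1, hz.2.2.2.trans h3⟩)
  have s3 : rectInt f lo' hi' y₀ y₁' = rectInt f lo' hi' y₀ y₁ := by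
    have hsub : closedBox lo' hi' y₁ y₁' ⊆ closedBox lo' hi' y₀' y₁' \ openBox lo hi y₀ y₁ := by
      rintro z ⟨h1, h2, h3, h4⟩
      exact ⟨⟨h1, h2, hy₀.trans (hy.trans h3), h4⟩, fun h => absurd h.2.2.2 (not_lt.2 h3)⟩
    have := horiz_add_vert_eq hle' hlt' hhb' hy₁ (fun z hz => hf z (hsub hz)) (hd.mono hsub)
    simp only [rectInt, hv lo' (Or.inl rfl) hy₀ hy hy₁ le_rfl,
      hv hi' (Or.inr rfl) hy₀ hy hy₁ le_rfl]
    linear_combination this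
  have s4 : rectInt f lo' hi' y₀' y₁' = rectInt f lo' hi' y₀ y₁' := by
    have hsub : closedBox lo' hi' y₀' y₀ ⊆ closedBox lo' hi' y₀' y₁' \ openBox lo hi y₀ y₁ := by
      rintro z ⟨h1, h2, h3, h4⟩
      exact ⟨⟨h1, h2, h3, h4.trans (hy.trans hy₁)⟩, fun h => absurd h.2.2.1 (not_lt.2 h4)⟩
    have := horiz_add_vert_eq hle' hlt' hhb' hy₀ (fun z hz => hf z (hsub hz)) (hd.mono hsub)
    simp only [rectInt, hv lo' (Or.inl rfl) le_rfl hy₀ (hy.trans hy₁) le_rfl,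
      hv hi' (Or.inr rfl) le_rfl hy₀ (hy.trans hy₁) le_rfl]
    linear_combination this
  rw [s4, s3, s2, s1]

/-- Cauchy's theorem: the integral over the boundary of a box vanishes if the function is
holomorphic in the box. -/
theorem rectInt_eq_zero {f : ℂ → ℂ} {lo hi : EReal} {y₀ y₁ : ℝ} (hle : lo ≤ hi) (hlt : lo ≠ ⊤)
    (hhb : hi ≠ ⊥) (hy : y₀ ≤ y₁) (hf : ∀ z ∈ closedBox lo hi y₀ y₁, DifferentiableAt ℂ f z)
    (hd : ExpDecayOn f (closedBox lo hi y₀ y₁)) : rectInt f lo hi y₀ y₁ = 0 := by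
  have := horiz_add_vert_eq hle hlt hhb hy hf hd
  unfold rectInt
  linear_combination this

/-! ### From half circles to rectangles -/

/-- A holomorphic function on a disc slit along the ray to the right of its centre has a primitive:
the exponential function turns the slit disc into a convex half-strip. -/
theorem exists_primitive_slitBall {f : ℂ → ℂ} {c ρ : ℝ} (hρ : 0 < ρ)
    (hf : ∀ z ∈ Metric.ball (c : ℂ) ρ, ¬(z.im = 0 ∧ c ≤ z.re) → DifferentiableAt ℂ f z) :
    ∃ P : ℂ → ℂ, ∀ z ∈ Metric.ball (c : ℂ) ρ, ¬(z.im = 0 ∧ c ≤ z.re) → HasDerivAt P (f z) z := by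
  let s : Set ℂ := {u | u.re < Real.log ρ} ∩ ({u | -Real.pi < u.im} ∩ {u | u.im < Real.pi})
  have hso : IsOpen s := (isOpen_lt Complex.continuous_re continuous_const).inter
    ((isOpen_lt continuous_const Complex.continuous_im).inter
      (isOpen_lt Complex.continuous_im continuous_const))
  have hsc : Convex ℝ s := (convex_halfSpace_re_lt _).inter
    ((convex_halfSpace_im_gt _).inter (convex_halfSpace_im_lt _))
  have hslit : ∀ z : ℂ, (c : ℂ) - z ∈ Complex.slitPlane ↔ ¬(z.im = 0 ∧ c ≤ z.re) := by
    intro z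
    simp only [Complex.mem_slitPlane_iff, Complex.sub_re, Complex.ofReal_re, Complex.sub_im,
      Complex.ofReal_im, zero_sub, sub_pos, ne_eq, neg_eq_zero, not_and, not_le]
    tauto
  have hg : DifferentiableOn ℂ (fun u => -(f (c - Complex.exp u) * Complex.exp u)) s := by
    intro u hu
    have h1 : ‖Complex.exp u‖ < ρ := by
      rw [Complex.norm_exp, ← Real.exp_log hρ]
      exact Real.exp_lt_exp.2 hu.1
    have h2 : DifferentiableAt ℂ f (c - Complex.exp u) := by
      refine hf _ (by simpa [Metric.mem_ball, dist_eq_norm] using h1) ((hslit _).1 ?_)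
      rw [sub_sub_cancel, Complex.mem_slitPlane_iff_arg]
      refine ⟨?_, Complex.exp_ne_zero u⟩
      have h3 : (Complex.log (Complex.exp u)).im = u.im :=
        congrArg Complex.im (Complex.log_exp hu.2.1 hu.2.2.le)
      rw [Complex.log_im] at h3
      rw [h3]
      exact hu.2.2.ne
    have h4 : DifferentiableAt ℂ (fun u => f (c - Complex.exp u)) u :=
      DifferentiableAt.comp (g := f) u h2 (by fun_prop)
    exact (h4.mul Complex.differentiableAt_exp).neg.differentiableWithinAt
  obtain ⟨Q, hQ⟩ := hsc.exists_forall_hasDerivWithinAt hg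
  refine ⟨fun z => Q (Complex.log (c - z)), fun z hz hz' => ?_⟩
  have hsl := (hslit z).2 hz'
  have hne : (c : ℂ) - z ≠ 0 := Complex.slitPlane_ne_zero hsl
  have hmem : Complex.log (c - z) ∈ s := by
    refine ⟨?_, ?_, ?_⟩
    · rw [mem_ofPred_eq, Complex.log_re]
      refine Real.log_lt_log (norm_pos_iff.2 hne) ?_
      rw [norm_sub_rev]
      simpa [Metric.mem_ball, dist_eq_norm] using hz
    · exact Complex.neg_pi_lt_log_im _
    · rw [mem_ofPred_eq, Complex.log_im]
      exact lt_of_le_of_ne (Complex.arg_le_pi _) (Complex.mem_slitPlane_iff_arg.1 hsl).1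
  have h1 := (hQ _ hmem).hasDerivAt (hso.mem_nhds hmem)
  have h2 : HasDerivAt (fun z : ℂ => Complex.log (c - z)) (-1 / (c - z)) z :=
    ((hasDerivAt_id z).const_sub (c : ℂ)).clog hsl
  have h3 := h1.comp z h2
  have e : -(f z * (c - z)) * (-1 / (c - z)) = f z := by field_simp
  rw [Complex.exp_log hne, sub_sub_cancel, e] at h3
  exact h3

/-- The integral of a function with a primitive along a path. -/
theorem integral_path_eq_sub {f P : ℂ → ℂ} {D : Set ℂ} (hP : ∀ z ∈ D, HasDerivAt P (f z) z)
    (hf : ∀ z ∈ D, DifferentiableAt ℂ f z) {path path' : ℝ → ℂ} {s t : ℝ} (hst : s ≤ t)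
    (hp : ∀ x, HasDerivAt path (path' x) x) (hp' : Continuous path')
    (hD : ∀ x ∈ Icc s t, path x ∈ D) :
    ∫ x in s..t, path' x * f (path x) = P (path t) - P (path s) := by
  have hc : Continuous path := continuous_iff_continuousAt.2 fun x => (hp x).continuousAt
  refine intervalIntegral.integral_eq_sub_of_hasDerivAt (f := fun x => P (path x)) ?_ ?_
  · intro x hx
    rw [uIcc_of_le hst] at hx
    have h1 := (hP _ (hD x hx)).scomp x (hp x)
    simp only [smul_eq_mul] at h1
    exact h1
  · refine ContinuousOn.intervalIntegrable_of_Icc hst ?_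
    refine hp'.continuousOn.mul fun x hx => ?_
    exact (ContinuousAt.comp (g := f) (hf _ (hD x hx)).continuousAt
      hc.continuousAt).continuousWithinAt

/-- The half circle at the left end of a contour may be replaced by three sides of a rectangle. -/
theorem arcInt_leftHalfCircle {f : ℂ → ℂ} {c ε r ρ : ℝ} (hε : 0 < ε) (hr : 0 < r) (hρ : r + ε ≤ ρ)
    (hf : ∀ z ∈ Metric.ball (c : ℂ) ρ, ¬(z.im = 0 ∧ c ≤ z.re) → DifferentiableAt ℂ f z) :
    arcInt ⟨Icc (Real.pi / 2) (3 * Real.pi / 2),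
      fun t => (c : ℂ) + ε * Complex.exp (-(t * I))⟩ f =
      I * (∫ s in (-ε)..ε, f (((c - r : ℝ) : ℂ) + s * I)) +
        (∫ t in (c - r)..c, f ((t : ℂ) + ε * I)) -
        ∫ t in (c - r)..c, f ((t : ℂ) + (-ε : ℝ) * I) := by
  let D : Set ℂ := {z | z ∈ Metric.ball (c : ℂ) ρ ∧ ¬(z.im = 0 ∧ c ≤ z.re)}
  have hρ0 : 0 < ρ := by linarith
  obtain ⟨P, hP⟩ := exists_primitive_slitBall hρ0 hf
  have hP' : ∀ z ∈ D, HasDerivAt P (f z) z := fun z hz => hP z hz.1 hz.2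
  have hf' : ∀ z ∈ D, DifferentiableAt ℂ f z := fun z hz => hf z hz.1 hz.2
  have hpi := Real.pi_pos
  have hball : ∀ x y : ℝ, |x - c| ≤ r → |y| ≤ ε →
      (x : ℂ) + y * I ∈ Metric.ball (c : ℂ) ρ := by
    intro x y hx hy
    rw [Metric.mem_ball, dist_eq_norm]
    have h1 : (x : ℂ) + y * I - c = ((x - c : ℝ) : ℂ) + (y : ℂ) * I := by push_cast; ring
    rw [h1]
    refine lt_of_lt_of_le ?_ hρ
    have h2 : ‖((x - c : ℝ) : ℂ) + (y : ℂ) * I‖ ^ 2 = (x - c) ^ 2 + y ^ 2 := by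
      rw [← Complex.normSq_eq_norm_sq, Complex.normSq_add_mul_I]
    refine lt_of_pow_lt_pow_left₀ 2 (by linarith) ?_
    rw [h2]
    have h3 := sq_le_sq' (abs_le.1 hx).1 (abs_le.1 hx).2
    have h4 := sq_le_sq' (abs_le.1 hy).1 (abs_le.1 hy).2
    nlinarith
  have hcirc : ∀ t : ℝ, HasDerivAt (fun t : ℝ => (c : ℂ) + ε * Complex.exp (-(t * I)))
      (ε * (Complex.exp (-(t * I)) * -(1 * I))) t := fun t =>
    (((((Complex.ofRealCLM.hasDerivAt (x := t)).mul_const I).neg).cexp).const_mul (ε : ℂ)).const_add _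
  have hexp : ∀ t : ℝ, Complex.exp (-(t * I)) = (Real.cos t : ℂ) + (-Real.sin t : ℝ) * I := by
    intro t
    rw [← neg_mul, Complex.exp_mul_I, Complex.cos_neg, Complex.sin_neg]
    push_cast
    ring
  have hpath : ∀ t : ℝ, (c : ℂ) + ε * Complex.exp (-(t * I)) =
      ((c + ε * Real.cos t : ℝ) : ℂ) + (-(ε * Real.sin t) : ℝ) * I := by
    intro t
    rw [hexp]
    push_cast
    ring
  have i1 : arcInt ⟨Icc (Real.pi / 2) (3 * Real.pi / 2),
      fun t => (c : ℂ) + ε * Complex.exp (-(t * I))⟩ f =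
      P ((c : ℂ) + ε * I) - P ((c : ℂ) + (-ε : ℝ) * I) := by
    have h := integral_path_eq_sub hP' hf' (s := Real.pi / 2) (t := 3 * Real.pi / 2) (by linarith)
      hcirc (by fun_prop) (fun t ht => by
        rw [hpath]
        have hcos : Real.cos t ≤ 0 := by
          refine Real.cos_nonpos_of_pi_div_two_le_of_le ht.1 ?_
          linarith [ht.2]
        refine ⟨?_, ?_⟩
        · rw [← hpath, Metric.mem_ball, dist_eq_norm, add_sub_cancel_left, norm_mul,
            ← neg_mul, ← Complex.ofReal_neg, Complex.norm_exp_ofReal_mul_I, mul_one,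
            Complex.norm_real, Real.norm_of_nonneg hε.le]
          linarith
        · simp only [Complex.add_im, Complex.ofReal_im, Complex.mul_im, Complex.ofReal_re,
            Complex.I_im, mul_one, Complex.I_re, mul_zero, add_zero, zero_add, Complex.add_re,
            Complex.mul_re, sub_zero, neg_eq_zero, mul_eq_zero, hε.ne', false_or, not_and, not_le]
          intro hs
          have h1 := Real.sin_sq_add_cos_sq t
          rw [hs] at h1
          have h2 : Real.cos t < 0 := lt_of_le_of_ne hcos fun h => by rw [h] at h1; norm_num at h1
          nlinarith)
    have e1 : (c : ℂ) + ε * Complex.exp (-((3 * Real.pi / 2 : ℝ) * I)) = (c : ℂ) + ε * I := by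
      rw [hexp]
      have : (3 * Real.pi / 2 : ℝ) = Real.pi / 2 + Real.pi := by ring
      rw [this, Real.cos_add_pi, Real.sin_add_pi]
      simp
    have e2 : (c : ℂ) + ε * Complex.exp (-((Real.pi / 2 : ℝ) * I)) =
        (c : ℂ) + (-ε : ℝ) * I := by
      rw [hexp]
      simp
    rw [e1, e2] at h
    rw [← h, intervalIntegral.integral_of_le (by linarith), ← integral_Icc_eq_integral_Ioc]
    unfold arcInt
    simp only [(hcirc _).deriv]
  have hline : ∀ (y t : ℝ), HasDerivAt (fun t : ℝ => (t : ℂ) + y * I) 1 t := fun y t =>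
    (Complex.ofRealCLM.hasDerivAt).add_const _
  have hup : ∀ (x t : ℝ), HasDerivAt (fun t : ℝ => (x : ℂ) + t * I) I t := fun x t => by
    simpa using (((Complex.ofRealCLM.hasDerivAt (x := t)).mul_const I).const_add (x : ℂ))
  have i2 : I * (∫ s in (-ε)..ε, f (((c - r : ℝ) : ℂ) + s * I)) =
      P (((c - r : ℝ) : ℂ) + ε * I) - P (((c - r : ℝ) : ℂ) + (-ε : ℝ) * I) := by
    rw [← intervalIntegral.integral_const_mul]
    refine integral_path_eq_sub hP' hf' (by linarith) (hup (c - r)) continuous_const ?_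
    intro s hs
    refine ⟨hball _ _ (by simp [abs_of_pos hr]) (abs_le.2 hs), ?_⟩
    simp [hr]
  have i3 : ∀ y : ℝ, y ≠ 0 → |y| ≤ ε → (∫ t in (c - r)..c, f ((t : ℂ) + y * I)) =
      P ((c : ℂ) + y * I) - P (((c - r : ℝ) : ℂ) + y * I) := by
    intro y hy0 hy
    have := integral_path_eq_sub hP' hf' (s := c - r) (t := c) (by linarith) (hline y)
      continuous_const (fun t ht => by
        refine ⟨hball _ _ (abs_le.2 ⟨by linarith [ht.1], by linarith [ht.2]⟩) hy, ?_⟩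
        simp [hy0])
    simpa using this
  rw [i1, i2, i3 ε hε.ne' (abs_of_pos hε).le, i3 (-ε) (by linarith)
    (by rw [abs_neg, abs_of_pos hε])]
  ring

/-- The half circle at the right end of a contour may be replaced by three sides of a rectangle. -/
theorem arcInt_rightHalfCircle {f : ℂ → ℂ} {d ε r ρ : ℝ} (hε : 0 < ε) (hr : 0 < r) (hρ : r + ε ≤ ρ)
    (hf : ∀ z ∈ Metric.ball (d : ℂ) ρ, ¬(z.im = 0 ∧ z.re ≤ d) → DifferentiableAt ℂ f z) :
    arcInt ⟨Icc (-(Real.pi / 2)) (Real.pi / 2),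
      fun t => (d : ℂ) + ε * Complex.exp (-(t * I))⟩ f =
      -(I * ∫ s in (-ε)..ε, f (((d + r : ℝ) : ℂ) + s * I)) +
        (∫ t in d..(d + r), f ((t : ℂ) + ε * I)) -
        ∫ t in d..(d + r), f ((t : ℂ) + (-ε : ℝ) * I) := by
  have h := arcInt_leftHalfCircle (f := fun z => f (-z)) (c := -d) hε hr hρ (by
    intro z hz hz'
    have h1 : DifferentiableAt ℂ f (-z) := by
      refine hf (-z) ?_ ?_
      · rw [Metric.mem_ball, dist_eq_norm] at hz ⊢
        have e : -z - (d : ℂ) = -(z - ((-d : ℝ) : ℂ)) := by push_cast; ring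
        rwa [e, norm_neg]
      · simp only [Complex.neg_im, Complex.neg_re, neg_eq_zero]
        intro h
        exact hz' ⟨h.1, by linarith [h.2]⟩
    exact DifferentiableAt.comp (g := f) z h1 differentiable_neg.differentiableAt)
  have e0 : arcInt ⟨Icc (-(Real.pi / 2)) (Real.pi / 2),
      fun t => (d : ℂ) + ε * Complex.exp (-(t * I))⟩ f =
      -arcInt ⟨Icc (Real.pi / 2) (3 * Real.pi / 2),
        fun t => ((-d : ℝ) : ℂ) + ε * Complex.exp (-(t * I))⟩ (fun z => f (-z)) := by
    have hpi := Real.pi_pos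
    have hcirc : ∀ x t : ℝ, HasDerivAt (fun t : ℝ => (x : ℂ) + ε * Complex.exp (-(t * I)))
        (ε * (Complex.exp (-(t * I)) * -(1 * I))) t := fun x t =>
      (((((Complex.ofRealCLM.hasDerivAt (x := t)).mul_const I).neg).cexp).const_mul
        (ε : ℂ)).const_add _
    have hshift : ∀ t : ℝ, Complex.exp (-(((t + Real.pi : ℝ) : ℂ) * I)) =
        -Complex.exp (-(t * I)) := by
      intro t
      have : -(((t + Real.pi : ℝ) : ℂ) * I) = -(t * I) + -(Real.pi * I) := by push_cast; ring
      rw [this, Complex.exp_add, Complex.exp_neg (Real.pi * I), Complex.exp_pi_mul_I]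
      norm_num
    unfold arcInt
    simp only [(hcirc _ _).deriv]
    rw [integral_Icc_eq_integral_Ioc, integral_Icc_eq_integral_Ioc,
      ← intervalIntegral.integral_of_le (by linarith),
      ← intervalIntegral.integral_of_le (by linarith)]
    have h2 := intervalIntegral.integral_comp_add_right (a := -(Real.pi / 2)) (b := Real.pi / 2)
      (fun t : ℝ => ε * (Complex.exp (-(t * I)) * -(1 * I)) *
        f (-(((-d : ℝ) : ℂ) + ε * Complex.exp (-(t * I))))) Real.pi
    have e1 : -(Real.pi / 2) + Real.pi = Real.pi / 2 := by ring
    have e2 : Real.pi / 2 + Real.pi = 3 * Real.pi / 2 := by ring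
    rw [e1, e2] at h2
    rw [← h2, ← intervalIntegral.integral_neg]
    congr 1
    funext t
    rw [hshift]
    have e3 : -(((-d : ℝ) : ℂ) + ε * -Complex.exp (-(t * I))) =
        (d : ℂ) + ε * Complex.exp (-(t * I)) := by push_cast; ring
    rw [e3]
    generalize Complex.exp (-(t * I)) = w
    generalize f (d + ε * w) = v
    ring
  rw [e0, h]
  have j1 : ∫ s in (-ε)..ε, f (-(((-d - r : ℝ) : ℂ) + s * I)) =
      ∫ s in (-ε)..ε, f (((d + r : ℝ) : ℂ) + s * I) := by
    have := intervalIntegral.integral_comp_neg (a := -ε) (b := ε)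
      fun s : ℝ => f (((d + r : ℝ) : ℂ) + s * I)
    rw [neg_neg] at this
    rw [← this]
    congr 1
    funext s
    congr 1
    push_cast
    ring
  have j2 : ∀ y : ℝ, ∫ t in (-d - r)..(-d), f (-((t : ℂ) + (y : ℝ) * I)) =
      ∫ t in d..(d + r), f ((t : ℂ) + (-y : ℝ) * I) := by
    intro y
    have := intervalIntegral.integral_comp_neg (a := -d - r) (b := -d)
      fun t : ℝ => f ((t : ℂ) + (-y : ℝ) * I)
    have e1 : -(-d - r) = d + r := by ring
    rw [neg_neg, e1] at this
    rw [← this]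
    congr 1
    funext s
    congr 1
    push_cast
    ring
  rw [j1, j2 ε, j2 (-ε), neg_neg]
  ring

end Deformation

/-! ### Boxes around an interval of the extended real line -/

section Around

open Complex (I)

/-- The box with sides `lo`, `hi`, `y₀`, `y₁` surrounds `[c, d] ⊆ [-∞, ∞]`: it is open at exactly
those ends at which `[c, d]` is unbounded. -/
structure Around (c d lo hi : EReal) (y₀ y₁ : ℝ) : Prop where
  left : (c = ⊥ ∧ lo = ⊥) ∨ (lo ≠ ⊥ ∧ lo < c)
  right : (d = ⊤ ∧ hi = ⊤) ∨ (hi ≠ ⊤ ∧ d < hi)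
  neg : y₀ < 0
  pos : 0 < y₁

namespace Around

variable {c d lo hi lo' hi' : EReal} {y₀ y₁ y₀' y₁' : ℝ}

theorem lo_le (h : Around c d lo hi y₀ y₁) : lo ≤ c := by
  rcases h.left with ⟨-, h⟩ | ⟨-, h⟩
  · exact h ▸ bot_le
  · exact h.le

theorem le_hi (h : Around c d lo hi y₀ y₁) : d ≤ hi := by
  rcases h.right with ⟨-, h⟩ | ⟨-, h⟩
  · exact h ▸ le_top
  · exact h.le

theorem lo_ne_top (h : Around c d lo hi y₀ y₁) : lo ≠ ⊤ := by
  rcases h.left with ⟨-, h⟩ | ⟨-, h⟩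
  · simp [h]
  · exact h.ne_top

theorem hi_ne_bot (h : Around c d lo hi y₀ y₁) : hi ≠ ⊥ := by
  rcases h.right with ⟨-, h⟩ | ⟨-, h⟩
  · simp [h]
  · exact h.ne_bot

theorem finitePart_subset (h : Around c d lo hi y₀ y₁) :
    finitePart (Icc c d) ⊆ openBox lo hi y₀ y₁ := by
  rintro z ⟨hz, h1, h2⟩
  refine ⟨?_, ?_, by rw [hz]; exact h.neg, by rw [hz]; exact h.pos⟩
  · rcases h.left with ⟨-, h⟩ | ⟨-, h⟩
    · rw [h]; exact EReal.bot_lt_coe _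
    · exact h.trans_le h1
  · rcases h.right with ⟨-, h⟩ | ⟨-, h⟩
    · rw [h]; exact EReal.coe_lt_top _
    · exact h2.trans_lt h

/-- Two boxes around `[c, d]` lie in a common box around `[c, d]`. -/
theorem sup (h : Around c d lo hi y₀ y₁) (h' : Around c d lo' hi' y₀' y₁') :
    Around c d (min lo lo') (max hi hi') (min y₀ y₀') (max y₁ y₁') := by
  refine ⟨?_, ?_, (min_le_left _ _).trans_lt h.neg, h.pos.trans_le (le_max_left _ _)⟩
  · rcases h.left with ⟨h1, h2⟩ | ⟨h1, h2⟩
    · exact Or.inl ⟨h1, by simp [h2]⟩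
    · rcases h'.left with ⟨h3, h4⟩ | ⟨h3, h4⟩
      · exact Or.inl ⟨h3, by simp [h4]⟩
      · refine Or.inr ⟨?_, (min_le_left _ _).trans_lt h2⟩
        rcases min_choice lo lo' with h | h <;> rw [h] <;> assumption
  · rcases h.right with ⟨h1, h2⟩ | ⟨h1, h2⟩
    · exact Or.inl ⟨h1, by simp [h2]⟩
    · rcases h'.right with ⟨h3, h4⟩ | ⟨h3, h4⟩
      · exact Or.inl ⟨h3, by simp [h4]⟩
      · refine Or.inr ⟨?_, h2.trans_le (le_max_left _ _)⟩
        rcases max_choice hi hi' with h | h <;> rw [h] <;> assumption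

end Around

/-- Exponential decay in the real direction between any two boxes around `[c, d]`. -/
def DecaysAround (c d : EReal) (f : ℂ → ℂ) : Prop :=
  ∀ ⦃lo hi lo' hi' : EReal⦄ ⦃y₀ y₁ y₀' y₁' : ℝ⦄, Around c d lo hi y₀ y₁ →
    Around c d lo' hi' y₀' y₁' → ExpDecayOn f (closedBox lo' hi' y₀' y₁' \ openBox lo hi y₀ y₁)

/-- The integral over the boundary of a box around `[c, d]` does not depend on the box. -/
theorem rectInt_eq_of_around {c d lo hi lo' hi' : EReal} {y₀ y₁ y₀' y₁' : ℝ} (hcd : c ≤ d)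
    {f : ℂ → ℂ} (hf : ∀ z ∉ finitePart (Icc c d), DifferentiableAt ℂ f z)
    (hd : DecaysAround c d f) (h : Around c d lo hi y₀ y₁) (h' : Around c d lo' hi' y₀' y₁') :
    rectInt f lo hi y₀ y₁ = rectInt f lo' hi' y₀' y₁' := by
  have key : ∀ {lo hi lo' hi' : EReal} {y₀ y₁ y₀' y₁' : ℝ}, Around c d lo hi y₀ y₁ →
      Around c d lo' hi' y₀' y₁' → lo' ≤ lo → hi ≤ hi' → y₀' ≤ y₀ → y₁ ≤ y₁' →
      rectInt f lo' hi' y₀' y₁' = rectInt f lo hi y₀ y₁ := by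
    intro lo hi lo' hi' y₀ y₁ y₀' y₁' h h' h1 h2 h3 h4
    exact rectInt_eq_of_nested h1 h2 (h.lo_le.trans (hcd.trans h.le_hi)) h.lo_ne_top h.hi_ne_bot h3
      (h.neg.trans h.pos).le h4 (fun z hz => hf z fun hz' => hz.2 (h.finitePart_subset hz'))
      (hd h h')
  rw [← key h (h.sup h') (min_le_left _ _) (le_max_left _ _) (min_le_left _ _) (le_max_left _ _),
    ← key h' (h.sup h') (min_le_right _ _) (le_max_right _ _) (min_le_right _ _)
      (le_max_right _ _)]

theorem horiz_coe (f : ℂ → ℂ) {x₀ x₁ : ℝ} (h : x₀ ≤ x₁) (y : ℝ) :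
    horiz f x₀ x₁ y = ∫ t in x₀..x₁, f ((t : ℂ) + y * I) := by
  have : realPart x₀ x₁ = Icc x₀ x₁ := by
    ext t
    simp [realPart]
  rw [horiz, this, integral_Icc_eq_integral_Ioc, intervalIntegral.integral_of_le h]

theorem realPart_subset_union (lo m hi : EReal) :
    realPart lo hi ⊆ realPart lo m ∪ realPart m hi := by
  rintro t ⟨h1, h2⟩
  rcases le_total (t : EReal) m with h | h
  · exact Or.inl ⟨h1, h⟩
  · exact Or.inr ⟨h, h2⟩

theorem mem_ball_of_abs_le {c x y r ε ρ : ℝ} (hr : 0 < r) (hε : 0 < ε) (hρ : r + ε ≤ ρ)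
    (hx : |x - c| ≤ r) (hy : |y| ≤ ε) : (x : ℂ) + y * I ∈ Metric.ball (c : ℂ) ρ := by
  rw [Metric.mem_ball, dist_eq_norm]
  have h1 : (x : ℂ) + y * I - c = ((x - c : ℝ) : ℂ) + (y : ℂ) * I := by push_cast; ring
  rw [h1]
  refine lt_of_lt_of_le ?_ hρ
  have h2 : ‖((x - c : ℝ) : ℂ) + (y : ℂ) * I‖ ^ 2 = (x - c) ^ 2 + y ^ 2 := by
    rw [← Complex.normSq_eq_norm_sq, Complex.normSq_add_mul_I]
  refine lt_of_pow_lt_pow_left₀ 2 (by linarith) ?_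
  rw [h2]
  have h3 := sq_le_sq' (abs_le.1 hx).1 (abs_le.1 hx).2
  have h4 := sq_le_sq' (abs_le.1 hy).1 (abs_le.1 hy).2
  nlinarith

theorem coe_mem_finitePart {c d : EReal} {x : ℝ} (h1 : c ≤ x) (h2 : (x : EReal) ≤ d) :
    (x : ℂ) ∈ finitePart (Icc c d) := ⟨by simp, by simpa using ⟨h1, h2⟩⟩

/-- A contour with circular ends may be replaced by a rectangle of the same height. -/
theorem cint_contour_eq_rectInt_near {c d : EReal} (hcd : c ≤ d) (hc : c ≠ ⊤) (hd : d ≠ ⊥)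
    {ε r ρ : ℝ} (hε : 0 < ε) (hr : 0 < r) (hρ : r + ε ≤ ρ) {f : ℂ → ℂ}
    (hf : ∀ z ∈ Metric.thickening ρ (finitePart (Icc c d)), z ∉ finitePart (Icc c d) →
      DifferentiableAt ℂ f z)
    (hdec : ExpDecayOn f {z | c ≤ (z.re : EReal) ∧ (z.re : EReal) ≤ d ∧ |z.im| = ε}) :
    cint (contour c d ε) f = rectInt f (c - r) (d + r) (-ε) ε := by
  have hball : ∀ x : ℝ, c ≤ x → (x : EReal) ≤ d →
      Metric.ball (x : ℂ) ρ ⊆ Metric.thickening ρ (finitePart (Icc c d)) := fun x h1 h2 =>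
    Metric.ball_subset_thickening (coe_mem_finitePart h1 h2) ρ
  have hmem : ∀ x t y : ℝ, c ≤ x → (x : EReal) ≤ d → |t - x| ≤ r → |y| = ε →
      DifferentiableAt ℂ f ((t : ℂ) + y * I) := by
    intro x t y h1 h2 h3 h4
    refine hf _ (hball x h1 h2 (mem_ball_of_abs_le hr hε hρ h3 h4.le)) fun h => ?_
    have h5 := h.1
    simp only [Complex.add_im, Complex.ofReal_im, Complex.mul_im, Complex.ofReal_re, Complex.I_im,
      mul_one, Complex.I_re, mul_zero, add_zero, zero_add] at h5
    rw [h5, abs_zero] at h4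
    exact hε.ne h4
  have hsε : |ε| = ε ∧ |(-ε)| = ε := by rw [abs_neg, abs_of_pos hε]; exact ⟨rfl, rfl⟩
  have i0 : ∀ y, |y| = ε → IntegrableOn (fun t : ℝ => f ((t : ℂ) + y * I)) (realPart c d) := by
    intro y hy
    obtain ⟨C, δ, hδ, hC⟩ := hdec
    refine integrableOn_line (C := C) (isClosed_realPart _ _) (fun t ht => ?_) hδ (fun t ht => ?_)
    · exact hmem t t y ht.1 ht.2 (by simpa using hr.le) hy
    · simpa using hC ((t : ℂ) + y * I) (by simpa using ⟨ht.1, ht.2, hy⟩)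
  have icc : ∀ x x₀ x₁ y : ℝ, c ≤ x → (x : EReal) ≤ d → |y| = ε → x - r ≤ x₀ → x₁ ≤ x + r →
      IntegrableOn (fun t : ℝ => f ((t : ℂ) + y * I)) (realPart x₀ x₁) := by
    intro x x₀ x₁ y h1 h2 h3 h4 h5
    have : realPart x₀ x₁ = Icc x₀ x₁ := by
      ext t
      simp [realPart]
    rw [this]
    refine (continuousOn_line fun t ht => hmem x t y h1 h2 ?_ h3).integrableOn_compact isCompact_Icc
    exact abs_le.2 ⟨by linarith [ht.1], by linarith [ht.2]⟩
  have i1 : ∀ y, |y| = ε →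
      IntegrableOn (fun t : ℝ => f ((t : ℂ) + y * I)) (realPart (c - r) d) := by
    intro y hy
    induction c with
    | bot => simpa using i0 y hy
    | top => exact absurd rfl hc
    | coe c =>
      refine IntegrableOn.mono_set ?_ (realPart_subset_union _ c _)
      refine IntegrableOn.union ?_ (i0 y hy)
      exact_mod_cast icc c (c - r) c y le_rfl hcd hy le_rfl (by linarith)
  have i2 : ∀ y, |y| = ε →
      IntegrableOn (fun t : ℝ => f ((t : ℂ) + y * I)) (realPart (c - r) (d + r)) := by
    intro y hy
    induction d with
    | bot => exact absurd rfl hd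
    | top => simpa using i1 y hy
    | coe d =>
      refine IntegrableOn.mono_set ?_ (realPart_subset_union _ d _)
      refine IntegrableOn.union (i1 y hy) ?_
      exact_mod_cast icc d d (d + r) y hcd le_rfl hy (by linarith) le_rfl
  -- `L` and `R` compare the contributions of the left and of the right end. At an infinite end both
  -- contributions are empty.
  have L : ((leftEnd c ε).map fun A => arcInt A f).sum + horiz f c d ε - horiz f c d (-ε) =
      vert f (-ε) ε (c - r) + horiz f (c - r) d ε - horiz f (c - r) d (-ε) := by
    induction c with
    | bot => simp [leftEnd, vert_bot]
    | top => exact absurd rfl hc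
    | coe c =>
      have e : (c : EReal) - (r : EReal) = ((c - r : ℝ) : EReal) := by norm_cast
      have h := arcInt_leftHalfCircle (f := f) (c := c) hε hr hρ (fun z hz hz' => by
        refine hf z (hball c le_rfl hcd hz) fun h => hz' ⟨h.1, ?_⟩
        exact EReal.coe_le_coe_iff.1 h.2.1)
      have h1 : ((c - r : ℝ) : EReal) ≤ c := by
        rw [EReal.coe_le_coe_iff]; linarith
      rw [e] at i1 ⊢
      rw [horiz_add_horiz h1 hcd (i1 ε hsε.1), horiz_add_horiz h1 hcd (i1 (-ε) hsε.2),
        horiz_coe f (by linarith), horiz_coe f (by linarith), vert_coe]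
      have hl : leftEnd (c : EReal) ε = [⟨Icc (Real.pi / 2) (3 * Real.pi / 2),
          fun t => (c : ℂ) + ε * Complex.exp (-(t * I))⟩] := by simp [leftEnd]
      rw [hl, List.map_singleton, List.sum_singleton, h]
      ring
  have R : ((rightEnd d ε).map fun A => arcInt A f).sum + horiz f (c - r) d ε -
      horiz f (c - r) d (-ε) = -vert f (-ε) ε (d + r) + horiz f (c - r) (d + r) ε -
        horiz f (c - r) (d + r) (-ε) := by
    induction d with
    | bot => exact absurd rfl hd
    | top => simp [rightEnd, vert_top]
    | coe d =>
      have e : (d : EReal) + (r : EReal) = ((d + r : ℝ) : EReal) := by norm_cast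
      have h := arcInt_rightHalfCircle (f := f) (d := d) hε hr hρ (fun z hz hz' => by
        refine hf z (hball d hcd le_rfl hz) fun h => hz' ⟨h.1, ?_⟩
        exact EReal.coe_le_coe_iff.1 h.2.2)
      have h1 : (d : EReal) ≤ ((d + r : ℝ) : EReal) := by
        rw [EReal.coe_le_coe_iff]; linarith
      have h2 : c - (r : EReal) ≤ (d : EReal) := by
        refine le_trans ?_ hcd
        induction c with
        | bot => simp
        | top => exact absurd rfl hc
        | coe c => norm_cast; linarith
      rw [e] at i2 ⊢
      rw [horiz_add_horiz h2 h1 (i2 ε hsε.1), horiz_add_horiz h2 h1 (i2 (-ε) hsε.2),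
        horiz_coe f (by linarith), horiz_coe f (by linarith), vert_coe]
      have hl : rightEnd (d : EReal) ε = [⟨Icc (-(Real.pi / 2)) (Real.pi / 2),
          fun t => (d : ℂ) + ε * Complex.exp (-(t * I))⟩] := by simp [rightEnd]
      rw [hl, List.map_singleton, List.sum_singleton, h]
      ring
  have hcont : contour c d ε = leftEnd c ε ++ [topArc c d ε] ++ rightEnd d ε ++
      [bottomArc c d ε] := by simp [contour, hc, hd]
  simp only [cint, hcont, List.map_append, List.sum_append, List.map_cons, List.map_nil,
    List.sum_cons, List.sum_nil, arcInt_topArc, arcInt_bottomArc, rectInt]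
  linear_combination L + R

theorem expDecayOn_of_isCompact {f : ℂ → ℂ} {Z : Set ℂ} (hZ : IsCompact Z)
    (hf : ContinuousOn f Z) : ExpDecayOn f Z := by
  have h1 : ContinuousOn (fun z : ℂ => ‖f z‖ * Real.exp |z.re|) Z :=
    hf.norm.mul (by fun_prop)
  obtain ⟨C, hC⟩ := hZ.exists_bound_of_continuousOn h1
  refine ⟨C, 1, one_pos, fun z hz => ?_⟩
  have h2 := hC z hz
  rw [Real.norm_of_nonneg (by positivity)] at h2
  rwa [neg_one_mul, Real.exp_neg, ← div_eq_mul_inv, le_div_iff₀ (Real.exp_pos _)]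

theorem isClosed_closedBox (lo hi : EReal) (y₀ y₁ : ℝ) : IsClosed (closedBox lo hi y₀ y₁) := by
  have h1 : Continuous fun z : ℂ => (z.re : EReal) :=
    continuous_coe_real_ereal.comp Complex.continuous_re
  exact (isClosed_le continuous_const h1).inter ((isClosed_le h1 continuous_const).inter
    ((isClosed_le continuous_const Complex.continuous_im).inter
      (isClosed_le Complex.continuous_im continuous_const)))

theorem isOpen_openBox (lo hi : EReal) (y₀ y₁ : ℝ) : IsOpen (openBox lo hi y₀ y₁) := by
  have h1 : Continuous fun z : ℂ => (z.re : EReal) :=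
    continuous_coe_real_ereal.comp Complex.continuous_re
  exact (isOpen_lt continuous_const h1).inter ((isOpen_lt h1 continuous_const).inter
    ((isOpen_lt continuous_const Complex.continuous_im).inter
      (isOpen_lt Complex.continuous_im continuous_const)))

theorem isCompact_closedBox (x₀ x₁ y₀ y₁ : ℝ) : IsCompact (closedBox x₀ x₁ y₀ y₁) := by
  have : closedBox x₀ x₁ y₀ y₁ = Icc x₀ x₁ ×ℂ Icc y₀ y₁ := by
    ext z
    simp [closedBox, Complex.mem_reProdIm, and_assoc]
  rw [this]
  exact isCompact_Icc.reProdIm isCompact_Icc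

theorem around_coe {a b x₀ x₁ y₀ y₁ : ℝ} (h₀ : x₀ < a) (h₁ : b < x₁) (hy₀ : y₀ < 0)
    (hy₁ : 0 < y₁) : Around (a : EReal) b x₀ x₁ y₀ y₁ :=
  ⟨Or.inr ⟨EReal.coe_ne_bot _, by exact_mod_cast h₀⟩,
    Or.inr ⟨EReal.coe_ne_top _, by exact_mod_cast h₁⟩, hy₀, hy₁⟩

theorem around_sub_add {c d : EReal} (hc : c ≠ ⊤) (hd : d ≠ ⊥) {r y : ℝ} (hr : 0 < r)
    (hy : 0 < y) : Around c d (c - r) (d + r) (-y) y := by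
  refine ⟨?_, ?_, by linarith, hy⟩
  · induction c with
    | bot => exact Or.inl ⟨rfl, EReal.bot_sub _⟩
    | top => exact absurd rfl hc
    | coe c =>
      rw [← EReal.coe_sub]
      exact Or.inr ⟨EReal.coe_ne_bot _, EReal.coe_lt_coe_iff.2 (by linarith)⟩
  · induction d with
    | bot => exact absurd rfl hd
    | top => exact Or.inl ⟨rfl, EReal.top_add_coe _⟩
    | coe d =>
      rw [← EReal.coe_add]
      exact Or.inr ⟨EReal.coe_ne_top _, EReal.coe_lt_coe_iff.2 (by linarith)⟩

theorem mem_thickening_of_mem_closedBox {a b r ε ρ : ℝ} (hab : a ≤ b) (hr : 0 < r) (hε : 0 < ε)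
    (hρ : r + ε ≤ ρ) {z : ℂ} (hz : z ∈ closedBox (a - r : ℝ) (b + r : ℝ) (-ε) ε) :
    z ∈ Metric.thickening ρ (finitePart (Icc (a : EReal) b)) := by
  obtain ⟨h1, h2, h3, h4⟩ := hz
  rw [EReal.coe_le_coe_iff] at h1 h2
  rw [Metric.mem_thickening_iff]
  have h5 : |z.re - max a (min b z.re)| ≤ r := by
    rw [abs_le]
    rcases le_total b z.re with h | h
    · rw [min_eq_left h, max_eq_right hab]; constructor <;> linarith
    · rw [min_eq_right h]
      rcases le_total a z.re with h' | h'
      · rw [max_eq_right h']; constructor <;> linarith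
      · rw [max_eq_left h']; constructor <;> linarith
  refine ⟨((max a (min b z.re) : ℝ) : ℂ), coe_mem_finitePart ?_ ?_, ?_⟩
  · exact_mod_cast le_max_left _ _
  · exact_mod_cast max_le hab (min_le_left _ _)
  · have := mem_ball_of_abs_le hr hε hρ h5 (abs_le.2 ⟨h3, h4⟩)
    rwa [Complex.re_add_im] at this

/-- A contour around a compact interval may be replaced by a flatter rectangle. -/
theorem cint_contour_eq_rectInt_flat {a b : ℝ} (hab : a ≤ b) {ε ε' r ρ : ℝ} (hε : 0 < ε)
    (hε' : 0 < ε') (hle : ε' ≤ ε) (hr : 0 < r) (hρ : r + ε ≤ ρ) {f : ℂ → ℂ}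
    (hf : ∀ z ∈ Metric.thickening ρ (finitePart (Icc (a : EReal) b)),
      z ∉ finitePart (Icc (a : EReal) b) → DifferentiableAt ℂ f z) :
    cint (contour a b ε) f = rectInt f (a - r : ℝ) (b + r : ℝ) (-ε') ε' := by
  have hA : ∀ {y : ℝ}, 0 < y → Around (a : EReal) b (a - r : ℝ) (b + r : ℝ) (-y) y := fun hy =>
    around_coe (by linarith) (by linarith) (by linarith) hy
  have hdiff : ∀ y, 0 < y → ∀ z ∈ closedBox (a - r : ℝ) (b + r : ℝ) (-ε) ε \
      openBox (a - r : ℝ) (b + r : ℝ) (-y) y, DifferentiableAt ℂ f z := fun y hy z hz =>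
    hf z (mem_thickening_of_mem_closedBox hab hr hε hρ hz.1)
      fun h => hz.2 ((hA hy).finitePart_subset h)
  have hdec : ∀ y, 0 < y → ExpDecayOn f (closedBox (a - r : ℝ) (b + r : ℝ) (-ε) ε \
      openBox (a - r : ℝ) (b + r : ℝ) (-y) y) := fun y hy =>
    expDecayOn_of_isCompact ((isCompact_closedBox _ _ _ _).diff (isOpen_openBox _ _ _ _))
      fun z hz => (hdiff y hy z hz).continuousAt.continuousWithinAt
  have h1 := cint_contour_eq_rectInt_near (c := (a : EReal)) (d := b) (by exact_mod_cast hab)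
    (EReal.coe_ne_top _) (EReal.coe_ne_bot _) hε hr hρ hf ((hdec ε hε).mono (by
      rintro z ⟨h1, h2, h3⟩
      rw [EReal.coe_le_coe_iff] at h1 h2
      refine ⟨⟨?_, ?_, (abs_le.1 h3.le).1, (abs_le.1 h3.le).2⟩, fun h => ?_⟩
      · exact_mod_cast by linarith
      · exact_mod_cast by linarith
      · exact absurd (abs_lt.2 ⟨h.2.2.1, h.2.2.2⟩) (not_lt.2 h3.ge)))
  rw [h1]
  have e1 : (a : EReal) - (r : EReal) = ((a - r : ℝ) : EReal) := by norm_cast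
  have e2 : (b : EReal) + (r : EReal) = ((b + r : ℝ) : EReal) := by norm_cast
  rw [e1, e2]
  exact rectInt_eq_of_nested le_rfl le_rfl (by exact_mod_cast by linarith) (EReal.coe_ne_top _)
    (EReal.coe_ne_bot _) (by linarith) (by linarith) hle (hdiff ε' hε') (hdec ε' hε')

/-- The integral over the contour around `[a, b]` does not depend on its width, as long as the
contour stays in the neighbourhood of `[a, b]` where the function is holomorphic. -/
theorem cint_contour_eq_of_width {a b : ℝ} (hab : a ≤ b) {ε ε' ρ : ℝ} (hε : 0 < ε)
    (hε' : 0 < ε') (hρ : ε < ρ) (hρ' : ε' < ρ) {f : ℂ → ℂ}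
    (hf : ∀ z ∈ Metric.thickening ρ (finitePart (Icc (a : EReal) b)),
      z ∉ finitePart (Icc (a : EReal) b) → DifferentiableAt ℂ f z) :
    cint (contour a b ε) f = cint (contour a b ε') f := by
  have hm : 0 < min ε ε' := lt_min hε hε'
  have hr : 0 < min (ρ - ε) (ρ - ε') := lt_min (by linarith) (by linarith)
  rw [cint_contour_eq_rectInt_flat hab hε hm (min_le_left _ _) hr
      (by linarith [min_le_left (ρ - ε) (ρ - ε')]) hf,
    cint_contour_eq_rectInt_flat hab hε' hm (min_le_right _ _) hr
      (by linarith [min_le_right (ρ - ε) (ρ - ε')]) hf]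

/-- The integral over the contour around `[a, b]` equals that over the boundary of a rectangle
around `[a, b]`. The function need only be holomorphic off `[a, b]` in the rectangle and in a neighbourhood
of `[a, b]` that contains the contour. -/
theorem cint_contour_eq_rectInt_of_box {a b : ℝ} (hab : a ≤ b) {ε ρ x₀ x₁ y₀ y₁ : ℝ} (hε : 0 < ε)
    (hρ : ε < ρ) (hx₀ : x₀ < a) (hx₁ : b < x₁) (hy₀ : y₀ < 0) (hy₁ : 0 < y₁) {f : ℂ → ℂ}
    (hf : ∀ z ∈ Metric.thickening ρ (finitePart (Icc (a : EReal) b)),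
      z ∉ finitePart (Icc (a : EReal) b) → DifferentiableAt ℂ f z)
    (hf' : ∀ z ∈ closedBox x₀ x₁ y₀ y₁, z ∉ finitePart (Icc (a : EReal) b) →
      DifferentiableAt ℂ f z) :
    cint (contour a b ε) f = rectInt f x₀ x₁ y₀ y₁ := by
  obtain ⟨r, hr0, hr⟩ : ∃ r, 0 < r ∧ r ≤ ρ - ε ∧ r ≤ a - x₀ ∧ r ≤ x₁ - b := by
    refine ⟨min (ρ - ε) (min (a - x₀) (x₁ - b)), lt_min (by linarith)
      (lt_min (by linarith) (by linarith)), min_le_left _ _, ?_, ?_⟩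
    · exact (min_le_right _ _).trans (min_le_left _ _)
    · exact (min_le_right _ _).trans (min_le_right _ _)
  obtain ⟨y, hy0, hy⟩ : ∃ y, 0 < y ∧ y ≤ ε ∧ y ≤ -y₀ ∧ y ≤ y₁ := by
    refine ⟨min ε (min (-y₀) y₁), lt_min hε (lt_min (by linarith) hy₁), min_le_left _ _, ?_, ?_⟩
    · exact (min_le_right _ _).trans (min_le_left _ _)
    · exact (min_le_right _ _).trans (min_le_right _ _)
  rw [cint_contour_eq_rectInt_flat hab hε hy0 hy.1 hr0 (by linarith [hr.1]) hf]
  have hA : Around (a : EReal) b (a - r : ℝ) (b + r : ℝ) (-y) y :=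
    around_coe (by linarith) (by linarith) (by linarith) hy0
  have hdiff : ∀ z ∈ closedBox x₀ x₁ y₀ y₁ \ openBox (a - r : ℝ) (b + r : ℝ) (-y) y,
      DifferentiableAt ℂ f z := fun z hz => hf' z hz.1 fun h => hz.2 (hA.finitePart_subset h)
  refine (rectInt_eq_of_nested ?_ ?_ ?_ (EReal.coe_ne_top _) (EReal.coe_ne_bot _) (by linarith)
    (by linarith) hy.2.2 hdiff (expDecayOn_of_isCompact ((isCompact_closedBox _ _ _ _).diff
      (isOpen_openBox _ _ _ _)) fun z hz => (hdiff z hz).continuousAt.continuousWithinAt)).symm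
  · exact_mod_cast by linarith [hr.2.1]
  · exact_mod_cast by linarith [hr.2.2]
  · exact_mod_cast by linarith

/-- The integral over the contour around `[c, d]` equals the integral over the boundary of any box
around `[c, d]`. -/
theorem cint_contour_eq_rectInt {c d lo hi : EReal} {y₀ y₁ ε : ℝ} (hcd : c ≤ d) {f : ℂ → ℂ}
    (hf : ∀ z ∉ finitePart (Icc c d), DifferentiableAt ℂ f z) (hd : DecaysAround c d f)
    (hε : 0 < ε) (h : Around c d lo hi y₀ y₁) :
    cint (contour c d ε) f = rectInt f lo hi y₀ y₁ := by
  by_cases hc : c = ⊤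
  · have hd' : d = ⊤ := top_le_iff.1 (hc ▸ hcd)
    subst hc hd'
    have e : contour ⊤ ⊤ ε = rectContour ((1 / ε : ℝ) : EReal) ⊤ (-ε) ε := by
      simp [contour, rectContour, leftEnd, rightEnd, -one_div]
    have h' : Around ⊤ ⊤ ((1 / ε : ℝ) : EReal) ⊤ (-ε) ε :=
      ⟨Or.inr ⟨EReal.coe_ne_bot _, EReal.coe_lt_top _⟩, Or.inl ⟨rfl, rfl⟩, by linarith, hε⟩
    rw [e, cint_rectContour f (by linarith) (EReal.coe_ne_top _) (by simp)]
    exact rectInt_eq_of_around hcd hf hd h' h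
  by_cases hb : d = ⊥
  · have hc' : c = ⊥ := le_bot_iff.1 (hb ▸ hcd)
    subst hb hc'
    have e : contour ⊥ ⊥ ε = rectContour ⊥ ((-(1 / ε) : ℝ) : EReal) (-ε) ε := by
      simp [contour, rectContour, leftEnd, rightEnd, -one_div]
    have h' : Around ⊥ ⊥ ⊥ ((-(1 / ε) : ℝ) : EReal) (-ε) ε :=
      ⟨Or.inl ⟨rfl, rfl⟩, Or.inr ⟨EReal.coe_ne_top _, EReal.bot_lt_coe _⟩, by linarith, hε⟩
    rw [e, cint_rectContour f (by linarith) (by simp) (EReal.coe_ne_bot _)]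
    exact rectInt_eq_of_around hcd hf hd h' h
  have h' := around_sub_add hc hb one_pos hε
  rw [cint_contour_eq_rectInt_near hcd hc hb hε one_pos le_rfl (fun z _ hz => hf z hz)
    ((hd h' h').mono ?_)]
  · exact rectInt_eq_of_around hcd hf hd h' h
  · rintro z ⟨h1, h2, h3⟩
    refine ⟨⟨h'.lo_le.trans h1, h2.trans h'.le_hi, (abs_le.1 h3.le).1, (abs_le.1 h3.le).2⟩,
      fun h => absurd (abs_lt.2 ⟨h.2.2.1, h.2.2.2⟩) (not_lt.2 h3.ge)⟩

end Around

/-! ### The sets `S_n(K)` and the growth of elements of `O^exp` -/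

section Growth

open Complex (I)

/-- The closure of `U_n(K)` lies in the corresponding set with non-strict inequalities. -/
theorem closure_U_subset (n : ℕ) (K : Set EReal) :
    closure (U n K) ⊆ Metric.cthickening (1 / (n : ℝ)) (finitePart K) ∪
      {z | ⊤ ∈ K ∧ (n : ℝ) ≤ z.re ∧ |z.im| ≤ 1 / (n : ℝ)} ∪
      {z | ⊥ ∈ K ∧ z.re ≤ -(n : ℝ) ∧ |z.im| ≤ 1 / (n : ℝ)} := by
  refine closure_minimal ?_ ?_
  · refine union_subset_union (union_subset_union (Metric.thickening_subset_cthickening _ _) ?_) ?_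
    · rintro z ⟨h1, h2, h3⟩
      exact ⟨h1, h2.le, h3.le⟩
    · rintro z ⟨h1, h2, h3⟩
      exact ⟨h1, h2.le, h3.le⟩
  · have him : Continuous fun z : ℂ => |z.im| := continuous_abs.comp Complex.continuous_im
    refine (Metric.isClosed_cthickening.union ?_).union ?_
    · by_cases h : ⊤ ∈ K
      · simp only [h, true_and]
        exact (isClosed_le continuous_const Complex.continuous_re).inter
          (isClosed_le him continuous_const)
      · simp [h]
    · by_cases h : ⊥ ∈ K
      · simp only [h, true_and]
        exact (isClosed_le Complex.continuous_re continuous_const).inter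
          (isClosed_le him continuous_const)
      · simp [h]

/-- A sufficient condition for `z` to lie in `S_n(K)`, in terms of inequalities. The distance from
`K ∩ ℂ` is required to exceed `1 / n` uniformly, because `S_n(K)` is defined by the closure of
`U_n(K)`. -/
theorem mem_S_of {n : ℕ} {K : Set EReal} {z : ℂ} {η : ℝ} (hη : 1 / (n : ℝ) < η)
    (hd : ∀ k ∈ finitePart K, η ≤ dist z k) (htop : ⊤ ∈ K → z.re < n ∨ 1 / (n : ℝ) < |z.im|)
    (hbot : ⊥ ∈ K → -(n : ℝ) < z.re ∨ 1 / (n : ℝ) < |z.im|) (him : |z.im| < n) : z ∈ S n K := by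
  refine ⟨fun h => ?_, him⟩
  rcases closure_U_subset n K h with (h | ⟨h1, h2, h3⟩) | ⟨h1, h2, h3⟩
  · rw [Metric.mem_cthickening_iff] at h
    have h1 : ENNReal.ofReal η ≤ Metric.infEDist z (finitePart K) := by
      refine Metric.le_infEDist.2 fun k hk => ?_
      rw [edist_dist]
      exact ENNReal.ofReal_le_ofReal (hd k hk)
    have h2 := (ENNReal.ofReal_le_ofReal_iff (by positivity)).1 (h1.trans h)
    linarith
  · rcases htop h1 with h | h <;> linarith
  · rcases hbot h1 with h | h <;> linarith

theorem le_dist_of_mem_S {n : ℕ} {K : Set EReal} {z : ℂ} (hz : z ∈ S n K) {k : ℂ}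
    (hk : k ∈ finitePart K) : 1 / (n : ℝ) ≤ dist z k := by
  by_contra! h
  exact hz.1 (subset_closure (Or.inl (Or.inl (Metric.mem_thickening_iff.2 ⟨k, hk, h⟩))))

theorem strip_of_mem_S_top {n : ℕ} {K : Set EReal} {z : ℂ} (hz : z ∈ S n K) (hK : ⊤ ∈ K) :
    z.re ≤ n ∨ 1 / (n : ℝ) ≤ |z.im| := by
  by_contra! h
  exact hz.1 (subset_closure (Or.inl (Or.inr ⟨hK, h.1, h.2⟩)))

theorem strip_of_mem_S_bot {n : ℕ} {K : Set EReal} {z : ℂ} (hz : z ∈ S n K) (hK : ⊥ ∈ K) :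
    -(n : ℝ) ≤ z.re ∨ 1 / (n : ℝ) ≤ |z.im| := by
  by_contra! h
  exact hz.1 (subset_closure (Or.inr ⟨hK, h.1, h.2⟩))

theorem isOpen_S (n : ℕ) (K : Set EReal) : IsOpen (S n K) :=
  isClosed_closure.isOpen_compl.inter
    (isOpen_lt (continuous_abs.comp Complex.continuous_im) continuous_const)

theorem not_mem_finitePart_of_mem_S {n : ℕ} (hn : 1 ≤ n) {K : Set EReal} {z : ℂ} (hz : z ∈ S n K) :
    z ∉ finitePart K := by
  intro h
  have h1 := le_dist_of_mem_S hz h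
  rw [dist_self] at h1
  have : (0 : ℝ) < 1 / n := by positivity
  linarith

theorem abs_re_sub_le_dist (z k : ℂ) : |z.re - k.re| ≤ dist z k := by
  rw [dist_eq_norm, ← Complex.sub_re]
  exact Complex.abs_re_le_norm _

theorem abs_im_le_dist {z k : ℂ} (hk : k.im = 0) : |z.im| ≤ dist z k := by
  have := Complex.abs_im_le_norm (z - k)
  rwa [Complex.sub_im, hk, sub_zero, ← dist_eq_norm] at this

theorem isClosed_finitePart (c d : EReal) : IsClosed (finitePart (Icc c d)) :=
  (isClosed_eq Complex.continuous_im continuous_const).inter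
    (isClosed_Icc.preimage (continuous_coe_real_ereal.comp Complex.continuous_re))

/-- Every point off the finite part of an interval lies in all but finitely many `S_n`. -/
theorem exists_forall_mem_S {c d : EReal} {z : ℂ} (hz : z ∉ finitePart (Icc c d)) :
    ∃ N : ℕ, 1 ≤ N ∧ ∀ n ≥ N, z ∈ S n (Icc c d) := by
  obtain ⟨η, hη, hηb⟩ := Metric.isOpen_iff.1 (isClosed_finitePart c d).isOpen_compl z hz
  have hd : ∀ k ∈ finitePart (Icc c d), η ≤ dist z k := by
    intro k hk
    by_contra! h
    exact hηb (by rwa [Metric.mem_ball, dist_comm]) hk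
  obtain ⟨N, hN⟩ := exists_nat_gt (max (1 / η) (max |z.re| |z.im|))
  refine ⟨N + 1, by omega, fun n hn => ?_⟩
  have hn' : (N : ℝ) + 1 ≤ n := by exact_mod_cast hn
  have h1 := (le_max_left _ _).trans_lt hN
  have h2 := ((le_max_left _ _).trans (le_max_right _ _)).trans_lt hN
  have h3 := ((le_max_right _ _).trans (le_max_right _ _)).trans_lt hN
  have h4 := abs_lt.1 h2
  refine mem_S_of ?_ hd (fun _ => Or.inl (by linarith)) (fun _ => Or.inl (by linarith))
    (by linarith)
  rw [one_div_lt (by linarith [one_div_pos.2 hη]) hη]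
  linarith

/-- The part of a horizontal strip outside a box around `[c, d]` is contained in all but finitely
many `S_n([c, d])`. -/
theorem exists_forall_strip_subset_S {c d lo hi : EReal} {y₀ y₁ : ℝ}
    (h : Around c d lo hi y₀ y₁) (M : ℝ) :
    ∃ N : ℕ, 1 ≤ N ∧ ∀ n ≥ N, {z : ℂ | |z.im| ≤ M} \ openBox lo hi y₀ y₁ ⊆ S n (Icc c d) := by
  obtain ⟨η, hη, hl, hr, hy₀, hy₁⟩ : ∃ η : ℝ, 0 < η ∧ (c ≠ ⊥ → ∀ x : ℝ, (x : EReal) ≤ lo →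
      ∀ k : ℝ, c ≤ k → x + η ≤ k) ∧ (d ≠ ⊤ → ∀ x : ℝ, hi ≤ (x : EReal) →
      ∀ k : ℝ, (k : EReal) ≤ d → k + η ≤ x) ∧ η ≤ -y₀ ∧ η ≤ y₁ := by
    obtain ⟨η₁, h1, h2⟩ : ∃ η : ℝ, 0 < η ∧ (c ≠ ⊥ → ∀ x : ℝ, (x : EReal) ≤ lo →
        ∀ k : ℝ, c ≤ k → x + η ≤ k) := by
      rcases h.left with ⟨h1, -⟩ | ⟨h1, h2⟩
      · exact ⟨1, one_pos, fun h => absurd h1 h⟩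
      · lift lo to ℝ using ⟨h.lo_ne_top, h1⟩
        induction c with
        | bot => exact absurd h2 (by simp)
        | top => exact ⟨1, one_pos, fun _ x _ k hk => absurd hk (by simp)⟩
        | coe c =>
          rw [EReal.coe_lt_coe_iff] at h2
          refine ⟨c - lo, by linarith, fun _ x hx k hk => ?_⟩
          rw [EReal.coe_le_coe_iff] at hx hk
          linarith
    obtain ⟨η₂, h3, h4⟩ : ∃ η : ℝ, 0 < η ∧ (d ≠ ⊤ → ∀ x : ℝ, hi ≤ (x : EReal) →
        ∀ k : ℝ, (k : EReal) ≤ d → k + η ≤ x) := by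
      rcases h.right with ⟨h1, -⟩ | ⟨h1, h2⟩
      · exact ⟨1, one_pos, fun h => absurd h1 h⟩
      · lift hi to ℝ using ⟨h1, h.hi_ne_bot⟩
        induction d with
        | top => exact absurd h2 (by simp)
        | bot => exact ⟨1, one_pos, fun _ x _ k hk => absurd hk (by simp)⟩
        | coe d =>
          rw [EReal.coe_lt_coe_iff] at h2
          refine ⟨hi - d, by linarith, fun _ x hx k hk => ?_⟩
          rw [EReal.coe_le_coe_iff] at hx hk
          linarith
    refine ⟨min (min η₁ η₂) (min (-y₀) y₁), lt_min (lt_min h1 h3)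
      (lt_min (by linarith [h.neg]) h.pos), fun hc x hx k hk => ?_, fun hd x hx k hk => ?_, ?_, ?_⟩
    · exact le_trans (by gcongr; exact (min_le_left _ _).trans (min_le_left _ _)) (h2 hc x hx k hk)
    · exact le_trans (by gcongr; exact (min_le_left _ _).trans (min_le_right _ _)) (h4 hd x hx k hk)
    · exact (min_le_right _ _).trans (min_le_left _ _)
    · exact (min_le_right _ _).trans (min_le_right _ _)
  obtain ⟨N, hN⟩ := exists_nat_gt (max (max (1 / η) |M|)
    (max |lo.toReal| |hi.toReal|))
  refine ⟨N + 1, by omega, fun n hn z hz => ?_⟩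
  have hn' : (N : ℝ) + 1 ≤ n := by exact_mod_cast hn
  have h1 := ((le_max_left _ _).trans (le_max_left _ _)).trans_lt hN
  have h2 := ((le_max_right _ _).trans (le_max_left _ _)).trans_lt hN
  have h4 := abs_lt.1 (((le_max_left _ _).trans (le_max_right _ _)).trans_lt hN)
  have h5 := abs_lt.1 (((le_max_right _ _).trans (le_max_right _ _)).trans_lt hN)
  obtain ⟨hzM, hzo⟩ := hz
  rw [mem_ofPred_eq] at hzM
  have hnη : 1 / (n : ℝ) < η := by
    rw [one_div_lt (by linarith [one_div_pos.2 hη]) hη]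
    linarith
  have hcases : η ≤ |z.im| ∨ (z.re : EReal) ≤ lo ∨ hi ≤ (z.re : EReal) := by
    by_contra! hcon
    obtain ⟨k1, k2, k3⟩ := hcon
    have := abs_lt.1 k1
    exact hzo ⟨k2, k3, by linarith, by linarith⟩
  refine mem_S_of hnη (fun k hk => ?_) (fun hK => ?_) (fun hK => ?_) ?_
  · rcases hcases with hc | hc | hc
    · exact hc.trans (abs_im_le_dist hk.1)
    · have hcb : c ≠ ⊥ := by
        rintro rfl
        rcases h.left with ⟨-, h⟩ | ⟨-, h⟩
        · rw [h] at hc; simp at hc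
        · simp at h
      have := hl hcb z.re hc k.re hk.2.1
      have h6 := neg_le_abs (z.re - k.re)
      linarith [abs_re_sub_le_dist z k]
    · have hdt : d ≠ ⊤ := by
        rintro rfl
        rcases h.right with ⟨-, h⟩ | ⟨-, h⟩
        · rw [h] at hc; simp at hc
        · simp at h
      have := hr hdt z.re hc k.re hk.2.2
      have h6 := le_abs_self (z.re - k.re)
      linarith [abs_re_sub_le_dist z k]
  · rcases hcases with hc | hc | hc
    · exact Or.inr (by linarith)
    · left
      have hlb : lo ≠ ⊥ := by rintro rfl; simp at hc
      lift lo to ℝ using ⟨h.lo_ne_top, hlb⟩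
      rw [EReal.coe_le_coe_iff] at hc
      simp only [EReal.toReal_coe] at h4
      linarith
    · exfalso
      have hd : d = ⊤ := top_le_iff.1 hK.2
      rcases h.right with ⟨-, h⟩ | ⟨-, h⟩
      · rw [h] at hc; simp at hc
      · simp [hd] at h
  · rcases hcases with hc | hc | hc
    · exact Or.inr (by linarith)
    · exfalso
      have hd : c = ⊥ := le_bot_iff.1 hK.1
      rcases h.left with ⟨-, h⟩ | ⟨-, h⟩
      · rw [h] at hc; simp at hc
      · simp [hd] at h
    · left
      have hlb : hi ≠ ⊤ := by rintro rfl; simp at hc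
      lift hi to ℝ using ⟨hlb, h.hi_ne_bot⟩
      rw [EReal.coe_le_coe_iff] at hc
      simp only [EReal.toReal_coe] at h5
      linarith
  · linarith [le_abs_self M]

/-- The region between two boxes around `[c, d]` is contained in all but finitely many
`S_n([c, d])`. -/
theorem exists_forall_collar_subset_S {c d lo hi lo' hi' : EReal} {y₀ y₁ y₀' y₁' : ℝ}
    (h : Around c d lo hi y₀ y₁) :
    ∃ N : ℕ, 1 ≤ N ∧ ∀ n ≥ N,
      closedBox lo' hi' y₀' y₁' \ openBox lo hi y₀ y₁ ⊆ S n (Icc c d) := by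
  obtain ⟨N, hN1, hN⟩ := exists_forall_strip_subset_S h (max |y₀'| |y₁'|)
  exact ⟨N, hN1, fun n hn => (sdiff_subset_sdiff_left fun z hz =>
    abs_le_max_abs_abs hz.2.2.1 hz.2.2.2).trans (hN n hn)⟩

section Vector

variable {E : Type*} [AddCommGroup E] [Module ℂ E] [TopologicalSpace E]

/-- Elements of `O^exp` grow more slowly than any exponential on sets contained in almost all
`S_n`. -/
theorem SlowGrowth.exists_le {K : Set EReal} {F : ℂ → E} (hF : SlowGrowth K F) {Z : Set ℂ}
    (hZ : ∃ N : ℕ, 1 ≤ N ∧ ∀ n ≥ N, Z ⊆ S n K) {p : Seminorm ℂ E} (hp : Continuous p) {δ : ℝ}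
    (hδ : 0 < δ) : ∃ C : ℝ, 0 ≤ C ∧ ∀ z ∈ Z, p (F z) ≤ C * Real.exp (δ * |z.re|) := by
  obtain ⟨N, hN1, hN⟩ := hZ
  obtain ⟨M, hM⟩ := exists_nat_gt (1 / δ)
  have hn : 1 ≤ max N M := hN1.trans (le_max_left _ _)
  obtain ⟨C, hC⟩ := hF (max N M) hn p hp
  refine ⟨max C 0, le_max_right _ _, fun z hz => ?_⟩
  have h1 := hC z (hN _ (le_max_left _ _) hz)
  have h2 : 1 / ((max N M : ℕ) : ℝ) ≤ δ := by
    rw [one_div_le (by positivity) hδ]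
    exact hM.le.trans (by exact_mod_cast le_max_right _ _)
  have h3 : p (F z) ≤ C * Real.exp (1 / ((max N M : ℕ) : ℝ) * |z.re|) := by
    rwa [neg_mul, Real.exp_neg, ← div_eq_mul_inv, div_le_iff₀ (Real.exp_pos _)] at h1
  refine h3.trans ?_
  gcongr
  exact le_max_left _ _

/-- The product of an exponentially decreasing scalar kernel and an element of `O^exp` decreases
exponentially in each continuous seminorm. -/
theorem ExpDecayOn.mul_dual {K : Set EReal} {F : ℂ → E} (hF : SlowGrowth K F) {Z : Set ℂ}
    (hZ : ∃ N : ℕ, 1 ≤ N ∧ ∀ n ≥ N, Z ⊆ S n K) {k : ℂ → ℂ} (hk : ExpDecayOn k Z)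
    {p : Seminorm ℂ E} (hp : Continuous p) :
    ∃ C δ : ℝ, 0 < δ ∧ ∀ z ∈ Z, ‖k z‖ * p (F z) ≤ C * Real.exp (-δ * |z.re|) := by
  obtain ⟨C, δ, hδ, hC⟩ := hk
  obtain ⟨D, hD0, hD⟩ := hF.exists_le hZ hp (half_pos hδ)
  refine ⟨C * D, δ / 2, half_pos hδ, fun z hz => ?_⟩
  have h1 := mul_le_mul (hC z hz) (hD z hz) (apply_nonneg p _)
    ((norm_nonneg _).trans (hC z hz))
  refine h1.trans_eq ?_
  have h2 : Real.exp (-(δ / 2) * |z.re|) = Real.exp (-δ * |z.re|) * Real.exp (δ / 2 * |z.re|) := by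
    rw [← Real.exp_add]
    congr 1
    ring
  rw [h2]
  ring

end Vector

/-- The Fourier kernel decays in every box around `[c, d]` when `ζ` is in the Fourier domain. -/
theorem expDecayOn_kernel {c d lo hi : EReal} {y₀ y₁ : ℝ} (hproper : Icc c d ≠ univ)
    (h : Around c d lo hi y₀ y₁) {ζ : ℂ} (hζ : ζ ∈ fourierDomain c d) :
    ExpDecayOn (fun z => Complex.exp (-(I * z * ζ))) (closedBox lo hi y₀ y₁) := by
  have hnorm : ∀ z : ℂ, ‖Complex.exp (-(I * z * ζ))‖ = Real.exp (z.re * ζ.im + z.im * ζ.re) := by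
    intro z
    rw [Complex.norm_exp]
    congr 1
    simp
  have him : ∀ z ∈ closedBox lo hi y₀ y₁, z.im * ζ.re ≤ max |y₀| |y₁| * |ζ.re| := by
    intro z hz
    refine (le_abs_self _).trans ?_
    rw [abs_mul]
    gcongr
    exact abs_le_max_abs_abs hz.2.2.1 hz.2.2.2
  by_cases hd : d = ⊤
  · have hc : c ≠ ⊥ := by
      rintro rfl
      exact hproper (by rw [hd, Icc_bot_top])
    have hlo : lo ≠ ⊥ := by
      rcases h.left with ⟨h1, -⟩ | ⟨h1, -⟩
      · exact absurd h1 hc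
      · exact h1
    lift lo to ℝ using ⟨h.lo_ne_top, hlo⟩
    have hneg := hζ.1 hd
    refine ⟨Real.exp (max |y₀| |y₁| * |ζ.re| + 2 * (-ζ.im) * |lo|), -ζ.im, by linarith,
      fun z hz => ?_⟩
    rw [hnorm, ← Real.exp_add]
    refine Real.exp_le_exp.2 ?_
    have h1 := him z hz
    have h2 : lo ≤ z.re := EReal.coe_le_coe_iff.1 hz.1
    have h3 : |z.re| ≤ z.re + 2 * |lo| := by
      rcases abs_cases z.re with h | h <;> rcases abs_cases lo with h' | h' <;> linarith
    nlinarith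
  by_cases hc : c = ⊥
  · have hhi : hi ≠ ⊤ := by
      rcases h.right with ⟨h1, -⟩ | ⟨h1, -⟩
      · exact absurd h1 hd
      · exact h1
    lift hi to ℝ using ⟨hhi, h.hi_ne_bot⟩
    have hpos := hζ.2 hc
    refine ⟨Real.exp (max |y₀| |y₁| * |ζ.re| + 2 * ζ.im * |hi|), ζ.im, by linarith,
      fun z hz => ?_⟩
    rw [hnorm, ← Real.exp_add]
    refine Real.exp_le_exp.2 ?_
    have h1 := him z hz
    have h2 : z.re ≤ hi := EReal.coe_le_coe_iff.1 hz.2.1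
    have h3 : |z.re| ≤ -z.re + 2 * |hi| := by
      rcases abs_cases z.re with h | h <;> rcases abs_cases hi with h' | h' <;> linarith
    nlinarith
  have hlo : lo ≠ ⊥ := by
    rcases h.left with ⟨h1, -⟩ | ⟨h1, -⟩
    · exact absurd h1 hc
    · exact h1
  have hhi : hi ≠ ⊤ := by
    rcases h.right with ⟨h1, -⟩ | ⟨h1, -⟩
    · exact absurd h1 hd
    · exact h1
  lift lo to ℝ using ⟨h.lo_ne_top, hlo⟩
  lift hi to ℝ using ⟨hhi, h.hi_ne_bot⟩
  exact expDecayOn_of_isCompact (isCompact_closedBox _ _ _ _) (by fun_prop)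

/-! ### Tameness of the contours -/

theorem tame_of_isCompact {A : Arc} (hd : IsCompact A.dom) (hc : ContDiff ℝ 1 A.path)
    (hL : ∃ L : ℝ, ∀ t, ‖deriv A.path t‖ ≤ L) : A.Tame :=
  ⟨hd.isClosed, hc, hL, fun δ _ => by
    have := hc.continuous
    exact (Continuous.continuousOn (by fun_prop)).integrableOn_compact hd⟩

theorem tame_topArc (lo hi : EReal) (y : ℝ) : (topArc lo hi y).Tame := by
  have hd : ∀ t : ℝ, HasDerivAt (fun t : ℝ => (t : ℂ) + y * I) 1 t := fun t =>
    (Complex.ofRealCLM.hasDerivAt).add_const _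
  refine ⟨isClosed_realPart lo hi, ?_, ⟨1, fun t => ?_⟩, fun δ hδ => ?_⟩
  · exact (Complex.ofRealCLM.contDiff).add contDiff_const
  · have : deriv (topArc lo hi y).path t = 1 := (hd t).deriv
    simp [this]
  · simpa [topArc] using (integrable_exp_neg_abs hδ).integrableOn

theorem tame_bottomArc (lo hi : EReal) (y : ℝ) : (bottomArc lo hi y).Tame := by
  have hd : ∀ t : ℝ, HasDerivAt (fun t : ℝ => -(t : ℂ) - y * I) (-1) t := fun t =>
    ((Complex.ofRealCLM.hasDerivAt).neg).sub_const _
  refine ⟨(isClosed_realPart lo hi).preimage continuous_neg, ?_, ⟨1, fun t => ?_⟩,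
    fun δ hδ => ?_⟩
  · exact (Complex.ofRealCLM.contDiff).neg.sub contDiff_const
  · have : deriv (bottomArc lo hi y).path t = -1 := (hd t).deriv
    simp [this]
  · simpa [bottomArc] using (integrable_exp_neg_abs hδ).integrableOn

theorem tame_vertical (x σ y₀ y₁ : ℝ) : Arc.Tame ⟨Icc y₀ y₁, fun t => (x : ℂ) + t * (σ * I)⟩ := by
  have hd : ∀ t : ℝ, HasDerivAt (fun t : ℝ => (x : ℂ) + t * (σ * I)) (1 * (σ * I)) t := fun t =>
    ((Complex.ofRealCLM.hasDerivAt).mul_const (σ * I)).const_add _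
  refine tame_of_isCompact isCompact_Icc ?_ ⟨‖(1 * (σ * I) : ℂ)‖, fun t => ?_⟩
  · exact contDiff_const.add ((Complex.ofRealCLM.contDiff).mul contDiff_const)
  · rw [(hd t).deriv]

theorem tame_up (x y₀ y₁ : ℝ) : Arc.Tame ⟨Icc y₀ y₁, fun t => (x : ℂ) + t * I⟩ := by
  simpa using tame_vertical x 1 y₀ y₁

theorem tame_down (x y₀ y₁ : ℝ) : Arc.Tame ⟨Icc y₀ y₁, fun t => (x : ℂ) - t * I⟩ := by
  simpa [sub_eq_add_neg] using tame_vertical x (-1) y₀ y₁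

theorem tame_circle (x ε s t : ℝ) :
    Arc.Tame ⟨Icc s t, fun t => (x : ℂ) + ε * Complex.exp (-(t * I))⟩ := by
  have hd : ∀ t : ℝ, HasDerivAt (fun t : ℝ => (x : ℂ) + ε * Complex.exp (-(t * I)))
      (ε * (Complex.exp (-(t * I)) * -(1 * I))) t := fun t =>
    (((((Complex.ofRealCLM.hasDerivAt (x := t)).mul_const I).neg).cexp).const_mul
      (ε : ℂ)).const_add _
  refine tame_of_isCompact isCompact_Icc ?_ ⟨|ε|, fun t => ?_⟩
  · exact contDiff_const.add (contDiff_const.mul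
      ((Complex.ofRealCLM.contDiff.mul contDiff_const).neg.cexp))
  · rw [(hd t).deriv, norm_mul, norm_mul, ← neg_mul, ← Complex.ofReal_neg,
      Complex.norm_exp_ofReal_mul_I]
    simp

theorem tame_rectContour (lo hi : EReal) (y₀ y₁ : ℝ) : TameContour (rectContour lo hi y₀ y₁) := by
  intro A hA
  simp only [rectContour, List.mem_append, List.mem_singleton] at hA
  rcases hA with ((hA | rfl) | hA) | rfl
  · split_ifs at hA
    · simp at hA
    · rw [List.mem_singleton.1 hA]; exact tame_up _ _ _
  · exact tame_topArc _ _ _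
  · split_ifs at hA
    · simp at hA
    · rw [List.mem_singleton.1 hA]; exact tame_down _ _ _
  · exact tame_bottomArc _ _ _

theorem tame_contour (c d : EReal) (ε : ℝ) : TameContour (contour c d ε) := by
  intro A hA
  simp only [contour, List.mem_append, List.mem_singleton] at hA
  rcases hA with ((hA | rfl) | hA) | rfl
  · unfold leftEnd at hA
    split_ifs at hA
    · simp at hA
    · rw [List.mem_singleton.1 hA]; exact tame_up _ _ _
    · rw [List.mem_singleton.1 hA]; exact tame_circle _ _ _ _
  · exact tame_topArc _ _ _
  · unfold rightEnd at hA
    split_ifs at hA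
    · simp at hA
    · rw [List.mem_singleton.1 hA]; exact tame_down _ _ _
    · rw [List.mem_singleton.1 hA]; exact tame_circle _ _ _ _
  · exact tame_bottomArc _ _ _

theorem support_rectContour_subset {lo hi : EReal} {y₀ y₁ : ℝ} (hle : lo ≤ hi) (hlo : lo ≠ ⊤)
    (hhi : hi ≠ ⊥) (hy : y₀ ≤ y₁) :
    support (rectContour lo hi y₀ y₁) ⊆ closedBox lo hi y₀ y₁ \ openBox lo hi y₀ y₁ := by
  rintro z ⟨A, hA, t, ht, rfl⟩
  simp only [rectContour, List.mem_append, List.mem_singleton] at hA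
  rcases hA with ((hA | rfl) | hA) | rfl
  · split_ifs at hA with hb
    · simp at hA
    · lift lo to ℝ using ⟨hlo, hb⟩
      rw [List.mem_singleton.1 hA] at ht ⊢
      simpa [closedBox, openBox] using ⟨hle, ht.1, ht.2⟩
  · simpa [closedBox, openBox, topArc] using ⟨ht.1, ht.2, hy⟩
  · split_ifs at hA with hb
    · simp at hA
    · lift hi to ℝ using ⟨hb, hhi⟩
      rw [List.mem_singleton.1 hA] at ht ⊢
      have h1 : y₀ ≤ -t := by linarith [ht.2]
      have h2 : -t ≤ y₁ := by linarith [ht.1]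
      simpa [closedBox, openBox] using ⟨hle, h1, h2⟩
  · have h1 := ht.1
    have h2 := ht.2
    simp only [EReal.coe_neg] at h1 h2
    simpa [closedBox, openBox, bottomArc] using ⟨h1, h2, hy⟩

end Growth

/-! ### Existence and well-definedness of the Fourier transform -/

section Fourier

open Complex (I)

theorem circle_point (x ε t : ℝ) : (x : ℂ) + ε * Complex.exp (-(t * I)) =
    ((x + ε * Real.cos t : ℝ) : ℂ) + (-(ε * Real.sin t) : ℝ) * I := by
  have : Complex.exp (-(t * I)) = (Real.cos t : ℂ) + (-Real.sin t : ℝ) * I := by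
    rw [← neg_mul, Complex.exp_mul_I, Complex.cos_neg, Complex.sin_neg]
    push_cast
    ring
  rw [this]
  push_cast
  ring

theorem re_add_mul_I (x y : ℝ) : ((x : ℂ) + y * I).re = x := by simp

theorem im_add_mul_I (x y : ℝ) : ((x : ℂ) + y * I).im = y := by simp

theorem contour_eq_of_finite {c d : EReal} (hc : c ≠ ⊤) (hd : d ≠ ⊥) (ε : ℝ) :
    contour c d ε = leftEnd c ε ++ [topArc c d ε] ++ rightEnd d ε ++ [bottomArc c d ε] := by
  simp [contour, hc, hd]

theorem leftEnd_coe (c ε : ℝ) : leftEnd (c : EReal) ε = [⟨Icc (Real.pi / 2) (3 * Real.pi / 2),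
    fun t => (c : ℂ) + ε * Complex.exp (-(t * I))⟩] := by simp [leftEnd]

theorem rightEnd_coe (d ε : ℝ) : rightEnd (d : EReal) ε = [⟨Icc (-(Real.pi / 2)) (Real.pi / 2),
    fun t => (d : ℂ) + ε * Complex.exp (-(t * I))⟩] := by simp [rightEnd]

/-- On a circle, a point at height less than half the radius is at horizontal distance at least
half the radius from the centre. -/
theorem half_le_of_abs_sin_lt {s k : ℝ} (h : s ^ 2 + k ^ 2 = 1) (hs : |s| < 1 / 2) (hk : 0 ≤ k) :
    1 / 2 ≤ k := by
  have h1 := abs_lt.1 hs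
  nlinarith

theorem support_contour_subset_of_finite {c d : EReal} (hcd : c ≤ d) (hc : c ≠ ⊤) (hd : d ≠ ⊥)
    {ε : ℝ} (hε : 0 < ε) : support (contour c d ε) ⊆ closedBox (c - ε) (d + ε) (-ε) ε \
      openBox (c - (ε / 2 : ℝ)) (d + (ε / 2 : ℝ)) (-(ε / 2)) (ε / 2) := by
  have hA := around_sub_add hc hd hε hε
  rintro z ⟨A, hA', t, ht, rfl⟩
  rw [contour_eq_of_finite hc hd] at hA'
  simp only [List.mem_append, List.mem_singleton] at hA'
  have hb := Real.sin_sq_add_cos_sq t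
  have hs1 : |ε * Real.sin t| ≤ ε := by
    rw [abs_mul, abs_of_pos hε]
    exact mul_le_of_le_one_right hε.le (Real.abs_sin_le_one t)
  have hhalf : |ε * Real.sin t| < ε / 2 → |Real.sin t| < 1 / 2 := by
    intro h
    rw [abs_mul, abs_of_pos hε] at h
    nlinarith
  rcases hA' with ((hA' | rfl) | hA') | rfl
  · induction c with
    | bot => simp [leftEnd] at hA'
    | top => exact absurd rfl hc
    | coe c =>
      rw [leftEnd_coe, List.mem_singleton] at hA'
      subst hA'
      have hcos : Real.cos t ≤ 0 :=
        Real.cos_nonpos_of_pi_div_two_le_of_le ht.1 (by linarith [ht.2, Real.pi_pos])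
      simp only [circle_point]
      refine ⟨⟨?_, ?_, ?_, ?_⟩, ?_⟩
      · rw [re_add_mul_I, ← EReal.coe_sub, EReal.coe_le_coe_iff]
        nlinarith [Real.neg_one_le_cos t]
      · rw [re_add_mul_I]
        refine le_trans ?_ (hcd.trans hA.le_hi)
        rw [EReal.coe_le_coe_iff]
        nlinarith
      · rw [im_add_mul_I]; linarith [(abs_le.1 hs1).2]
      · rw [im_add_mul_I]; linarith [(abs_le.1 hs1).1]
      · rintro ⟨h1, -, h3, h4⟩
        rw [re_add_mul_I, ← EReal.coe_sub, EReal.coe_lt_coe_iff] at h1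
        rw [im_add_mul_I] at h3 h4
        have h5 := half_le_of_abs_sin_lt (k := -Real.cos t) (by rw [neg_sq]; exact hb)
          (hhalf (abs_lt.2 ⟨by linarith, by linarith⟩)) (by linarith)
        nlinarith
  · have h1 := ht.1
    have h2 := ht.2
    simp only [topArc]
    refine ⟨⟨?_, ?_, ?_, ?_⟩, ?_⟩
    · rw [re_add_mul_I]; exact hA.lo_le.trans h1
    · rw [re_add_mul_I]; exact h2.trans hA.le_hi
    · rw [im_add_mul_I]; linarith
    · rw [im_add_mul_I]
    · rintro ⟨-, -, -, h4⟩
      rw [im_add_mul_I] at h4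
      linarith
  · induction d with
    | top => simp [rightEnd] at hA'
    | bot => exact absurd rfl hd
    | coe d =>
      rw [rightEnd_coe, List.mem_singleton] at hA'
      subst hA'
      have hcos : 0 ≤ Real.cos t := Real.cos_nonneg_of_mem_Icc ht
      simp only [circle_point]
      refine ⟨⟨?_, ?_, ?_, ?_⟩, ?_⟩
      · rw [re_add_mul_I]
        refine (hA.lo_le.trans hcd).trans ?_
        rw [EReal.coe_le_coe_iff]
        nlinarith
      · rw [re_add_mul_I, ← EReal.coe_add, EReal.coe_le_coe_iff]
        nlinarith [Real.cos_le_one t]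
      · rw [im_add_mul_I]; linarith [(abs_le.1 hs1).2]
      · rw [im_add_mul_I]; linarith [(abs_le.1 hs1).1]
      · rintro ⟨-, h1, h3, h4⟩
        rw [re_add_mul_I, ← EReal.coe_add, EReal.coe_lt_coe_iff] at h1
        rw [im_add_mul_I] at h3 h4
        have h5 := half_le_of_abs_sin_lt hb
          (hhalf (abs_lt.2 ⟨by linarith, by linarith⟩)) hcos
        nlinarith
  · have h1 := ht.1
    have h2 := ht.2
    have e : (bottomArc c d ε).path t = ((-t : ℝ) : ℂ) + (-ε : ℝ) * I := by
      simp only [bottomArc]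
      push_cast
      ring
    rw [e]
    refine ⟨⟨?_, ?_, ?_, ?_⟩, ?_⟩
    · rw [re_add_mul_I]; exact hA.lo_le.trans h1
    · rw [re_add_mul_I]; exact h2.trans hA.le_hi
    · rw [im_add_mul_I]
    · rw [im_add_mul_I]; linarith
    · rintro ⟨-, -, h4, -⟩
      rw [im_add_mul_I] at h4
      linarith

/-- Every contour around `[c, d]` lies between two boxes around `[c, d]`. -/
theorem exists_support_contour_subset {c d : EReal} (hcd : c ≤ d) {ε : ℝ} (hε : 0 < ε) :
    ∃ (lo hi lo' hi' : EReal) (y₀ y₁ y₀' y₁' : ℝ), Around c d lo hi y₀ y₁ ∧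
      Around c d lo' hi' y₀' y₁' ∧
      support (contour c d ε) ⊆ closedBox lo' hi' y₀' y₁' \ openBox lo hi y₀ y₁ := by
  by_cases hc : c = ⊤
  · have hd' : d = ⊤ := top_le_iff.1 (hc ▸ hcd)
    subst hc hd'
    have e : contour ⊤ ⊤ ε = rectContour ((1 / ε : ℝ) : EReal) ⊤ (-ε) ε := by
      simp [contour, rectContour, leftEnd, rightEnd, -one_div]
    have h' : Around ⊤ ⊤ ((1 / ε : ℝ) : EReal) ⊤ (-ε) ε :=
      ⟨Or.inr ⟨EReal.coe_ne_bot _, EReal.coe_lt_top _⟩, Or.inl ⟨rfl, rfl⟩, by linarith, hε⟩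
    refine ⟨_, _, _, _, _, _, _, _, h', h', ?_⟩
    rw [e]
    exact support_rectContour_subset le_top (EReal.coe_ne_top _) (by simp) (by linarith)
  by_cases hb : d = ⊥
  · have hc' : c = ⊥ := le_bot_iff.1 (hb ▸ hcd)
    subst hb hc'
    have e : contour ⊥ ⊥ ε = rectContour ⊥ ((-(1 / ε) : ℝ) : EReal) (-ε) ε := by
      simp [contour, rectContour, leftEnd, rightEnd, -one_div]
    have h' : Around ⊥ ⊥ ⊥ ((-(1 / ε) : ℝ) : EReal) (-ε) ε :=
      ⟨Or.inl ⟨rfl, rfl⟩, Or.inr ⟨EReal.coe_ne_top _, EReal.bot_lt_coe _⟩, by linarith, hε⟩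
    refine ⟨_, _, _, _, _, _, _, _, h', h', ?_⟩
    rw [e]
    exact support_rectContour_subset bot_le (by simp) (EReal.coe_ne_bot _) (by linarith)
  exact ⟨_, _, _, _, _, _, _, _, around_sub_add hc hb (half_pos hε) (half_pos hε),
    around_sub_add hc hb hε hε, support_contour_subset_of_finite hcd hc hb hε⟩

theorem exists_around {c d : EReal} (hcd : c ≤ d) :
    ∃ (lo hi : EReal) (y₀ y₁ : ℝ), Around c d lo hi y₀ y₁ := by
  obtain ⟨lo, hi, -, -, y₀, y₁, -, -, h, -⟩ := exists_support_contour_subset hcd one_pos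
  exact ⟨lo, hi, y₀, y₁, h⟩

theorem Around.support_subset {c d lo hi : EReal} {y₀ y₁ : ℝ} (hcd : c ≤ d)
    (h : Around c d lo hi y₀ y₁) :
    support (rectContour lo hi y₀ y₁) ⊆ closedBox lo hi y₀ y₁ \ openBox lo hi y₀ y₁ :=
  support_rectContour_subset (h.lo_le.trans (hcd.trans h.le_hi)) h.lo_ne_top h.hi_ne_bot
    (h.neg.trans h.pos).le

theorem Around.cint_eq {c d lo hi : EReal} {y₀ y₁ : ℝ} (h : Around c d lo hi y₀ y₁) (f : ℂ → ℂ) :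
    cint (rectContour lo hi y₀ y₁) f = rectInt f lo hi y₀ y₁ :=
  cint_rectContour f (h.neg.trans h.pos).le h.lo_ne_top h.hi_ne_bot

section Vector

variable {E : Type*} [AddCommGroup E] [Module ℂ E] [TopologicalSpace E] [IsTopologicalAddGroup E]
  [ContinuousSMul ℂ E]

theorem differentiableAt_fourier {c d : EReal} (F : Oexp E (Icc c d)) (e : E →L[ℂ] ℂ) (ζ : ℂ)
    {z : ℂ} (hz : z ∉ finitePart (Icc c d)) :
    DifferentiableAt ℂ (fun z => Complex.exp (-(I * z * ζ)) * e ((F : ℂ → E) z)) z :=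
  (by fun_prop : DifferentiableAt ℂ (fun z => Complex.exp (-(I * z * ζ))) z).mul
    (F.2.1.differentiableAt_dual e hz)

theorem decaysAround_fourier {c d : EReal} (hproper : Icc c d ≠ univ) (F : Oexp E (Icc c d))
    (e : E →L[ℂ] ℂ) {ζ : ℂ} (hζ : ζ ∈ fourierDomain c d) :
    DecaysAround c d (fun z => Complex.exp (-(I * z * ζ)) * e ((F : ℂ → E) z)) := by
  intro lo hi lo' hi' y₀ y₁ y₀' y₁' h h'
  obtain ⟨p, hp, hpe⟩ := seminorm_dual_continuous e
  obtain ⟨C, δ, hδ, hC⟩ := ExpDecayOn.mul_dual F.2.2 (exists_forall_collar_subset_S h)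
    ((expDecayOn_kernel hproper h' hζ).mono sdiff_subset) hp
  refine ⟨C, δ, hδ, fun z hz => ?_⟩
  rw [norm_mul, ← hpe]
  exact hC z hz

theorem integrableOn_fourier {c d : EReal} (hproper : Icc c d ≠ univ) (F : Oexp E (Icc c d))
    (e : E →L[ℂ] ℂ) {ζ : ℂ} (hζ : ζ ∈ fourierDomain c d) {γ : List Arc} (hγ : TameContour γ)
    {lo hi lo' hi' : EReal} {y₀ y₁ y₀' y₁' : ℝ} (h : Around c d lo hi y₀ y₁)
    (h' : Around c d lo' hi' y₀' y₁')
    (hs : support γ ⊆ closedBox lo' hi' y₀' y₁' \ openBox lo hi y₀ y₁) :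
    ∀ A ∈ γ, IntegrableOn (fun t => deriv A.path t *
      (fun z => Complex.exp (-(I * z * ζ)) * e ((F : ℂ → E) z)) (A.path t)) A.dom :=
  integrableOn_of_expDecayOn hγ (fun _ hz => (differentiableAt_fourier F e ζ fun hz' =>
    (hs hz).2 (h.finitePart_subset hz')).continuousAt.continuousWithinAt)
    ((decaysAround_fourier hproper F e hζ h h').mono hs)

/-- The Fourier integral may be computed along the boundary of any box around `[c, d]`. -/
theorem hasContourIntegral_fourier_iff {c d : EReal} (hcd : c ≤ d) (hproper : Icc c d ≠ univ)
    (F : Oexp E (Icc c d)) {ζ : ℂ} (hζ : ζ ∈ fourierDomain c d) {ε : ℝ} (hε : 0 < ε)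
    {lo hi : EReal} {y₀ y₁ : ℝ} (h : Around c d lo hi y₀ y₁) {v : E} :
    HasContourIntegral (contour c d ε) (fun z => Complex.exp (-(I * z * ζ)) • (F : ℂ → E) z) v ↔
      ∀ e : E →L[ℂ] ℂ, cint (rectContour lo hi y₀ y₁)
        (fun z => Complex.exp (-(I * z * ζ)) * e ((F : ℂ → E) z)) = e v := by
  have hval : ∀ e : E →L[ℂ] ℂ, cint (contour c d ε)
      (fun z => Complex.exp (-(I * z * ζ)) * e ((F : ℂ → E) z)) =
      cint (rectContour lo hi y₀ y₁)
        (fun z => Complex.exp (-(I * z * ζ)) * e ((F : ℂ → E) z)) := by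
    intro e
    rw [h.cint_eq]
    exact cint_contour_eq_rectInt hcd (fun z hz => differentiableAt_fourier F e ζ hz)
      (decaysAround_fourier hproper F e hζ) hε h
  simp only [HasContourIntegral, map_smul, smul_eq_mul]
  constructor
  · intro hv e
    rw [← hval]
    exact (hv e).2
  · intro hv e
    obtain ⟨lo₁, hi₁, lo₂, hi₂, s₀, s₁, s₂, s₃, h₁, h₂, hs⟩ := exists_support_contour_subset hcd hε
    refine ⟨integrableOn_fourier hproper F e hζ (tame_contour c d ε) h₁ h₂ hs, ?_⟩
    exact (hval e).trans (hv e)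

theorem S_empty (n : ℕ) : S n ∅ = {z | |z.im| < (n : ℝ)} := by
  have : U n ∅ = ∅ := by simp [U, finitePart]
  rw [S, this]
  simp

/-- Two representatives of a class have the same Fourier integrals. -/
theorem cint_fourier_eq_of_mk_eq {c d : EReal} (hcd : c ≤ d) (hproper : Icc c d ≠ univ)
    {F G : Oexp E (Icc c d)} (hFG : BV.mk F = BV.mk G) {ζ : ℂ} (hζ : ζ ∈ fourierDomain c d)
    {lo hi : EReal} {y₀ y₁ : ℝ} (h : Around c d lo hi y₀ y₁) (e : E →L[ℂ] ℂ) :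
    cint (rectContour lo hi y₀ y₁) (fun z => Complex.exp (-(I * z * ζ)) * e ((F : ℂ → E) z)) =
      cint (rectContour lo hi y₀ y₁)
        (fun z => Complex.exp (-(I * z * ζ)) * e ((G : ℂ → E) z)) := by
  have hmem : F - G ∈ entirePart E (Icc c d) := by
    rwa [BV.mk, BV.mk, Submodule.mkQ_apply, Submodule.mkQ_apply, Submodule.Quotient.eq] at hFG
  obtain ⟨H, ⟨hH1, hH2⟩, hH⟩ := hmem
  have hs := h.support_subset hcd
  have hT := tame_rectContour lo hi y₀ y₁
  rw [← sub_eq_zero, ← cint_sub (integrableOn_fourier hproper F e hζ hT h h hs)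
    (integrableOn_fourier hproper G e hζ hT h h hs)]
  have h1 : cint (rectContour lo hi y₀ y₁) (fun z => Complex.exp (-(I * z * ζ)) *
      e ((F : ℂ → E) z) - Complex.exp (-(I * z * ζ)) * e ((G : ℂ → E) z)) =
      cint (rectContour lo hi y₀ y₁) (fun z => Complex.exp (-(I * z * ζ)) * e (H z)) := by
    refine cint_congr hT fun z hz => ?_
    have h2 := hH z fun hz' => (hs hz).2 (h.finitePart_subset hz')
    rw [← h2, ← mul_sub, ← map_sub]
    rfl
  have huniv : ∀ z : ℂ, z ∈ (finitePart ∅)ᶜ := fun z => by simp [finitePart]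
  rw [h1, h.cint_eq]
  obtain ⟨p, hp, hpe⟩ := seminorm_dual_continuous e
  refine rectInt_eq_zero (h.lo_le.trans (hcd.trans h.le_hi)) h.lo_ne_top h.hi_ne_bot
    (h.neg.trans h.pos).le (fun z _ => ?_) ?_
  · exact (by fun_prop : DifferentiableAt ℂ (fun z => Complex.exp (-(I * z * ζ))) z).mul
      (hH1.differentiableAt_dual e (huniv z))
  · obtain ⟨C, δ, hδ, hC⟩ := ExpDecayOn.mul_dual (Z := closedBox lo hi y₀ y₁) hH2 (by
      obtain ⟨N, hN⟩ := exists_nat_gt (max |y₀| |y₁|)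
      refine ⟨N + 1, by omega, fun n hn z hz => ?_⟩
      rw [S_empty]
      have hn' : (N : ℝ) + 1 ≤ n := by exact_mod_cast hn
      have := abs_le_max_abs_abs hz.2.2.1 hz.2.2.2
      exact lt_of_le_of_lt this (by linarith)) (expDecayOn_kernel hproper h hζ) hp
    refine ⟨C, δ, hδ, fun z hz => ?_⟩
    rw [norm_mul, ← hpe]
    exact hC z hz

/-- The Fourier transform of `[F]` may be computed from the single representative `F` and over the
boundary of a single box around `[c, d]`. -/
theorem isFourierTransform_iff {c d : EReal} (hcd : c ≤ d) (hproper : Icc c d ≠ univ)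
    (F : Oexp E (Icc c d)) (φ : ℂ → E) {lo hi : EReal} {y₀ y₁ : ℝ}
    (h : Around c d lo hi y₀ y₁) : IsFourierTransform (BV.mk F) φ ↔
      ∀ ζ ∈ fourierDomain c d, ∀ e : E →L[ℂ] ℂ, cint (rectContour lo hi y₀ y₁)
        (fun z => Complex.exp (-(I * z * ζ)) * e ((F : ℂ → E) z)) = e (φ ζ) := by
  constructor
  · intro hφ ζ hζ
    exact (hasContourIntegral_fourier_iff hcd hproper F hζ one_pos h).1 (hφ F rfl 1 one_pos ζ hζ)
  · intro hφ G hG ε hε ζ hζ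
    refine (hasContourIntegral_fourier_iff hcd hproper G hζ hε h).2 fun e => ?_
    rw [cint_fourier_eq_of_mk_eq hcd hproper hG hζ h e]
    exact hφ ζ hζ e

theorem BV.exists_rep {K : Set EReal} (f : BV E K) : ∃ F : Oexp E K, BV.mk F = f :=
  Submodule.mkQ_surjective _ f

end Vector

theorem exists_isFourierTransform {E : Type*} [AddCommGroup E] [Module ℂ E] [UniformSpace E]
    [IsUniformAddGroup E] [ContinuousSMul ℂ E] [PolynormableSpace ℂ E]
    (hE : IsSequentiallyComplete E) {c d : EReal} (hcd : c ≤ d) (hproper : Icc c d ≠ univ)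
    (f : BV E (Icc c d)) : ∃ φ, IsFourierTransform f φ := by
  obtain ⟨F, rfl⟩ := BV.exists_rep f
  obtain ⟨lo, hi, y₀, y₁, h⟩ := exists_around hcd
  have hs := h.support_subset hcd
  have key : ∀ ζ ∈ fourierDomain c d, ∃ v : E, HasContourIntegral (rectContour lo hi y₀ y₁)
      (fun z => Complex.exp (-(I * z * ζ)) • (F : ℂ → E) z) v := by
    intro ζ hζ
    refine exists_hasContourIntegral hE (tame_rectContour _ _ _ _) (fun z hz => ?_) fun p hp => ?_
    · have h1 := F.2.1.continuousAt (z := z) fun hz' => (hs hz).2 (h.finitePart_subset hz')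
      exact ((by fun_prop : ContinuousAt (fun z => Complex.exp (-(I * z * ζ))) z).smul
        h1).continuousWithinAt
    · obtain ⟨C, δ, hδ, hC⟩ := ExpDecayOn.mul_dual F.2.2 (exists_forall_collar_subset_S h)
        ((expDecayOn_kernel hproper h hζ).mono sdiff_subset) hp
      refine ⟨C, δ, hδ, fun z hz => ?_⟩
      rw [map_smul_eq_mul]
      exact hC z (hs hz)
  choose! φ hφ using key
  refine ⟨φ, (isFourierTransform_iff hcd hproper F φ h).2 fun ζ hζ e => ?_⟩
  simpa using (hφ ζ hζ).cint_eq e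

end Fourier

/-! ### The contour convolution -/

section Bilinear

/-- Continuity of a bilinear map in terms of continuous seminorms. -/
def SeminormBounded {E E₁ E₂ : Type*} [AddCommGroup E] [Module ℂ E] [TopologicalSpace E]
    [AddCommGroup E₁] [Module ℂ E₁] [TopologicalSpace E₁]
    [AddCommGroup E₂] [Module ℂ E₂] [TopologicalSpace E₂] (B : E₁ →ₗ[ℂ] E₂ →ₗ[ℂ] E) : Prop :=
  ∀ p : Seminorm ℂ E, Continuous p →
    ∃ (q : Seminorm ℂ E₁) (r : Seminorm ℂ E₂) (D : ℝ), Continuous q ∧ Continuous r ∧ 0 < D ∧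
      ∀ x y, p (B x y) ≤ D * q x * r y

variable {E E₁ E₂ : Type*} [AddCommGroup E] [Module ℂ E] [UniformSpace E]
  [IsUniformAddGroup E] [PolynormableSpace ℂ E]
  [AddCommGroup E₁] [Module ℂ E₁] [TopologicalSpace E₁] [IsTopologicalAddGroup E₁]
  [AddCommGroup E₂] [Module ℂ E₂] [TopologicalSpace E₂] [IsTopologicalAddGroup E₂]
  {B : E₁ →ₗ[ℂ] E₂ →ₗ[ℂ] E}

theorem SeminormBounded.continuous (hB : SeminormBounded B) :
    Continuous fun x : E₁ × E₂ => B x.1 x.2 := by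
  refine continuous_iff_continuousAt.2 fun x => ?_
  refine tendsto_iff_seminorm.2 fun p hp => ?_
  obtain ⟨q, r, D, hq, hr, hD, h⟩ := hB p hp
  have hlim : Tendsto (fun y : E₁ × E₂ => D * q (y.1 - x.1) * r y.2 + D * q x.1 * r (y.2 - x.2))
      (𝓝 x) (𝓝 0) := by
    have : Continuous fun y : E₁ × E₂ =>
        D * q (y.1 - x.1) * r y.2 + D * q x.1 * r (y.2 - x.2) := by fun_prop
    simpa using this.tendsto x
  refine squeeze_zero (fun _ => apply_nonneg _ _) (fun y => ?_) hlim
  have e : B y.1 y.2 - B x.1 x.2 = B (y.1 - x.1) y.2 + B x.1 (y.2 - x.2) := by simp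
  rw [e]
  exact (map_add_le_add p _ _).trans (add_le_add (h _ _) (h _ _))

/-- The functional `y ↦ e (B x y)`. -/
def SeminormBounded.left (hB : SeminormBounded B) (e : E →L[ℂ] ℂ) (x : E₁) : E₂ →L[ℂ] ℂ :=
  ⟨(e : E →ₗ[ℂ] ℂ) ∘ₗ B x, e.continuous.comp (hB.continuous.comp (by fun_prop :
    Continuous fun y : E₂ => (x, y)))⟩

/-- The functional `x ↦ e (B x y)`. -/
def SeminormBounded.right (hB : SeminormBounded B) (e : E →L[ℂ] ℂ) (y : E₂) : E₁ →L[ℂ] ℂ :=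
  ⟨(e : E →ₗ[ℂ] ℂ) ∘ₗ B.flip y, e.continuous.comp (hB.continuous.comp (by fun_prop :
    Continuous fun x : E₁ => (x, y)))⟩

theorem SeminormBounded.left_apply (hB : SeminormBounded B) (e : E →L[ℂ] ℂ) (x : E₁) (y : E₂) :
    hB.left e x y = e (B x y) := rfl

theorem SeminormBounded.right_apply (hB : SeminormBounded B) (e : E →L[ℂ] ℂ) (x : E₁) (y : E₂) :
    hB.right e y x = e (B x y) := rfl

theorem HolomorphicOn.comp_const_sub {E : Type*} [AddCommGroup E] [Module ℂ E]
    [TopologicalSpace E] [IsTopologicalAddGroup E] {G : ℂ → E} {Ω : Set ℂ}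
    (hG : HolomorphicOn G Ω) (z : ℂ) :
    HolomorphicOn (fun w => G (z - w)) {w | z - w ∈ Ω} := by
  intro w hw
  obtain ⟨g', hg'⟩ := hG _ hw
  have ht : Tendsto (fun v : ℂ => z - v) (𝓝[≠] w) (𝓝[≠] (z - w)) := by
    refine tendsto_nhdsWithin_iff.2 ⟨?_, ?_⟩
    · exact ((by fun_prop : Continuous fun v : ℂ => z - v).tendsto w).mono_left nhdsWithin_le_nhds
    · filter_upwards [self_mem_nhdsWithin] with v hv
      simpa [sub_right_inj] using hv
  refine ⟨-g', ((hg'.comp ht).neg).congr fun v => ?_⟩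
  simp only [Function.comp, slope, vsub_eq_sub]
  rw [show z - v - (z - w) = -(v - w) by ring, inv_neg, neg_smul, neg_neg]

/-- The product rule for a continuous bilinear map. -/
theorem SeminormBounded.differentiableAt [ContinuousSMul ℂ E₂] (hB : SeminormBounded B)
    (e : E →L[ℂ] ℂ) {f : ℂ → E₁} {g : ℂ → E₂} {Ω Ω' : Set ℂ} (hf : HolomorphicOn f Ω)
    (hg : HolomorphicOn g Ω') {z : ℂ}
    (hz : z ∈ Ω) (hz' : z ∈ Ω') : DifferentiableAt ℂ (fun w => e (B (f w) (g w))) z := by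
  obtain ⟨f', hf'⟩ := hf z hz
  obtain ⟨g', hg'⟩ := hg z hz'
  have hgc : Tendsto g (𝓝[≠] z) (𝓝 (g z)) := (hg.continuousAt hz').mono_left nhdsWithin_le_nhds
  have h1 : Tendsto (fun w => e (B (slope f z w) (g w))) (𝓝[≠] z) (𝓝 (e (B f' (g z)))) :=
    (e.continuous.tendsto _).comp ((hB.continuous.tendsto (f', g z)).comp (hf'.prodMk_nhds hgc))
  have h2 : Tendsto (fun w => e (B (f z) (slope g z w))) (𝓝[≠] z) (𝓝 (e (B (f z) g'))) :=
    (e.continuous.tendsto _).comp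
      ((hB.continuous.tendsto (f z, g')).comp (tendsto_const_nhds.prodMk_nhds hg'))
  refine (hasDerivAt_iff_tendsto_slope.2 ((h1.add h2).congr fun w => ?_)).differentiableAt
  simp only [slope, vsub_eq_sub, map_smul, LinearMap.smul_apply, map_sub, LinearMap.sub_apply,
    smul_eq_mul]
  ring

end Bilinear

section Geometry

variable {a b : ℝ} {c d : EReal}

/-- The Minkowski sum `[a, b] + [c, d]` lies in `[a + c, b + d]`. -/
theorem add_mem_finitePart {k m : ℂ} (hk : k ∈ finitePart (Icc (a : EReal) b))
    (hm : m ∈ finitePart (Icc c d)) : k + m ∈ finitePart (Icc (a + c) (b + d)) := by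
  refine ⟨by simp [hk.1, hm.1], ?_⟩
  rw [Complex.add_re, EReal.coe_add]
  exact ⟨add_le_add hk.2.1 hm.2.1, add_le_add hk.2.2 hm.2.2⟩

theorem le_dist_sub_of_dist_le {z w k : ℂ} {η ρ : ℝ}
    (hz : ∀ k ∈ finitePart (Icc (a + c) (b + d)), η ≤ dist z k)
    (hk : k ∈ finitePart (Icc (a : EReal) b)) (hw : dist w k ≤ ρ) {m : ℂ}
    (hm : m ∈ finitePart (Icc c d)) : η - ρ ≤ dist (z - w) m := by
  have h1 := hz _ (add_mem_finitePart hk hm)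
  have h2 : dist z (k + m) ≤ dist (z - w) m + dist w k := by
    rw [dist_eq_norm, dist_eq_norm, dist_eq_norm]
    calc ‖z - (k + m)‖ = ‖(z - w - m) + (w - k)‖ := by congr 1; ring
      _ ≤ _ := norm_add_le _ _
  linarith

theorem sub_not_mem_finitePart {z w : ℂ} {η : ℝ}
    (hz : ∀ k ∈ finitePart (Icc (a + c) (b + d)), η ≤ dist z k)
    (hw : w ∈ Metric.thickening η (finitePart (Icc (a : EReal) b))) :
    z - w ∉ finitePart (Icc c d) := by
  intro hm
  obtain ⟨k, hk, hwk⟩ := Metric.mem_thickening_iff.1 hw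
  have := le_dist_sub_of_dist_le hz hk (le_refl (dist w k)) hm
  rw [dist_self] at this
  linarith

theorem exists_dist_le_of_mem_closedBox (hab : a ≤ b) {r : ℝ} (hr : 0 ≤ r) {w : ℂ}
    (hw : w ∈ closedBox (a - r : ℝ) (b + r : ℝ) (-r) r) :
    ∃ k ∈ finitePart (Icc (a : EReal) b), dist w k ≤ 3 / 2 * r := by
  obtain ⟨h1, h2, h3, h4⟩ := hw
  rw [EReal.coe_le_coe_iff] at h1 h2
  refine ⟨((max a (min b w.re) : ℝ) : ℂ), coe_mem_finitePart ?_ ?_, ?_⟩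
  · exact EReal.coe_le_coe_iff.2 (le_max_left _ _)
  · exact EReal.coe_le_coe_iff.2 (max_le hab (min_le_left _ _))
  · have hre : |w.re - max a (min b w.re)| ≤ r := by
      rw [abs_le]
      rcases max_cases a (min b w.re) with ⟨h, h'⟩ | ⟨h, h'⟩ <;>
        rcases min_cases b w.re with ⟨h5, h6⟩ | ⟨h5, h6⟩ <;> rw [h] <;>
        constructor <;> linarith
    have him : |w.im| ≤ r := abs_le.2 ⟨h3, h4⟩
    rw [dist_eq_norm, Complex.norm_eq_sqrt_sq_add_sq, Real.sqrt_le_left (by positivity)]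
    simp only [Complex.sub_re, Complex.ofReal_re, Complex.sub_im, Complex.ofReal_im, sub_zero]
    have h5 := sq_le_sq' (by linarith [(abs_le.1 hre).1]) (abs_le.1 hre).2
    have h6 := sq_le_sq' (by linarith [(abs_le.1 him).1]) (abs_le.1 him).2
    nlinarith [sq_nonneg r]

theorem support_contour_coe_subset (hab : a ≤ b) {r : ℝ} (hr : 0 < r) :
    support (contour a b r) ⊆ closedBox (a - r : ℝ) (b + r : ℝ) (-r) r \
      openBox (a - r / 2 : ℝ) (b + r / 2 : ℝ) (-(r / 2)) (r / 2) := by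
  simpa only [EReal.coe_sub, EReal.coe_add] using support_contour_subset_of_finite
    (EReal.coe_le_coe_iff.2 hab) (EReal.coe_ne_top a) (EReal.coe_ne_bot b) hr

theorem not_mem_finitePart_of_mem_support (hab : a ≤ b) {r : ℝ} (hr : 0 < r) {w : ℂ}
    (hw : w ∈ support (contour a b r)) : w ∉ finitePart (Icc (a : EReal) b) := fun h =>
  (support_contour_coe_subset hab hr hw).2
    ((around_coe (by linarith) (by linarith) (by linarith) (by linarith)).finitePart_subset h)

theorem abs_le_of_mem_closedBox {r : ℝ} (hr1 : r ≤ 1) {w : ℂ}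
    (hw : w ∈ closedBox (a - r : ℝ) (b + r : ℝ) (-r) r) :
    |w.re| ≤ |a| + |b| + 1 ∧ |w.im| ≤ r := by
  obtain ⟨h1, h2, h3, h4⟩ := hw
  rw [EReal.coe_le_coe_iff] at h1 h2
  refine ⟨abs_le.2 ⟨?_, ?_⟩, abs_le.2 ⟨h3, h4⟩⟩
  · linarith [neg_abs_le a, abs_nonneg b]
  · linarith [le_abs_self b, abs_nonneg a]

/-- If `z` stays in `S_n([a + c, b + d])` and `w` on the contour of width `1 / (2n)` around
`[a, b]`, then `z - w` stays in a fixed `S_m([c, d])`. -/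
theorem exists_forall_sub_mem_S (hab : a ≤ b) {n : ℕ} (hn : 1 ≤ n) :
    ∃ m : ℕ, n ≤ m ∧ ∀ z ∈ S n (Icc (a + c) (b + d)), ∀ w ∈ support (contour a b (1 / (2 * n : ℝ))),
      z - w ∈ S m (Icc c d) := by
  have hn0 : (1 : ℝ) ≤ n := by exact_mod_cast hn
  obtain ⟨m, hm⟩ := exists_nat_gt (4 * n + |a| + |b| + 2 : ℝ)
  have ha := abs_nonneg a
  have hb := abs_nonneg b
  refine ⟨m, by exact_mod_cast (by linarith : (n : ℝ) ≤ m), fun z hz w hw => ?_⟩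
  have hr : (0 : ℝ) < 1 / (2 * n) := by positivity
  have hbox := (support_contour_coe_subset hab hr hw).1
  obtain ⟨k, hk, hwk⟩ := exists_dist_le_of_mem_closedBox hab hr.le hbox
  obtain ⟨hwre, hwim⟩ := abs_le_of_mem_closedBox (by
    rw [div_le_one (by positivity)]; linarith) hbox
  have e1 : (1 : ℝ) / n - 3 / 2 * (1 / (2 * n)) = 1 / (4 * n) := by field_simp; norm_num
  have e2 : (1 : ℝ) / n - 1 / (2 * n) = 1 / (2 * n) := by field_simp; norm_num
  have hm4 : 1 / (m : ℝ) < 1 / (4 * n) := one_div_lt_one_div_of_lt (by positivity) (by linarith)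
  have hm2 : 1 / (m : ℝ) < 1 / (2 * n) := one_div_lt_one_div_of_lt (by positivity) (by linarith)
  have hle1 : (1 : ℝ) / (2 * n) ≤ 1 := by
    rw [div_le_one (by positivity)]; linarith
  have him : |z.im| - 1 / (2 * n) ≤ |(z - w).im| := by
    rw [Complex.sub_im]
    linarith [abs_sub_abs_le_abs_sub z.im w.im]
  have h1 := abs_le.1 hwre
  refine mem_S_of hm4 (fun k' hk' => ?_) (fun hK => ?_) (fun hK => ?_) ?_
  · rw [← e1]
    exact le_dist_sub_of_dist_le (fun k hk => le_dist_of_mem_S hz hk) hk hwk hk'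
  · have hd : d = ⊤ := top_le_iff.1 hK.2
    rcases strip_of_mem_S_top hz ⟨le_top, by rw [hd, EReal.coe_add_top]⟩ with h | h
    · left
      rw [Complex.sub_re]
      linarith
    · right
      linarith
  · have hc : c = ⊥ := le_bot_iff.1 hK.1
    rcases strip_of_mem_S_bot hz ⟨by rw [hc, EReal.add_bot], bot_le⟩ with h | h
    · left
      rw [Complex.sub_re]
      linarith
    · right
      linarith
  · rw [Complex.sub_im]
    have := hz.2
    rw [mem_ofPred_eq] at this
    linarith [abs_sub z.im w.im]

end Geometry

/-- Uniform bounds for the integrand of the contour convolution on `S_n([a + c, b + d])`. The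
factor `e^{-|Re w|}` is harmless, the contour being bounded. -/
theorem exists_convolution_bound {E E₁ E₂ : Type*} [AddCommGroup E] [Module ℂ E]
    [TopologicalSpace E] [AddCommGroup E₁] [Module ℂ E₁] [TopologicalSpace E₁]
    [IsTopologicalAddGroup E₁] [ContinuousSMul ℂ E₁] [AddCommGroup E₂] [Module ℂ E₂]
    [TopologicalSpace E₂] [IsTopologicalAddGroup E₂] [ContinuousSMul ℂ E₂]
    {B : E₁ →ₗ[ℂ] E₂ →ₗ[ℂ] E} {a b : ℝ} {c d : EReal} (hab : a ≤ b) (hB : SeminormBounded B)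
    (F : Oexp E₁ (Icc (a : EReal) b)) (G : Oexp E₂ (Icc c d)) {n : ℕ} (hn : 1 ≤ n)
    {p : Seminorm ℂ E} (hp : Continuous p) :
    ∃ C : ℝ, 0 ≤ C ∧ ∀ z ∈ S n (Icc (a + c) (b + d)),
      ∀ w ∈ support (contour a b (1 / (2 * n : ℝ))),
        p (B ((F : ℂ → E₁) w) ((G : ℂ → E₂) (z - w))) ≤
          C * Real.exp (1 / (n : ℝ) * |z.re|) * Real.exp (-1 * |w.re|) := by
  have hn0 : (1 : ℝ) ≤ n := by exact_mod_cast hn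
  have hr : (0 : ℝ) < 1 / (2 * n) := by positivity
  have hr1 : (1 : ℝ) / (2 * n) ≤ 1 := by
    rw [div_le_one (by positivity)]; linarith
  obtain ⟨q, r, D, hq, hr', hD, hbd⟩ := hB p hp
  obtain ⟨C₁, hC₁0, hC₁⟩ := F.2.2.exists_le (exists_forall_collar_subset_S
    (around_coe (a := a) (b := b) (by linarith : a - 1 / (2 * (n : ℝ)) / 2 < a)
      (by linarith : b < b + 1 / (2 * (n : ℝ)) / 2)
      (by linarith : -(1 / (2 * (n : ℝ)) / 2) < 0) (half_pos hr)))
    hq one_pos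
  obtain ⟨m, hnm, hm⟩ := exists_forall_sub_mem_S (c := c) (d := d) hab hn
  obtain ⟨C₂, hC₂⟩ := G.2.2 m (hn.trans hnm) r hr'
  have hmn : 1 / (m : ℝ) ≤ 1 / n := one_div_le_one_div_of_le (by linarith) (by exact_mod_cast hnm)
  have hm0 : 0 ≤ 1 / (m : ℝ) := by positivity
  have hn1 : 1 / (n : ℝ) ≤ 1 := by rw [div_le_one (by linarith)]; exact hn0
  obtain ⟨R, hR⟩ : ∃ R, R = |a| + |b| + 1 := ⟨_, rfl⟩
  refine ⟨D * C₁ * (max C₂ 0) * Real.exp (3 * R), by positivity, fun z hz w hw => ?_⟩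
  have hcol := support_contour_coe_subset hab hr hw
  have hwre := (abs_le_of_mem_closedBox hr1 hcol.1).1
  rw [← hR] at hwre
  have hR0 : 0 ≤ R := (abs_nonneg _).trans hwre
  have h1 := hC₁ w hcol
  have h2 := hC₂ _ (hm z hz w hw)
  have h3 : r ((G : ℂ → E₂) (z - w)) ≤ max C₂ 0 * Real.exp (1 / (m : ℝ) * |(z - w).re|) := by
    rw [neg_mul, Real.exp_neg, ← div_eq_mul_inv, div_le_iff₀ (Real.exp_pos _)] at h2
    refine h2.trans ?_
    gcongr
    exact le_max_left _ _
  have h4 : 1 / (m : ℝ) * |(z - w).re| ≤ 1 / (n : ℝ) * |z.re| + R := by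
    have : |(z - w).re| ≤ |z.re| + R := by
      rw [Complex.sub_re]
      linarith [abs_sub z.re w.re]
    calc 1 / (m : ℝ) * |(z - w).re| ≤ 1 / (n : ℝ) * (|z.re| + R) := by gcongr
      _ ≤ _ := by nlinarith
  calc p (B ((F : ℂ → E₁) w) ((G : ℂ → E₂) (z - w)))
      ≤ D * q ((F : ℂ → E₁) w) * r ((G : ℂ → E₂) (z - w)) := hbd _ _
    _ ≤ D * (C₁ * Real.exp R) *
        (max C₂ 0 * Real.exp (1 / (n : ℝ) * |z.re| + R)) := by
        have h5 : C₁ * Real.exp (1 * |w.re|) ≤ C₁ * Real.exp R := by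
          rw [one_mul]; gcongr
        have h6 := mul_le_mul_of_nonneg_left (h1.trans h5) hD.le
        refine mul_le_mul h6 (h3.trans ?_) (apply_nonneg _ _) (by positivity)
        gcongr
    _ = D * C₁ * (max C₂ 0) * Real.exp (1 / (n : ℝ) * |z.re|) * (Real.exp R * Real.exp R) := by
        rw [Real.exp_add]
        ring
    _ ≤ D * C₁ * (max C₂ 0) * Real.exp (1 / (n : ℝ) * |z.re|) *
        (Real.exp (3 * R) * Real.exp (-1 * |w.re|)) := by
        refine mul_le_mul_of_nonneg_left ?_ (by positivity)
        rw [← Real.exp_add, ← Real.exp_add]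
        exact Real.exp_le_exp.2 (by linarith)
    _ = _ := by ring

section Convolution

variable {E E₁ E₂ : Type*} [AddCommGroup E] [Module ℂ E] [UniformSpace E] [IsUniformAddGroup E]
  [PolynormableSpace ℂ E]
  [AddCommGroup E₁] [Module ℂ E₁] [TopologicalSpace E₁]
  [IsTopologicalAddGroup E₁] [ContinuousSMul ℂ E₁]
  [AddCommGroup E₂] [Module ℂ E₂] [TopologicalSpace E₂]
  [IsTopologicalAddGroup E₂] [ContinuousSMul ℂ E₂]
  {B : E₁ →ₗ[ℂ] E₂ →ₗ[ℂ] E} {a b : ℝ} {c d : EReal}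

theorem differentiableAt_convolution_integrand (hB : SeminormBounded B)
    (F : Oexp E₁ (Icc (a : EReal) b)) (G : Oexp E₂ (Icc c d)) (e : E →L[ℂ] ℂ) {z w : ℂ}
    (hw : w ∉ finitePart (Icc (a : EReal) b)) (hzw : z - w ∉ finitePart (Icc c d)) :
    DifferentiableAt ℂ (fun w => e (B ((F : ℂ → E₁) w) ((G : ℂ → E₂) (z - w)))) w :=
  hB.differentiableAt e F.2.1 (G.2.1.comp_const_sub z) hw hzw

theorem continuousOn_convolution_integrand (hab : a ≤ b) (hB : SeminormBounded B)
    (F : Oexp E₁ (Icc (a : EReal) b)) (G : Oexp E₂ (Icc c d)) {n : ℕ} (hn : 1 ≤ n) {z : ℂ}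
    (hz : z ∈ S n (Icc (a + c) (b + d))) :
    ContinuousOn (fun w => B ((F : ℂ → E₁) w) ((G : ℂ → E₂) (z - w)))
      (support (contour a b (1 / (2 * n : ℝ)))) := by
  have hn0 : (1 : ℝ) ≤ n := by exact_mod_cast hn
  intro w hw
  obtain ⟨m, hnm, hm⟩ := exists_forall_sub_mem_S (c := c) (d := d) hab hn
  have h1 : ContinuousAt (F : ℂ → E₁) w :=
    F.2.1.continuousAt (not_mem_finitePart_of_mem_support hab (by positivity) hw)
  have h2 : ContinuousAt (fun w => (G : ℂ → E₂) (z - w)) w :=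
    (G.2.1.comp_const_sub z).continuousAt
      (not_mem_finitePart_of_mem_S (hn.trans hnm) (hm z hz w hw))
  exact (hB.continuous.continuousAt.comp (x := w) (h1.prodMk h2)).continuousWithinAt

/-- The contour convolution exists and belongs to `O^exp`. -/
theorem exists_isContourConvolution [ContinuousSMul ℂ E] [T2Space E]
    (hE : IsSequentiallyComplete E) (hab : a ≤ b)
    (hB : SeminormBounded B) (F : Oexp E₁ (Icc (a : EReal) b)) (G : Oexp E₂ (Icc c d)) :
    ∃ H : Oexp E (Icc (a + c) (b + d)),
      IsContourConvolution B a b c d (F : ℂ → E₁) (G : ℂ → E₂) (H : ℂ → E) := by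
  have hex : ∀ n : ℕ, 1 ≤ n → ∀ z ∈ S n (Icc (a + c) (b + d)), ∃ v,
      HasContourIntegral (contour a b (1 / (2 * n : ℝ)))
        (fun w => B ((F : ℂ → E₁) w) ((G : ℂ → E₂) (z - w))) v := by
    intro n hn z hz
    refine exists_hasContourIntegral hE (tame_contour _ _ _)
      (continuousOn_convolution_integrand hab hB F G hn hz) fun p hp => ?_
    obtain ⟨C, -, hC⟩ := exists_convolution_bound hab hB F G hn hp
    exact ⟨_, 1, one_pos, fun w hw => hC z hz w hw⟩
  have hindep : ∀ z : ℂ, ∃ v, ∀ n : ℕ, 1 ≤ n → z ∈ S n (Icc (a + c) (b + d)) →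
      HasContourIntegral (contour a b (1 / (2 * n : ℝ)))
        (fun w => B ((F : ℂ → E₁) w) ((G : ℂ → E₂) (z - w))) v := by
    intro z
    by_cases hz : ∃ n : ℕ, 1 ≤ n ∧ z ∈ S n (Icc (a + c) (b + d))
    · obtain ⟨n, hn, hzn⟩ := hz
      obtain ⟨v, hv⟩ := hex n hn z hzn
      refine ⟨v, fun m hm hzm => ?_⟩
      obtain ⟨v', hv'⟩ := hex m hm z hzm
      have : v' = v := eq_of_dual_eq fun e => by
        rw [← hv.cint_eq e, ← hv'.cint_eq e]
        have hn0 : (1 : ℝ) ≤ n := by exact_mod_cast hn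
        have hm0 : (1 : ℝ) ≤ m := by exact_mod_cast hm
        have hlt : ∀ k : ℝ, 1 ≤ k → 1 / (2 * k) < 1 / k := fun k hk =>
          one_div_lt_one_div_of_lt (by linarith) (by linarith)
        -- The integrand is holomorphic off `[a, b]` up to the distance `max (1 / m) (1 / n)`, which
        -- exceeds both widths.
        refine cint_contour_eq_of_width hab (by positivity) (by positivity)
          ((hlt m hm0).trans_le (le_max_left _ (1 / (n : ℝ))))
          ((hlt n hn0).trans_le (le_max_right _ _)) fun w hw hw' => ?_
        exact differentiableAt_convolution_integrand hB F G e hw' (sub_not_mem_finitePart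
          (fun k hk => max_le (le_dist_of_mem_S hzm hk) (le_dist_of_mem_S hzn hk)) hw)
      rwa [← this]
    · exact ⟨0, fun n hn hzn => absurd ⟨n, hn, hzn⟩ hz⟩
  -- `H` is the convolution. It is bounded on each `S_n`, being an integral over a fixed contour
  -- there, and weakly holomorphic by differentiation under the integral.
  choose H hH using hindep
  have hbound : ∀ n : ℕ, 1 ≤ n → ∀ p : Seminorm ℂ E, Continuous p → ∃ C, 0 ≤ C ∧
      ∀ z ∈ S n (Icc (a + c) (b + d)), p (H z) ≤ C * Real.exp (1 / (n : ℝ) * |z.re|) := by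
    intro n hn p hp
    obtain ⟨C, hC0, hC⟩ := exists_convolution_bound hab hB F G hn hp
    refine ⟨C * expMass (contour a b (1 / (2 * n : ℝ))) 1,
      mul_nonneg hC0 (expMass_nonneg _ _), fun z hz => ?_⟩
    have := (hH z n hn hz).seminorm_le (tame_contour _ _ _) hp one_pos (hC z hz)
    rwa [mul_right_comm] at this
  refine ⟨⟨H, ?_, ?_⟩, fun n hn z hz => hH z n hn hz⟩
  · refine holomorphicOn_of_weak hE (isClosed_finitePart _ _).isOpen_compl (fun e z hz => ?_)
      fun p hp z hz => ?_
    · obtain ⟨n, hn, hzn⟩ := exists_forall_mem_S hz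
      have hzn := hzn n le_rfl
      have hn0 : (1 : ℝ) ≤ n := by exact_mod_cast hn
      have hd : DifferentiableOn ℂ (fun z => cint (contour a b (1 / (2 * n : ℝ)))
          fun w => e (B ((F : ℂ → E₁) w) ((G : ℂ → E₂) (z - w)))) (S n (Icc (a + c) (b + d))) := by
        refine differentiableOn_cint (tame_contour _ _ _) (isOpen_S _ _) (fun w hw z hz => ?_)
          (fun z hz => ?_) fun z₀ hz₀ => ?_
        · obtain ⟨m, hnm, hm⟩ := exists_forall_sub_mem_S (c := c) (d := d) hab hn
          have h1 := G.2.1.differentiableAt_dual (hB.left e ((F : ℂ → E₁) w))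
            (not_mem_finitePart_of_mem_S (hn.trans hnm) (hm z hz w hw))
          exact (h1.comp z
            (by fun_prop : DifferentiableAt ℂ (fun z => z - w) z)).differentiableWithinAt
        · exact e.continuous.comp_continuousOn
            (continuousOn_convolution_integrand hab hB F G hn hz)
        · obtain ⟨p, hp, hpe⟩ := seminorm_dual_continuous e
          obtain ⟨C, hC0, hC⟩ := exists_convolution_bound hab hB F G hn hp
          refine ⟨C * Real.exp (1 / (n : ℝ) * (|z₀.re| + 1)), 1, one_pos, ?_⟩
          filter_upwards [(isOpen_S n _).mem_nhds hz₀, Metric.ball_mem_nhds z₀ one_pos]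
            with z hz hz' w hw
          rw [← hpe]
          refine (hC z hz w hw).trans ?_
          have h1 := abs_re_sub_le_dist z z₀
          have h2 := abs_sub_abs_le_abs_sub z.re z₀.re
          rw [Metric.mem_ball] at hz'
          gcongr
          linarith
      refine ((hd.differentiableAt ((isOpen_S n _).mem_nhds hzn)).congr_of_eventuallyEq
        ?_).differentiableWithinAt
      filter_upwards [(isOpen_S n _).mem_nhds hzn] with w hw
      exact ((hH w n hn hw).cint_eq e).symm
    · obtain ⟨n, hn, hzn⟩ := exists_forall_mem_S hz
      have hzn := hzn n le_rfl
      obtain ⟨C, hC0, hC⟩ := hbound n hn p hp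
      refine ⟨C * Real.exp (1 / (n : ℝ) * (|z.re| + 1)), ?_⟩
      filter_upwards [(isOpen_S n _).mem_nhds hzn, Metric.ball_mem_nhds z one_pos] with w hw hw'
      refine (hC w hw).trans ?_
      have h1 := abs_re_sub_le_dist w z
      have h2 := abs_sub_abs_le_abs_sub w.re z.re
      rw [Metric.mem_ball] at hw'
      gcongr
      linarith
  · intro n hn p hp
    obtain ⟨C, hC0, hC⟩ := hbound n hn p hp
    refine ⟨C, fun z hz => ?_⟩
    rw [neg_mul, Real.exp_neg, ← div_eq_mul_inv, div_le_iff₀ (Real.exp_pos _)]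
    exact hC z hz

end Convolution

/-! ### The Fourier transform of the contour convolution -/

section Shift

open Complex (I)

theorem add_coe_le_coe_add_iff {x : EReal} {s t : ℝ} : x + (s : EReal) ≤ ((t + s : ℝ) : EReal) ↔
    x ≤ t := by
  induction x with
  | bot => simp
  | top =>
    rw [EReal.top_add_coe, top_le_iff, top_le_iff]
    exact iff_of_false (EReal.coe_ne_top _) (EReal.coe_ne_top _)
  | coe x => rw [← EReal.coe_add, EReal.coe_le_coe_iff, EReal.coe_le_coe_iff]; simp

theorem coe_add_le_add_coe_iff {x : EReal} {s t : ℝ} : ((t + s : ℝ) : EReal) ≤ x + (s : EReal) ↔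
    (t : EReal) ≤ x := by
  induction x with
  | bot => simp
  | top => simp
  | coe x => rw [← EReal.coe_add, EReal.coe_le_coe_iff, EReal.coe_le_coe_iff]; simp

theorem vert_sub_const (f : ℂ → ℂ) (w : ℂ) (x : EReal) (y₀ y₁ : ℝ) :
    vert (fun z => f (z - w)) y₀ y₁ x =
      vert f (y₀ - w.im) (y₁ - w.im) (x + (-w.re : ℝ)) := by
  induction x with
  | bot => simp [vert_bot]
  | top => rw [EReal.top_add_coe, vert_top, vert_top]
  | coe x =>
    rw [← EReal.coe_add, vert_coe, vert_coe,
      ← intervalIntegral.integral_comp_sub_right (fun s : ℝ => f (((x + -w.re : ℝ) : ℂ) + s * I))]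
    congr 1
    refine intervalIntegral.integral_congr fun s _ => ?_
    congr 1
    apply Complex.ext <;> simp [sub_eq_add_neg]

theorem horiz_sub_const (f : ℂ → ℂ) (w : ℂ) (lo hi : EReal) (y : ℝ) :
    horiz (fun z => f (z - w)) lo hi y =
      horiz f (lo + (-w.re : ℝ)) (hi + (-w.re : ℝ)) (y - w.im) := by
  have h := (measurePreserving_add_right volume (-w.re)).setIntegral_preimage_emb
    (measurableEmbedding_addRight (-w.re)) (fun t : ℝ => f ((t : ℂ) + (y - w.im : ℝ) * I))
    (realPart (lo + (-w.re : ℝ)) (hi + (-w.re : ℝ)))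
  have hpre : (fun t : ℝ => t + -w.re) ⁻¹' realPart (lo + (-w.re : ℝ)) (hi + (-w.re : ℝ)) =
      realPart lo hi := by
    ext t
    exact and_congr add_coe_le_coe_add_iff coe_add_le_add_coe_iff
  rw [hpre] at h
  refine Eq.trans ?_ h
  refine integral_congr_ae (Eventually.of_forall fun t => ?_)
  simp only
  congr 1
  apply Complex.ext <;> simp [sub_eq_add_neg]

theorem rectInt_sub_const (f : ℂ → ℂ) (w : ℂ) (lo hi : EReal) (y₀ y₁ : ℝ) :
    rectInt (fun z => f (z - w)) lo hi y₀ y₁ =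
      rectInt f (lo + (-w.re : ℝ)) (hi + (-w.re : ℝ)) (y₀ - w.im) (y₁ - w.im) := by
  simp only [rectInt, vert_sub_const, horiz_sub_const]

theorem Around.add_coe {c d lo hi : EReal} {y₀ y₁ y₀' y₁' a b s t : ℝ}
    (h : Around c d lo hi y₀ y₁) (hs : s ≤ a) (ht : b ≤ t) (hy₀ : y₀' ≤ y₀) (hy₁ : y₁ ≤ y₁') :
    Around (a + c) (b + d) (lo + s) (hi + t) y₀' y₁' := by
  refine ⟨?_, ?_, hy₀.trans_lt h.neg, h.pos.trans_le hy₁⟩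
  · rcases h.left with ⟨h1, h2⟩ | ⟨h1, h2⟩
    · left; simp [h1, h2]
    · right
      lift lo to ℝ using ⟨h.lo_ne_top, h1⟩
      rw [← EReal.coe_add]
      refine ⟨EReal.coe_ne_bot _, ?_⟩
      induction c with
      | bot => simp at h2
      | top => rw [EReal.coe_add_top]; exact EReal.coe_lt_top _
      | coe c =>
        rw [EReal.coe_lt_coe_iff] at h2
        rw [← EReal.coe_add, EReal.coe_lt_coe_iff]
        linarith
  · rcases h.right with ⟨h1, h2⟩ | ⟨h1, h2⟩
    · left; simp [h1, h2]
    · right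
      lift hi to ℝ using ⟨h1, h.hi_ne_bot⟩
      rw [← EReal.coe_add]
      refine ⟨EReal.coe_ne_top _, ?_⟩
      induction d with
      | top => simp at h2
      | bot => simp
      | coe d =>
        rw [EReal.coe_lt_coe_iff] at h2
        rw [← EReal.coe_add, EReal.coe_lt_coe_iff]
        linarith

theorem Around.enlarge {c d lo hi : EReal} {y₀ y₁ y₀' y₁' s t : ℝ}
    (h : Around c d lo hi y₀ y₁) (hs : s ≤ 0) (ht : 0 ≤ t) (hy₀ : y₀' ≤ y₀) (hy₁ : y₁ ≤ y₁') :
    Around c d (lo + s) (hi + t) y₀' y₁' := by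
  simpa using h.add_coe hs ht hy₀ hy₁

/-- Translating a box boundary by the points of a smaller box keeps it in a collar. -/
theorem sub_mem_collar {lo hi : EReal} {y₀ y₁ a b : ℝ} {z w : ℂ}
    (hw : w ∈ closedBox (a - 1 : ℝ) (b + 1 : ℝ) (-1) 1)
    (hz : z ∈ closedBox (lo + (a - 2 : ℝ)) (hi + (b + 2 : ℝ)) (y₀ - 2) (y₁ + 2) \
      openBox (lo + (a - 2 : ℝ)) (hi + (b + 2 : ℝ)) (y₀ - 2) (y₁ + 2)) :
    z - w ∈ closedBox (lo + (a - b - 3 : ℝ)) (hi + (b - a + 3 : ℝ)) (y₀ - 3) (y₁ + 3) \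
      openBox lo hi y₀ y₁ := by
  obtain ⟨w1, w2, w3, w4⟩ := hw
  obtain ⟨⟨z1, z2, z3, z4⟩, hzo⟩ := hz
  rw [EReal.coe_le_coe_iff] at w1 w2
  refine ⟨⟨?_, ?_, ?_, ?_⟩, ?_⟩
  · rw [Complex.sub_re]
    induction lo with
    | bot => simp
    | top => rw [EReal.top_add_coe] at z1; simp at z1
    | coe lo =>
      rw [← EReal.coe_add, EReal.coe_le_coe_iff] at z1 ⊢
      linarith
  · rw [Complex.sub_re]
    induction hi with
    | bot => simp at z2
    | top => rw [EReal.top_add_coe]; exact le_top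
    | coe hi =>
      rw [← EReal.coe_add, EReal.coe_le_coe_iff] at z2 ⊢
      linarith
  · rw [Complex.sub_im]; linarith
  · rw [Complex.sub_im]; linarith
  · rintro ⟨h1, h2, h3, h4⟩
    rw [Complex.sub_re] at h1 h2
    rw [Complex.sub_im] at h3 h4
    refine hzo ⟨?_, ?_, by linarith, by linarith⟩
    · induction lo with
      | bot => simp
      | top => simp at h1
      | coe lo =>
        rw [EReal.coe_lt_coe_iff] at h1
        rw [← EReal.coe_add, EReal.coe_lt_coe_iff]
        linarith
    · induction hi with
      | bot => simp at h2
      | top => rw [EReal.top_add_coe]; exact EReal.coe_lt_top _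
      | coe hi =>
        rw [EReal.coe_lt_coe_iff] at h2
        rw [← EReal.coe_add, EReal.coe_lt_coe_iff]
        linarith

theorem Icc_add_ne_univ {a b : ℝ} {c d : EReal} (h : Icc c d ≠ univ) :
    Icc (a + c) (b + d) ≠ univ := by
  intro hu
  apply h
  have h1 : (⊥ : EReal) ∈ Icc (a + c) (b + d) := hu ▸ mem_univ _
  have h2 : (⊤ : EReal) ∈ Icc (a + c) (b + d) := hu ▸ mem_univ _
  have hc : c = ⊥ := by
    have := le_bot_iff.1 h1.1
    rw [EReal.add_eq_bot_iff] at this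
    simpa using this
  have hd : d = ⊤ := by
    have := top_le_iff.1 h2.2
    induction d with
    | bot => simp at this
    | top => rfl
    | coe d => exact absurd this (EReal.coe_ne_top (b + d))
  rw [hc, hd, Icc_bot_top]

theorem Icc_coe_ne_univ (a b : ℝ) : Icc (a : EReal) b ≠ univ := by
  intro hu
  have : (⊤ : EReal) ∈ Icc (a : EReal) b := hu ▸ mem_univ _
  simpa using this.2

theorem fourierDomain_add_subset (a b : ℝ) (c d : EReal) :
    fourierDomain (a + c) (b + d) ⊆ fourierDomain c d := fun ζ hζ =>
  ⟨fun h => hζ.1 (by rw [h, EReal.coe_add_top]), fun h => hζ.2 (by rw [h, EReal.add_bot])⟩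

theorem fourierDomain_coe (a b : ℝ) : fourierDomain a b = univ := by
  ext; simp [fourierDomain]

end Shift

section Convolution

open Complex (I)

variable {E E₁ E₂ : Type*} [AddCommGroup E] [Module ℂ E] [UniformSpace E] [IsUniformAddGroup E]
  [ContinuousSMul ℂ E] [PolynormableSpace ℂ E]
  [AddCommGroup E₁] [Module ℂ E₁] [TopologicalSpace E₁]
  [IsTopologicalAddGroup E₁] [ContinuousSMul ℂ E₁]
  [AddCommGroup E₂] [Module ℂ E₂] [TopologicalSpace E₂]
  [IsTopologicalAddGroup E₂] [ContinuousSMul ℂ E₂]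
  {B : E₁ →ₗ[ℂ] E₂ →ₗ[ℂ] E} {a b : ℝ} {c d : EReal}

/-- The convolution theorem: the Fourier transform of the contour convolution is the product of the
Fourier transforms. Both contours are moved to large boxes, the order of integration is exchanged,
and the inner contour is translated by the outer variable. -/
theorem IsContourConvolution.isFourierTransform (hab : a ≤ b) (hcd : c ≤ d)
    (hproper : Icc c d ≠ univ) (hB : SeminormBounded B)
    {F : Oexp E₁ (Icc (a : EReal) b)} {G : Oexp E₂ (Icc c d)} {H : Oexp E (Icc (a + c) (b + d))}
    (hH : IsContourConvolution B a b c d (F : ℂ → E₁) (G : ℂ → E₂) (H : ℂ → E))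
    {φ : ℂ → E₁} {ψ : ℂ → E₂} (hφ : IsFourierTransform (BV.mk F) φ)
    (hψ : IsFourierTransform (BV.mk G) ψ) :
    IsFourierTransform (BV.mk H) fun ζ => B (φ ζ) (ψ ζ) := by
  obtain ⟨lo, hi, y₀, y₁, h⟩ := exists_around hcd
  have hab' : (a : EReal) ≤ b := EReal.coe_le_coe_iff.2 hab
  have hcd' : (a : EReal) + c ≤ b + d := add_le_add hab' hcd
  have hproper' := Icc_add_ne_univ (a := a) (b := b) hproper
  have habp := Icc_coe_ne_univ a b
  have h₁ : Around (a : EReal) b (a - 1 : ℝ) (b + 1 : ℝ) (-1) 1 :=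
    around_coe (by linarith) (by linarith) (by norm_num) one_pos
  have h₂ : Around (a + c) (b + d) (lo + (a - 2 : ℝ)) (hi + (b + 2 : ℝ)) (y₀ - 2) (y₁ + 2) :=
    h.add_coe (by linarith) (by linarith) (by linarith) (by linarith)
  have h₃ : Around c d (lo + (a - b - 3 : ℝ)) (hi + (b - a + 3 : ℝ)) (y₀ - 3) (y₁ + 3) :=
    h.enlarge (by linarith) (by linarith) (by linarith) (by linarith)
  have hs₁ := h₁.support_subset hab'
  have hs₂ := h₂.support_subset hcd'
  have hT₁ := tame_rectContour (a - 1 : ℝ) (b + 1 : ℝ) (-1) 1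
  have hT₂ := tame_rectContour (lo + (a - 2 : ℝ)) (hi + (b + 2 : ℝ)) (y₀ - 2) (y₁ + 2)
  have hsub : ∀ z ∈ support (rectContour (lo + (a - 2 : ℝ)) (hi + (b + 2 : ℝ)) (y₀ - 2) (y₁ + 2)),
      ∀ w ∈ closedBox (a - 1 : ℝ) (b + 1 : ℝ) (-1) 1, z - w ∉ finitePart (Icc c d) :=
    fun z hz w hw hzw => (sub_mem_collar hw (hs₂ hz)).2 (h.finitePart_subset hzw)
  rw [isFourierTransform_iff hcd' hproper' H _ h₂]
  intro ζ hζ e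
  have hζ' : ζ ∈ fourierDomain c d := fourierDomain_add_subset a b c d hζ
  -- The convolution at the points `z` of the outer box, as an integral over the fixed box around
  -- `[a, b]`: the points `z - w` avoid `[c, d]` for all `w` in that box.
  have step1 : ∀ z ∈ support (rectContour (lo + (a - 2 : ℝ)) (hi + (b + 2 : ℝ)) (y₀ - 2) (y₁ + 2)),
      Complex.exp (-(I * z * ζ)) * e ((H : ℂ → E) z) =
        cint (rectContour (a - 1 : ℝ) (b + 1 : ℝ) (-1) 1) fun w =>
          Complex.exp (-(I * z * ζ)) * e (B ((F : ℂ → E₁) w) ((G : ℂ → E₂) (z - w))) := by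
    intro z hz
    obtain ⟨n, hn, hzn⟩ := exists_forall_mem_S
      (fun hz' => (hs₂ hz).2 (h₂.finitePart_subset hz') : z ∉ finitePart (Icc (a + c) (b + d)))
    have hzn := hzn n le_rfl
    have hn0 : (1 : ℝ) ≤ n := by exact_mod_cast hn
    rw [cint_const_mul, h₁.cint_eq, ← (hH n hn z hzn).cint_eq e]
    congr 1
    refine cint_contour_eq_rectInt_of_box hab (ρ := 1 / (n : ℝ)) (by positivity)
      (one_div_lt_one_div_of_lt (by linarith) (by linarith)) (by linarith) (by linarith)
      (by norm_num) one_pos (fun w hw hw' => ?_) fun w hw hw' => ?_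
    · exact differentiableAt_convolution_integrand hB F G e hw'
        (sub_not_mem_finitePart (fun k hk => le_dist_of_mem_S hzn hk) hw)
    · exact differentiableAt_convolution_integrand hB F G e hw' (hsub z hz w hw)
  rw [cint_congr hT₂ step1]
  obtain ⟨p, hp, hpe⟩ := seminorm_dual_continuous e
  obtain ⟨q, r, D, hq, hr, hD, hbd⟩ := hB p hp
  obtain ⟨C₀, δ, hδ, hC₀⟩ := (expDecayOn_kernel hproper' h₂ hζ).mono
    (fun z hz => (hs₂ hz).1 : support (rectContour (lo + (a - 2 : ℝ)) (hi + (b + 2 : ℝ))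
      (y₀ - 2) (y₁ + 2)) ⊆ _)
  obtain ⟨C₁, hC₁0, hC₁⟩ := F.2.2.exists_le (exists_forall_collar_subset_S h₁) hq one_pos
  obtain ⟨C₂, hC₂0, hC₂⟩ := G.2.2.exists_le (exists_forall_collar_subset_S h) hr (half_pos hδ)
  obtain ⟨R, hR⟩ : ∃ R, R = |a| + |b| + 1 := ⟨_, rfl⟩
  rw [cint_cint_swap hT₂ hT₁ (C := max C₀ 0 * (D * (C₁ * Real.exp R) *
    (C₂ * Real.exp (δ / 2 * R))) * Real.exp (δ / 2 * R)) (δ := δ / 2) ?_ (half_pos hδ) ?_]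
  -- After the exchange, the inner integral over `u = z - w` is taken along a box around `[c, d]`,
  -- and gives the Fourier transform of `G`.
  · have step2 : ∀ w ∈ support (rectContour (a - 1 : ℝ) (b + 1 : ℝ) (-1) 1),
        (cint (rectContour (lo + (a - 2 : ℝ)) (hi + (b + 2 : ℝ)) (y₀ - 2) (y₁ + 2)) fun z =>
          Complex.exp (-(I * z * ζ)) * e (B ((F : ℂ → E₁) w) ((G : ℂ → E₂) (z - w)))) =
        Complex.exp (-(I * w * ζ)) * hB.right e (ψ ζ) ((F : ℂ → E₁) w) := by
      intro w hw
      have hw' := (hs₁ hw).1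
      obtain ⟨w1, w2, w3, w4⟩ := hw'
      rw [EReal.coe_le_coe_iff] at w1 w2
      have e1 : (fun z => Complex.exp (-(I * z * ζ)) *
          e (B ((F : ℂ → E₁) w) ((G : ℂ → E₂) (z - w)))) = fun z => Complex.exp (-(I * w * ζ)) *
          (fun u => Complex.exp (-(I * u * ζ)) *
            hB.left e ((F : ℂ → E₁) w) ((G : ℂ → E₂) u)) (z - w) := by
        funext z
        simp only [hB.left_apply]
        rw [← mul_assoc, ← Complex.exp_add]
        congr 2
        ring
      have h₄ : Around c d (lo + (a - 2 + -w.re : ℝ)) (hi + (b + 2 + -w.re : ℝ)) (y₀ - 2 - w.im)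
          (y₁ + 2 - w.im) :=
        h.enlarge (by linarith) (by linarith) (by linarith) (by linarith)
      rw [e1, cint_const_mul, h₂.cint_eq, rectInt_sub_const (fun u => Complex.exp (-(I * u * ζ)) *
            hB.left e ((F : ℂ → E₁) w) ((G : ℂ → E₂) u)), add_assoc lo, ← EReal.coe_add,
        add_assoc hi, ← EReal.coe_add, ← h₄.cint_eq,
        (isFourierTransform_iff hcd hproper G ψ h₄).1 hψ ζ hζ', hB.left_apply, hB.right_apply]
    rw [cint_congr hT₁ step2, (isFourierTransform_iff hab' habp F φ h₁).1 hφ ζ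
      (by rw [fourierDomain_coe]; trivial), hB.right_apply]
  · rintro ⟨z, w⟩ ⟨hz, hw⟩
    have hF : ContinuousAt (F : ℂ → E₁) w :=
      F.2.1.continuousAt fun hw' => (hs₁ hw).2 (h₁.finitePart_subset hw')
    have hG : ContinuousAt (G : ℂ → E₂) (z - w) := G.2.1.continuousAt (hsub z hz w (hs₁ hw).1)
    have hF' : ContinuousAt (fun x : ℂ × ℂ => (F : ℂ → E₁) x.2) (z, w) :=
      ContinuousAt.comp (f := fun x : ℂ × ℂ => x.2) hF continuousAt_snd
    have hG' : ContinuousAt (fun x : ℂ × ℂ => (G : ℂ → E₂) (x.1 - x.2)) (z, w) :=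
      ContinuousAt.comp (f := fun x : ℂ × ℂ => x.1 - x.2) hG (by fun_prop)
    have hBc := hB.continuous.continuousAt.comp (x := (z, w)) (hF'.prodMk hG')
    exact ((by fun_prop : ContinuousAt (fun x : ℂ × ℂ => Complex.exp (-(I * x.1 * ζ))) (z, w)).mul
      (e.continuous.continuousAt.comp hBc)).continuousWithinAt
  · intro z hz w hw
    have hwR := (abs_le_of_mem_closedBox le_rfl (hs₁ hw).1).1
    rw [← hR] at hwR
    have hR0 : 0 ≤ R := (abs_nonneg _).trans hwR
    have k1 := hC₁ w (hs₁ hw)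
    have k2 := hC₂ (z - w) (sub_mem_collar (hs₁ hw).1 (hs₂ hz))
    have k3 : |(z - w).re| ≤ |z.re| + R := by
      rw [Complex.sub_re]
      linarith [abs_sub z.re w.re]
    have k4 : q ((F : ℂ → E₁) w) ≤ C₁ * Real.exp R := by
      refine k1.trans ?_
      rw [one_mul]
      gcongr
    have k5 : r ((G : ℂ → E₂) (z - w)) ≤
        C₂ * Real.exp (δ / 2 * R) * Real.exp (δ / 2 * |z.re|) := by
      refine k2.trans ?_
      rw [mul_assoc, ← Real.exp_add, ← mul_add]
      gcongr
      linarith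
    have k6 : 1 ≤ Real.exp (δ / 2 * R) * Real.exp (-(δ / 2) * |w.re|) := by
      rw [← Real.exp_add, Real.one_le_exp_iff]
      nlinarith
    have k7 : ‖Complex.exp (-(I * z * ζ))‖ ≤ max C₀ 0 * Real.exp (-δ * |z.re|) := by
      refine (hC₀ z hz).trans ?_
      gcongr
      exact le_max_left _ _
    have k8 : ‖e (B ((F : ℂ → E₁) w) ((G : ℂ → E₂) (z - w)))‖ ≤ D * (C₁ * Real.exp R) *
        (C₂ * Real.exp (δ / 2 * R) * Real.exp (δ / 2 * |z.re|)) := by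
      rw [← hpe]
      refine (hbd _ _).trans ?_
      gcongr
    have k9 : Real.exp (-δ * |z.re|) * Real.exp (δ / 2 * |z.re|) =
        Real.exp (-(δ / 2) * |z.re|) := by
      rw [← Real.exp_add]
      congr 1
      ring
    rw [norm_mul]
    calc ‖Complex.exp (-(I * z * ζ))‖ * ‖e (B ((F : ℂ → E₁) w) ((G : ℂ → E₂) (z - w)))‖
        ≤ max C₀ 0 * Real.exp (-δ * |z.re|) * (D * (C₁ * Real.exp R) *
          (C₂ * Real.exp (δ / 2 * R) * Real.exp (δ / 2 * |z.re|))) := by gcongr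
      _ = max C₀ 0 * (D * (C₁ * Real.exp R) * (C₂ * Real.exp (δ / 2 * R))) *
          Real.exp (-(δ / 2) * |z.re|) * 1 := by rw [← k9]; ring
      _ ≤ max C₀ 0 * (D * (C₁ * Real.exp R) * (C₂ * Real.exp (δ / 2 * R))) *
          Real.exp (-(δ / 2) * |z.re|) *
          (Real.exp (δ / 2 * R) * Real.exp (-(δ / 2) * |w.re|)) := by gcongr
      _ = _ := by ring

end Convolution

/-! ### Cauchy's formula with an exponentially decreasing kernel -/

section Kernel

open Complex (I)

theorem ExpDecayOn.add {f g : ℂ → ℂ} {Z : Set ℂ} (hf : ExpDecayOn f Z) (hg : ExpDecayOn g Z) :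
    ExpDecayOn (fun z => f z + g z) Z := by
  obtain ⟨C, δ, hδ, hC⟩ := hf
  obtain ⟨C', δ', hδ', hC'⟩ := hg
  refine ⟨|C| + |C'|, min δ δ', lt_min hδ hδ', fun z hz => ?_⟩
  refine (norm_add_le _ _).trans ?_
  rw [add_mul]
  refine add_le_add ((hC z hz).trans ?_) ((hC' z hz).trans ?_)
  · gcongr
    · exact le_abs_self C
    · exact min_le_left _ _
  · gcongr
    · exact le_abs_self C'
    · exact min_le_right _ _

theorem ExpDecayOn.of_norm_le {f g : ℂ → ℂ} {Z : Set ℂ} (hf : ExpDecayOn f Z) (M : ℝ)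
    (h : ∀ z ∈ Z, ‖g z‖ ≤ M * ‖f z‖) : ExpDecayOn g Z := by
  obtain ⟨C, δ, hδ, hC⟩ := hf
  refine ⟨|M| * C, δ, hδ, fun z hz => (h z hz).trans ?_⟩
  rw [mul_assoc]
  exact mul_le_mul (le_abs_self M) (hC z hz) (norm_nonneg _) (abs_nonneg _)

theorem ExpDecayOn.union {f : ℂ → ℂ} {Z W : Set ℂ} (hf : ExpDecayOn f Z) (hg : ExpDecayOn f W) :
    ExpDecayOn f (Z ∪ W) := by
  obtain ⟨C, δ, hδ, hC⟩ := hf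
  obtain ⟨C', δ', hδ', hC'⟩ := hg
  refine ⟨max |C| |C'|, min δ δ', lt_min hδ hδ', fun z hz => ?_⟩
  rcases hz with hz | hz
  · refine (hC z hz).trans ?_
    gcongr
    · exact (le_abs_self C).trans (le_max_left _ _)
    · exact min_le_left _ _
  · refine (hC' z hz).trans ?_
    gcongr
    · exact (le_abs_self C').trans (le_max_right _ _)
    · exact min_le_right _ _

/-- The kernel `e^{-δ(w - z)} / (w - z)`. -/
noncomputable def cauchyKernel (δ : ℝ) (z w : ℂ) : ℂ := Complex.exp (-(δ * (w - z))) / (w - z)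

theorem exp_sub_eq (δ : ℝ) (z w : ℂ) : Complex.exp (-(δ * (w - z))) =
    Complex.exp (δ * z) * Complex.exp (-(I * w * (-(δ * I)))) := by
  rw [← Complex.exp_add]
  congr 1
  linear_combination (-(δ * w) : ℂ) * Complex.I_mul_I

theorem norm_exp_mul_ofReal (δ : ℝ) (z : ℂ) : ‖Complex.exp (δ * z)‖ = Real.exp (δ * z.re) := by
  rw [Complex.norm_exp]
  simp

theorem norm_cauchyKernel_le {δ r : ℝ} {z w : ℂ} (hr : 0 < r) (h : r ≤ ‖w - z‖) :
    ‖cauchyKernel δ z w‖ ≤ Real.exp (δ * z.re) / r * ‖Complex.exp (-(I * w * (-(δ * I))))‖ := by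
  rw [cauchyKernel, norm_div, exp_sub_eq, norm_mul, norm_exp_mul_ofReal, mul_div_right_comm]
  gcongr

theorem differentiableAt_cauchyKernel {δ : ℝ} {z w : ℂ} (h : w ≠ z) :
    DifferentiableAt ℂ (cauchyKernel δ z) w :=
  DifferentiableAt.div (by fun_prop) (by fun_prop) (sub_ne_zero.2 h)

theorem expDecayOn_cauchyKernel {δ r : ℝ} {z : ℂ} {W : Set ℂ}
    (hk : ExpDecayOn (fun w => Complex.exp (-(I * w * (-(δ * I))))) W) (hr : 0 < r)
    (h : ∀ w ∈ W, r ≤ ‖w - z‖) : ExpDecayOn (cauchyKernel δ z) W :=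
  hk.of_norm_le _ fun w hw => norm_cauchyKernel_le hr (h w hw)

/-- On opposite sides of the square the integrands combine to a multiple of `(1 + s²)⁻¹`, so that
each pair of sides contributes `-π * I`. -/
theorem rectInt_inv_square : rectInt (fun u => u⁻¹) (-1 : ℝ) (1 : ℝ) (-1) 1 =
    -(2 * Real.pi * I) := by
  have key : ∫ s in (-1 : ℝ)..1, (((1 + s ^ 2)⁻¹ : ℝ) : ℂ) = Real.pi / 2 := by
    rw [intervalIntegral.integral_ofReal, integral_inv_one_add_sq, Real.arctan_neg,
      Real.arctan_one]
    push_cast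
    ring
  have hne : ∀ x y : ℝ, (x ≠ 0 ∨ y ≠ 0) → (x : ℂ) + y * I ≠ 0 := by
    intro x y h h0
    have h1 := congrArg Complex.re h0
    have h2 := congrArg Complex.im h0
    simp at h1 h2
    rcases h with h | h <;> contradiction
  have hi1 : ∀ x : ℝ, x ≠ 0 → IntervalIntegrable (fun s : ℝ => ((x : ℂ) + s * I)⁻¹) volume (-1) 1 :=
    fun x hx => (Continuous.inv₀ (by fun_prop) fun s => hne x s (Or.inl hx)).intervalIntegrable _ _
  have hi2 : ∀ y : ℝ, y ≠ 0 → IntervalIntegrable (fun t : ℝ => ((t : ℂ) + y * I)⁻¹) volume (-1) 1 :=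
    fun y hy => (Continuous.inv₀ (by fun_prop) fun s => hne s y (Or.inr hy)).intervalIntegrable _ _
  have hv : (∫ s in (-1 : ℝ)..1, (((-1 : ℝ) : ℂ) + s * I)⁻¹) -
      ∫ s in (-1 : ℝ)..1, (((1 : ℝ) : ℂ) + s * I)⁻¹ = -2 * (Real.pi / 2) := by
    rw [← intervalIntegral.integral_sub (hi1 _ (by norm_num)) (hi1 _ one_ne_zero), ← key,
      ← intervalIntegral.integral_const_mul]
    refine intervalIntegral.integral_congr fun s _ => ?_
    have h1 := hne (-1) s (Or.inl (by norm_num))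
    have h2 := hne 1 s (Or.inl one_ne_zero)
    have h3 : (1 + (s : ℂ) ^ 2) ≠ 0 := by
      have : (1 + s ^ 2 : ℝ) ≠ 0 := by positivity
      exact_mod_cast this
    push_cast at h1 h2 ⊢
    field_simp
    linear_combination (2 * (s : ℂ) ^ 2) * Complex.I_sq
  have hh : (∫ t in (-1 : ℝ)..1, ((t : ℂ) + (1 : ℝ) * I)⁻¹) -
      ∫ t in (-1 : ℝ)..1, ((t : ℂ) + (-1 : ℝ) * I)⁻¹ = -2 * I * (Real.pi / 2) := by
    rw [← intervalIntegral.integral_sub (hi2 _ one_ne_zero) (hi2 _ (by norm_num)), ← key,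
      ← intervalIntegral.integral_const_mul]
    refine intervalIntegral.integral_congr fun s _ => ?_
    have h1 := hne s 1 (Or.inr one_ne_zero)
    have h2 := hne s (-1) (Or.inr (by norm_num))
    have h3 : (1 + (s : ℂ) ^ 2) ≠ 0 := by
      have : (1 + s ^ 2 : ℝ) ≠ 0 := by positivity
      exact_mod_cast this
    push_cast at h1 h2 ⊢
    simp only [one_mul, neg_one_mul, ← sub_eq_add_neg] at h1 h2 ⊢
    field_simp
    linear_combination (-2 * I) * Complex.I_sq
  rw [rectInt, vert_coe, vert_coe, horiz_coe _ (by norm_num), horiz_coe _ (by norm_num)]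
  linear_combination I * hv + hh

theorem rectInt_cauchyKernel_zero_square (δ : ℝ) :
    rectInt (cauchyKernel δ 0) (-1 : ℝ) (1 : ℝ) (-1) 1 = -(2 * Real.pi * I) := by
  have hA : Around ((0 : ℝ) : EReal) ((0 : ℝ) : EReal) (-1 : ℝ) (1 : ℝ) (-1) 1 :=
    around_coe (by norm_num) one_pos (by norm_num) one_pos
  have hs := hA.support_subset le_rfl
  have hT := tame_rectContour (-1 : ℝ) (1 : ℝ) (-1) 1
  have h0 : ∀ w ∈ support (rectContour (-1 : ℝ) (1 : ℝ) (-1) 1), w ≠ 0 := by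
    rintro w hw rfl
    exact (hs hw).2 (by simp [openBox])
  have hsub : ∀ {f : ℂ → ℂ}, (∀ w, w ≠ 0 → DifferentiableAt ℂ f w) → ∀ A ∈ rectContour (-1 : ℝ)
      (1 : ℝ) (-1) 1, IntegrableOn (fun t => deriv A.path t * f (A.path t)) A.dom := by
    intro f hf
    refine integrableOn_of_expDecayOn hT (fun w hw =>
      (hf w (h0 w hw)).continuousAt.continuousWithinAt) ?_
    refine (expDecayOn_of_isCompact (Z := closedBox (-1 : ℝ) (1 : ℝ) (-1) 1 \
      openBox (-1 : ℝ) (1 : ℝ) (-1) 1) ?_ fun w hw => ?_).mono hs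
    · exact (isCompact_closedBox _ _ _ _).diff (isOpen_openBox _ _ _ _)
    · refine (hf w ?_).continuousAt.continuousWithinAt
      rintro rfl
      exact hw.2 (by simp [openBox])
  have hinv : ∀ w : ℂ, w ≠ 0 → DifferentiableAt ℂ (fun u : ℂ => u⁻¹) w := fun w hw =>
    differentiableAt_inv hw
  have hk : ∀ w : ℂ, w ≠ 0 → DifferentiableAt ℂ (cauchyKernel δ 0) w := fun w hw =>
    differentiableAt_cauchyKernel hw
  have hd : Differentiable ℂ (dslope (fun u : ℂ => Complex.exp (-(δ * u))) 0) := by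
    rw [← differentiableOn_univ]
    exact (Complex.differentiableOn_dslope univ_mem).2 (by fun_prop)
  have h1 : cint (rectContour (-1 : ℝ) (1 : ℝ) (-1) 1)
      (fun w => cauchyKernel δ 0 w - w⁻¹) = 0 := by
    have h2 : cint (rectContour (-1 : ℝ) (1 : ℝ) (-1) 1) (fun w => cauchyKernel δ 0 w - w⁻¹) =
        cint (rectContour (-1 : ℝ) (1 : ℝ) (-1) 1)
          (dslope (fun u : ℂ => Complex.exp (-(δ * u))) 0) := by
      refine cint_congr hT fun w hw => ?_
      rw [dslope_of_ne _ (h0 w hw), slope_def_field, cauchyKernel]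
      simp [sub_div]
    rw [h2, hA.cint_eq]
    exact rectInt_eq_zero (EReal.coe_le_coe_iff.2 (by norm_num)) (EReal.coe_ne_top _)
      (EReal.coe_ne_bot _) (by norm_num) (fun w _ => hd w)
      (expDecayOn_of_isCompact (isCompact_closedBox _ _ _ _) hd.continuous.continuousOn)
  rw [cint_sub (hsub hk) (hsub hinv), sub_eq_zero, hA.cint_eq, hA.cint_eq] at h1
  rw [h1, rectInt_inv_square]

theorem le_norm_of_not_mem_openBox {z w : ℂ} {r : ℝ}
    (hw : w ∉ openBox (z.re - r : ℝ) (z.re + r : ℝ) (z.im - r) (z.im + r)) : r ≤ ‖w - z‖ := by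
  by_contra! h
  have h1 := abs_lt.1 ((Complex.abs_re_le_norm (w - z)).trans_lt h)
  have h2 := abs_lt.1 ((Complex.abs_im_le_norm (w - z)).trans_lt h)
  rw [Complex.sub_re] at h1
  rw [Complex.sub_im] at h2
  refine hw ⟨?_, ?_, by linarith, by linarith⟩
  · rw [EReal.coe_lt_coe_iff]; linarith
  · rw [EReal.coe_lt_coe_iff]; linarith

/-- A point of an open box is the centre of a square, of half-side at most `1`, inside the box. -/
theorem exists_square_subset {lo hi : EReal} {y₀ y₁ : ℝ} {z : ℂ} (hz : z ∈ openBox lo hi y₀ y₁) :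
    ∃ r : ℝ, 0 < r ∧ r ≤ 1 ∧ lo ≤ ((z.re - r : ℝ) : EReal) ∧ ((z.re + r : ℝ) : EReal) ≤ hi ∧
      y₀ ≤ z.im - r ∧ z.im + r ≤ y₁ := by
  obtain ⟨h1, h2, h3, h4⟩ := hz
  obtain ⟨r₁, hr₁, hlo⟩ : ∃ r : ℝ, 0 < r ∧ lo ≤ ((z.re - r : ℝ) : EReal) := by
    induction lo with
    | bot => exact ⟨1, one_pos, bot_le⟩
    | top => simp at h1
    | coe lo =>
      rw [EReal.coe_lt_coe_iff] at h1
      exact ⟨z.re - lo, by linarith, by rw [sub_sub_cancel]⟩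
  obtain ⟨r₂, hr₂, hhi⟩ : ∃ r : ℝ, 0 < r ∧ ((z.re + r : ℝ) : EReal) ≤ hi := by
    induction hi with
    | top => exact ⟨1, one_pos, le_top⟩
    | bot => simp at h2
    | coe hi =>
      rw [EReal.coe_lt_coe_iff] at h2
      exact ⟨hi - z.re, by linarith, by rw [add_sub_cancel]⟩
  refine ⟨min (min r₁ r₂) (min (min (z.im - y₀) (y₁ - z.im)) 1), ?_, ?_, ?_, ?_, ?_, ?_⟩
  · exact lt_min (lt_min hr₁ hr₂) (lt_min (lt_min (by linarith) (by linarith)) one_pos)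
  · exact (min_le_right _ _).trans (min_le_right _ _)
  · refine hlo.trans (EReal.coe_le_coe_iff.2 ?_)
    linarith [(min_le_left (min r₁ r₂) (min (min (z.im - y₀) (y₁ - z.im)) 1)).trans
      (min_le_left _ _)]
  · refine le_trans (EReal.coe_le_coe_iff.2 ?_) hhi
    linarith [(min_le_left (min r₁ r₂) (min (min (z.im - y₀) (y₁ - z.im)) 1)).trans
      (min_le_right _ _)]
  · linarith [((min_le_right (min r₁ r₂) (min (min (z.im - y₀) (y₁ - z.im)) 1)).trans
      (min_le_left _ _)).trans (min_le_left _ _)]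
  · linarith [((min_le_right (min r₁ r₂) (min (min (z.im - y₀) (y₁ - z.im)) 1)).trans
      (min_le_left _ _)).trans (min_le_right _ _)]

/-- Cauchy's formula for the constant function `1` and the decreasing kernel. -/
theorem rectInt_cauchyKernel {lo hi : EReal} {y₀ y₁ δ : ℝ} {z : ℂ}
    (hk : ExpDecayOn (fun w => Complex.exp (-(I * w * (-(δ * I))))) (closedBox lo hi y₀ y₁))
    (hz : z ∈ openBox lo hi y₀ y₁) :
    rectInt (cauchyKernel δ z) lo hi y₀ y₁ = -(2 * Real.pi * I) := by
  obtain ⟨r, hr, hr1, h1, h2, h3, h4⟩ := exists_square_subset hz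
  have e1 : rectInt (cauchyKernel δ z) lo hi y₀ y₁ =
      rectInt (cauchyKernel δ z) (z.re - r : ℝ) (z.re + r : ℝ) (z.im - r) (z.im + r) := by
    refine rectInt_eq_of_nested h1 h2 (EReal.coe_le_coe_iff.2 (by linarith)) (EReal.coe_ne_top _)
      (EReal.coe_ne_bot _) h3 (by linarith) h4 (fun w hw => ?_) ?_
    · refine differentiableAt_cauchyKernel ?_
      rintro rfl
      have := le_norm_of_not_mem_openBox hw.2
      rw [sub_self, norm_zero] at this
      linarith
    · exact expDecayOn_cauchyKernel (hk.mono sdiff_subset) hr fun w hw =>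
        le_norm_of_not_mem_openBox hw.2
  have e2 : rectInt (cauchyKernel δ 0) (-1 : ℝ) (1 : ℝ) (-1) 1 =
      rectInt (cauchyKernel δ 0) (-r : ℝ) (r : ℝ) (-r) r := by
    have hmem : ∀ w ∈ closedBox (-1 : ℝ) (1 : ℝ) (-1) 1 \ openBox (-r : ℝ) (r : ℝ) (-r) r,
        DifferentiableAt ℂ (cauchyKernel δ 0) w := by
      intro w hw
      refine differentiableAt_cauchyKernel ?_
      rintro rfl
      exact hw.2 (by simp [openBox, hr])
    refine rectInt_eq_of_nested (EReal.coe_le_coe_iff.2 (by linarith))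
      (EReal.coe_le_coe_iff.2 (by linarith)) (EReal.coe_le_coe_iff.2 (by linarith))
      (EReal.coe_ne_top _) (EReal.coe_ne_bot _) (by linarith) (by linarith) (by linarith) hmem ?_
    exact expDecayOn_of_isCompact ((isCompact_closedBox _ _ _ _).diff (isOpen_openBox _ _ _ _))
      fun w hw => (hmem w hw).continuousAt.continuousWithinAt
  have e3 : cauchyKernel δ z = fun w => cauchyKernel δ 0 (w - z) := by
    funext w
    simp [cauchyKernel]
  rw [e1, e3, rectInt_sub_const (cauchyKernel δ 0), ← EReal.coe_add, ← EReal.coe_add,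
    show z.re - r + -z.re = -r by ring, show z.re + r + -z.re = r by ring,
    show z.im - r - z.im = -r by ring, show z.im + r - z.im = r by ring, ← e2,
    rectInt_cauchyKernel_zero_square]

/-- The half-line `[0, ∞)` as a contour. -/
def rayContour : List Arc := [⟨Ici 0, fun t => (t : ℂ)⟩]

theorem tame_rayContour : TameContour rayContour := by
  intro A hA
  rw [rayContour, List.mem_singleton] at hA
  subst hA
  refine ⟨isClosed_Ici, Complex.ofRealCLM.contDiff, ⟨1, fun t => ?_⟩, fun δ hδ => ?_⟩
  · have : deriv (fun t : ℝ => (t : ℂ)) t = 1 := (Complex.ofRealCLM.hasDerivAt (x := t)).deriv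
    simp [this]
  · simpa using (integrable_exp_neg_abs hδ).integrableOn

theorem cint_rayContour (f : ℂ → ℂ) : cint rayContour f = ∫ t in Ioi (0 : ℝ), f t := by
  have : ∀ t : ℝ, deriv (fun t : ℝ => (t : ℂ)) t = 1 := fun t =>
    (Complex.ofRealCLM.hasDerivAt (x := t)).deriv
  simp [cint, rayContour, arcInt, this, integral_Ici_eq_integral_Ioi]

/-- If the Fourier integrals of `f` over `γ` vanish on the line `Im ζ = -δ`, then so does the
Cauchy integral with decreasing kernel at points `z` above (`s = 1`) or below (`s = -1`) the
contour. Indeed `1 / (w - z)` is, up to a constant, the integral of `e^{-isξ(w - z)}` over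
`ξ > 0`. -/
theorem cint_cauchyKernel_mul_eq_zero {γ : List Arc} (hγ : TameContour γ) {f : ℂ → ℂ} {δ s η : ℝ}
    {z : ℂ} (hs : s ≠ 0) (hη : 0 < η) (hf : ContinuousOn f (support γ))
    (hd : ExpDecayOn (fun w => Complex.exp (-(I * w * (-(δ * I)))) * f w) (support γ))
    (hz : ∀ w ∈ support γ, s * (w - z).im ≤ -η)
    (h0 : ∀ ξ : ℝ, cint γ (fun w => Complex.exp (-(I * w * (ξ - δ * I))) * f w) = 0) :
    cint γ (fun w => cauchyKernel δ z w * f w) = 0 := by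
  have hray : ∀ u ∈ support rayContour, 0 ≤ u.re ∧ u = (u.re : ℂ) := by
    rintro u ⟨A, hA, t, ht, rfl⟩
    rw [rayContour, List.mem_singleton] at hA
    subst hA
    exact ⟨by simpa using ht, by simp⟩
  obtain ⟨C, δ', hδ', hb⟩ := hd
  have hswap := cint_cint_swap hγ tame_rayContour (g := fun w u =>
    Complex.exp (-(δ * (w - z))) * f w * Complex.exp (-(I * s * (w - z)) * u))
    (C := Real.exp (δ * z.re) * |C|) (δ := min δ' η) ?_ (lt_min hδ' hη) ?_
  rotate_left
  · have h1 : ContinuousOn (fun x : ℂ × ℂ => f x.1) (support γ ×ˢ support rayContour) :=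
      hf.comp continuousOn_fst fun x hx => hx.1
    exact ((by fun_prop : Continuous fun x : ℂ × ℂ =>
      Complex.exp (-(δ * (x.1 - z)))).continuousOn.mul h1).mul (by fun_prop :
        Continuous fun x : ℂ × ℂ => Complex.exp (-(I * s * (x.1 - z)) * x.2)).continuousOn
  · intro w hw u hu
    obtain ⟨hu0, hu1⟩ := hray u hu
    have h2 : ‖Complex.exp (-(I * s * (w - z)) * u)‖ ≤
        Real.exp (-(min δ' η) * |u.re|) := by
      rw [Complex.norm_exp, hu1]
      refine Real.exp_le_exp.2 ?_
      have h3 : (-(I * s * (w - z)) * (u.re : ℂ)).re = s * (w - z).im * u.re := by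
        simp
      rw [h3, Complex.ofReal_re, abs_of_nonneg hu0]
      refine mul_le_mul_of_nonneg_right ((hz w hw).trans ?_) hu0
      exact neg_le_neg (min_le_right _ _)
    have h4 : ‖Complex.exp (-(δ * (w - z))) * f w‖ ≤ Real.exp (δ * z.re) * |C| *
        Real.exp (-(min δ' η) * |w.re|) := by
      rw [exp_sub_eq, mul_assoc (Complex.exp _) (Complex.exp _), norm_mul, norm_exp_mul_ofReal,
        mul_assoc (Real.exp _)]
      refine mul_le_mul_of_nonneg_left ((hb w hw).trans ?_) (Real.exp_pos _).le
      gcongr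
      · exact le_abs_self _
      · exact min_le_left _ _
    rw [norm_mul]
    exact mul_le_mul h4 h2 (norm_nonneg _) (by positivity)
  have hne : ∀ w ∈ support γ, (-(I * s * (w - z))).re < 0 := by
    intro w hw
    have h3 : (-(I * s * (w - z))).re = s * (w - z).im := by simp
    rw [h3]
    linarith [hz w hw]
  have hleft : ∀ w ∈ support γ, cint rayContour (fun u =>
      Complex.exp (-(δ * (w - z))) * f w * Complex.exp (-(I * s * (w - z)) * u)) =
      (I * s)⁻¹ * (cauchyKernel δ z w * f w) := by
    intro w hw
    have h5 := hne w hw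
    have hwz : w - z ≠ 0 := by
      intro h
      rw [h] at h5
      simp at h5
    have hs' : (s : ℂ) ≠ 0 := Complex.ofReal_ne_zero.2 hs
    rw [cint_const_mul, cint_rayContour, integral_exp_mul_complex_Ioi h5, cauchyKernel]
    simp only [Complex.ofReal_zero, mul_zero, Complex.exp_zero]
    have := Complex.I_ne_zero
    field_simp
  have hright : ∀ u ∈ support rayContour, cint γ (fun w =>
      Complex.exp (-(δ * (w - z))) * f w * Complex.exp (-(I * s * (w - z)) * u)) = 0 := by
    intro u hu
    have h6 := h0 (s * u.re)
    have h7 : (fun w => Complex.exp (-(δ * (w - z))) * f w * Complex.exp (-(I * s * (w - z)) * u)) =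
        fun w => Complex.exp (δ * z + I * s * z * u) *
          (Complex.exp (-(I * w * (((s * u.re : ℝ) : ℂ) - δ * I))) * f w) := by
      funext w
      rw [mul_right_comm, ← Complex.exp_add, ← mul_assoc, ← Complex.exp_add]
      congr 2
      rw [(hray u hu).2]
      push_cast
      rw [Complex.ofReal_re]
      linear_combination (-(δ * w) : ℂ) * Complex.I_mul_I
    rw [h7, cint_const_mul, h6, mul_zero]
  rw [cint_congr hγ hleft, cint_congr tame_rayContour hright, cint_const_mul] at hswap
  have hzero : cint rayContour (fun _ => 0) = 0 := by simp [cint_rayContour]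
  rw [hzero] at hswap
  have hs' : (s : ℂ) ≠ 0 := Complex.ofReal_ne_zero.2 hs
  exact (mul_eq_zero.1 hswap).resolve_left (inv_ne_zero (mul_ne_zero Complex.I_ne_zero hs'))

end Kernel

/-! ### Injectivity of the Fourier transform -/

section Injectivity

open Complex (I)

theorem exists_le_norm_sub {Z : Set ℂ} (hZ : IsClosed Z) {z : ℂ} (hz : z ∉ Z) :
    ∃ r : ℝ, 0 < r ∧ ∀ w ∈ Z, r ≤ ‖w - z‖ := by
  obtain ⟨r, hr, h⟩ := Metric.isOpen_iff.1 hZ.isOpen_compl z hz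
  refine ⟨r, hr, fun w hw => ?_⟩
  by_contra! hlt
  exact h (by rwa [Metric.mem_ball, dist_eq_norm]) hw

theorem isClosed_collar (lo hi lo' hi' : EReal) (y₀ y₁ y₀' y₁' : ℝ) :
    IsClosed (closedBox lo hi y₀ y₁ \ openBox lo' hi' y₀' y₁') :=
  (isClosed_closedBox _ _ _ _).inter (isOpen_openBox _ _ _ _).isClosed_compl

/-- Two functions continuous at `z` that agree at the nonreal points near `z` agree at `z`. -/
theorem eq_of_eq_of_im_ne_zero {f g : ℂ → ℂ} {z : ℂ} (hf : ContinuousAt f z)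
    (hg : ContinuousAt g z) (h : ∀ᶠ w in 𝓝 z, w.im ≠ 0 → f w = g w) : f z = g z := by
  have hmem : z ∈ closure {w : ℂ | w.im ≠ 0} := by
    refine Metric.mem_closure_iff.2 fun ε hε => ?_
    by_cases hz : z.im = 0
    · refine ⟨z + (ε / 2 : ℝ) * I, ?_, ?_⟩
      · simp [hz, hε.ne']
      · rw [dist_eq_norm, sub_add_cancel_left, norm_neg, norm_mul, Complex.norm_I, mul_one,
          Complex.norm_real, Real.norm_of_nonneg (by positivity)]
        linarith
    · exact ⟨z, hz, by simpa using hε⟩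
  have := mem_closure_iff_nhdsWithin_neBot.1 hmem
  refine tendsto_nhds_unique (f := f) (l := 𝓝[{w : ℂ | w.im ≠ 0}] z)
    (hf.mono_left nhdsWithin_le_nhds)
    ((hg.mono_left nhdsWithin_le_nhds).congr' ?_)
  filter_upwards [nhdsWithin_le_nhds h, self_mem_nhdsWithin] with w hw hw'
  exact (hw hw').symm

theorem seminorm_cauchyKernel_smul_le {E : Type*} [AddCommGroup E] [Module ℂ E] {δ : ℝ}
    {p : Seminorm ℂ E} {F : ℂ → E} {Z : Set ℂ} {C δ' r : ℝ}
    (hC : ∀ w ∈ Z, ‖Complex.exp (-(I * w * (-(δ * I))))‖ * p (F w) ≤ C * Real.exp (-δ' * |w.re|))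
    {z : ℂ} (hr : 0 < r) (hz : ∀ w ∈ Z, r ≤ ‖w - z‖) {w : ℂ} (hw : w ∈ Z) :
    p (cauchyKernel δ z w • F w) ≤ Real.exp (δ * z.re) / r * C * Real.exp (-δ' * |w.re|) := by
  rw [map_smul_eq_mul, mul_assoc]
  refine le_trans ?_ (mul_le_mul_of_nonneg_left (hC w hw) (by positivity))
  rw [← mul_assoc]
  gcongr
  exact norm_cauchyKernel_le hr (hz w hw)

section Scalar

variable {E : Type*} [AddCommGroup E] [Module ℂ E] [TopologicalSpace E] [IsTopologicalAddGroup E]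
  [ContinuousSMul ℂ E] {c d lo hi : EReal} {y₀ y₁ δ : ℝ}

theorem expDecayOn_cauchyKernel_mul (hproper : Icc c d ≠ univ) (F : Oexp E (Icc c d))
    (e : E →L[ℂ] ℂ) (hδ : -(δ * I) ∈ fourierDomain c d) (h : Around c d lo hi y₀ y₁) {r : ℝ} {z : ℂ}
    (hr : 0 < r) (hz : ∀ w ∈ closedBox lo hi y₀ y₁ \ openBox lo hi y₀ y₁, r ≤ ‖w - z‖) :
    ExpDecayOn (fun w => cauchyKernel δ z w * e ((F : ℂ → E) w))
      (closedBox lo hi y₀ y₁ \ openBox lo hi y₀ y₁) := by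
  refine (decaysAround_fourier hproper F e hδ h h).of_norm_le (Real.exp (δ * z.re) / r)
    fun w hw => ?_
  rw [norm_mul, norm_mul, ← mul_assoc]
  gcongr
  exact norm_cauchyKernel_le hr (hz w hw)

/-- Subtracting off the value at `z` regularizes the Cauchy integral. -/
theorem cint_exp_mul_dslope (hcd : c ≤ d) (hproper : Icc c d ≠ univ) (F : Oexp E (Icc c d))
    (e : E →L[ℂ] ℂ) (hδ : -(δ * I) ∈ fourierDomain c d) (h : Around c d lo hi y₀ y₁) {z : ℂ}
    (hz : z ∉ closedBox lo hi y₀ y₁ \ openBox lo hi y₀ y₁) :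
    cint (rectContour lo hi y₀ y₁)
        (fun w => Complex.exp (-(δ * (w - z))) * dslope (fun u => e ((F : ℂ → E) u)) z w) =
      cint (rectContour lo hi y₀ y₁) (fun w => cauchyKernel δ z w * e ((F : ℂ → E) w)) -
        e ((F : ℂ → E) z) * cint (rectContour lo hi y₀ y₁) (cauchyKernel δ z) := by
  have hs := h.support_subset hcd
  have hT := tame_rectContour lo hi y₀ y₁
  obtain ⟨r, hr, hzr⟩ := exists_le_norm_sub (isClosed_collar _ _ _ _ _ _ _ _) hz
  have hne : ∀ w ∈ support (rectContour lo hi y₀ y₁), w ≠ z := by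
    rintro w hw rfl
    exact hz (hs hw)
  have hk : ExpDecayOn (cauchyKernel δ z) (closedBox lo hi y₀ y₁ \ openBox lo hi y₀ y₁) :=
    expDecayOn_cauchyKernel ((expDecayOn_kernel hproper h hδ).mono sdiff_subset) hr hzr
  have hkc : ContinuousOn (cauchyKernel δ z) (support (rectContour lo hi y₀ y₁)) := fun w hw =>
    (differentiableAt_cauchyKernel (hne w hw)).continuousAt.continuousWithinAt
  have hfc : ContinuousOn (fun w => e ((F : ℂ → E) w)) (support (rectContour lo hi y₀ y₁)) :=
    fun w hw => (F.2.1.differentiableAt_dual e fun hw' =>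
      (hs hw).2 (h.finitePart_subset hw')).continuousAt.continuousWithinAt
  rw [← cint_const_mul, ← cint_sub]
  · refine cint_congr hT fun w hw => ?_
    rw [dslope_of_ne _ (hne w hw), slope_def_field, cauchyKernel]
    ring
  · exact integrableOn_of_expDecayOn hT (hkc.mul hfc)
      ((expDecayOn_cauchyKernel_mul hproper F e hδ h hr hzr).mono hs)
  · exact integrableOn_of_expDecayOn hT (continuousOn_const.mul hkc)
      ((hk.of_norm_le _ fun w _ => (norm_mul_le _ _)).mono hs)

/-- Cauchy's formula at nonreal points for an element with vanishing Fourier transform: inner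
boundary components do not contribute. -/
theorem cint_cauchyKernel_mul (hcd : c ≤ d) (hproper : Icc c d ≠ univ) {F : Oexp E (Icc c d)}
    (h0 : IsFourierTransform (BV.mk F) 0) (e : E →L[ℂ] ℂ)
    (hδ : -(δ * I) ∈ fourierDomain c d) (h : Around c d lo hi y₀ y₁) {z : ℂ}
    (hz : z ∈ openBox lo hi y₀ y₁) (him : z.im ≠ 0) :
    cint (rectContour lo hi y₀ y₁) (fun w => cauchyKernel δ z w * e ((F : ℂ → E) w)) =
      -(2 * Real.pi * I) * e ((F : ℂ → E) z) := by
  have habs := abs_pos.2 him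
  have hzK : z ∉ finitePart (Icc c d) := fun hz' => him hz'.1
  have hf : ∀ w ∉ finitePart (Icc c d), DifferentiableAt ℂ (fun u => e ((F : ℂ → E) u)) w :=
    fun w hw => F.2.1.differentiableAt_dual e hw
  obtain ⟨y₀', hy₀'⟩ : ∃ y, y = max y₀ (-(|z.im| / 2)) := ⟨_, rfl⟩
  obtain ⟨y₁', hy₁'⟩ : ∃ y, y = min y₁ (|z.im| / 2) := ⟨_, rfl⟩
  have hy₀z : -(|z.im| / 2) ≤ y₀' := hy₀' ▸ le_max_right _ _
  have hy₁z : y₁' ≤ |z.im| / 2 := hy₁' ▸ min_le_right _ _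
  have hy₀y : y₀ ≤ y₀' := hy₀' ▸ le_max_left _ _
  have hy₁y : y₁' ≤ y₁ := hy₁' ▸ min_le_left _ _
  have h' : Around c d lo hi y₀' y₁' :=
    ⟨h.left, h.right, hy₀' ▸ max_lt h.neg (by linarith), hy₁' ▸ lt_min h.pos (by linarith)⟩
  have hzs : z ∉ closedBox lo hi y₀' y₁' := by
    rintro ⟨-, -, h3, h4⟩
    rcases abs_cases z.im with ⟨h5, h6⟩ | ⟨h5, h6⟩ <;> linarith
  have hs' := h'.support_subset hcd
  have hT := tame_rectContour lo hi y₀' y₁'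
  have hle : lo ≤ hi := h.lo_le.trans (hcd.trans h.le_hi)
  -- The integral over the flat box vanishes, since `z` lies above or below it.
  have hsmall : cint (rectContour lo hi y₀' y₁')
      (fun w => cauchyKernel δ z w * e ((F : ℂ → E) w)) = 0 := by
    have hfc : ContinuousOn (fun w => e ((F : ℂ → E) w)) (support (rectContour lo hi y₀' y₁')) :=
      fun w hw => (hf w fun hw' =>
        (hs' hw).2 (h'.finitePart_subset hw')).continuousAt.continuousWithinAt
    have hd := (decaysAround_fourier hproper F e hδ h' h').mono hs'
    have hv : ∀ ξ : ℝ, cint (rectContour lo hi y₀' y₁')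
        (fun w => Complex.exp (-(I * w * (ξ - δ * I))) * e ((F : ℂ → E) w)) = 0 := by
      intro ξ
      have hξ : ((ξ : ℂ) - δ * I) ∈ fourierDomain c d := by
        simpa [fourierDomain] using hδ
      simpa using (isFourierTransform_iff hcd hproper F 0 h').1 h0 _ hξ e
    rcases lt_or_gt_of_ne him with hneg | hpos
    · rw [abs_of_neg hneg] at *
      refine cint_cauchyKernel_mul_eq_zero hT (s := -1) (η := -z.im / 2) (by norm_num)
        (by linarith) hfc hd (fun w hw => ?_) hv
      rw [Complex.sub_im]
      linarith [(hs' hw).1.2.2.1]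
    · rw [abs_of_pos hpos] at *
      refine cint_cauchyKernel_mul_eq_zero hT (s := 1) (η := z.im / 2) (by norm_num)
        (by linarith) hfc hd (fun w hw => ?_) hv
      rw [Complex.sub_im]
      linarith [(hs' hw).1.2.2.2]
  have hone : cint (rectContour lo hi y₀' y₁') (cauchyKernel δ z) = 0 := by
    obtain ⟨r, hr, hzr⟩ := exists_le_norm_sub (isClosed_closedBox _ _ _ _) hzs
    rw [h'.cint_eq]
    refine rectInt_eq_zero hle h.lo_ne_top h.hi_ne_bot (h'.neg.trans h'.pos).le (fun w hw => ?_)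
      (expDecayOn_cauchyKernel (expDecayOn_kernel hproper h' hδ) hr hzr)
    refine differentiableAt_cauchyKernel ?_
    rintro rfl
    exact hzs hw
  have hdiff : ∀ w ∉ finitePart (Icc c d), DifferentiableAt ℂ (fun w =>
      Complex.exp (-(δ * (w - z))) * dslope (fun u => e ((F : ℂ → E) u)) z w) w := by
    intro w hw
    have ho := (isClosed_finitePart c d).isOpen_compl
    have h1 : DifferentiableOn ℂ (dslope (fun u => e ((F : ℂ → E) u)) z) (finitePart (Icc c d))ᶜ :=
      (Complex.differentiableOn_dslope (ho.mem_nhds hzK)).2 fun u hu =>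
        (hf u hu).differentiableWithinAt
    exact (by fun_prop : DifferentiableAt ℂ (fun w => Complex.exp (-(δ * (w - z)))) w).mul
      (h1.differentiableAt (ho.mem_nhds hw))
  have hcollar : closedBox lo hi y₀ y₁ \ openBox lo hi y₀' y₁' ⊆ (finitePart (Icc c d))ᶜ :=
    fun w hw hw' => hw.2 (h'.finitePart_subset hw')
  have hdec : ExpDecayOn (fun w => Complex.exp (-(δ * (w - z))) *
      dslope (fun u => e ((F : ℂ → E) u)) z w) (closedBox lo hi y₀ y₁ \ openBox lo hi y₀' y₁') := by
    obtain ⟨r, hr, hball⟩ := Metric.nhds_basis_closedBall.mem_iff.1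
      ((isClosed_finitePart c d).isOpen_compl.mem_nhds hzK)
    -- Near `z` the function is bounded by compactness; away from `z` the quotient decays.
    have h1 := expDecayOn_of_isCompact (isCompact_closedBall z r) (f := fun w =>
      Complex.exp (-(δ * (w - z))) * dslope (fun u => e ((F : ℂ → E) u)) z w) fun w hw =>
        (hdiff w (hball hw)).continuousAt.continuousWithinAt
    have h2 : ExpDecayOn (fun w => Complex.exp (-(δ * (w - z))) *
        dslope (fun u => e ((F : ℂ → E) u)) z w)
        ((closedBox lo hi y₀ y₁ \ openBox lo hi y₀' y₁') \ Metric.closedBall z r) := by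
      have h3 := decaysAround_fourier hproper F e hδ h' h
      have h4 : ExpDecayOn (fun w => Complex.exp (-(I * w * (-(δ * I)))) * e ((F : ℂ → E) z))
          (closedBox lo hi y₀ y₁ \ openBox lo hi y₀' y₁') :=
        ((expDecayOn_kernel hproper h hδ).mono sdiff_subset).of_norm_le ‖e ((F : ℂ → E) z)‖
          fun w _ => by rw [norm_mul, mul_comm]
      have h5 : ExpDecayOn (fun w => Complex.exp (-(I * w * (-(δ * I)))) *
          (e ((F : ℂ → E) w) - e ((F : ℂ → E) z)))
          (closedBox lo hi y₀ y₁ \ openBox lo hi y₀' y₁') := by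
        have h6 := h3.add (h4.of_norm_le (g := fun w => -(Complex.exp (-(I * w * (-(δ * I)))) *
          e ((F : ℂ → E) z))) 1 fun w _ => by rw [norm_neg, one_mul])
        refine h6.of_norm_le 1 fun w _ => ?_
        rw [one_mul, mul_sub, sub_eq_add_neg]
      refine (h5.mono sdiff_subset).of_norm_le (Real.exp (δ * z.re) / r) fun w hw => ?_
      have hwr : r ≤ ‖w - z‖ := by
        have := hw.2
        rw [Metric.mem_closedBall, dist_eq_norm, not_le] at this
        exact this.le
      have hwz : w ≠ z := by
        rintro rfl
        exact hw.2 (Metric.mem_closedBall_self hr.le)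
      rw [dslope_of_ne _ hwz, slope_def_field, mul_div_left_comm, mul_comm, norm_mul, norm_mul,
        ← mul_assoc]
      gcongr
      exact norm_cauchyKernel_le hr hwr
    exact (h1.union h2).mono fun w hw => by
      by_cases hw' : w ∈ Metric.closedBall z r
      · exact Or.inl hw'
      · exact Or.inr ⟨hw, hw'⟩
  have key := rectInt_eq_of_nested le_rfl le_rfl hle h.lo_ne_top h.hi_ne_bot hy₀y
    (h'.neg.trans h'.pos).le hy₁y (fun w hw => hdiff w (hcollar hw)) hdec
  rw [← h.cint_eq, ← h'.cint_eq, cint_exp_mul_dslope hcd hproper F e hδ h fun hz' => hz'.2 hz,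
    cint_exp_mul_dslope hcd hproper F e hδ h' fun hz' => hzs hz'.1, hsmall, hone, h.cint_eq
    (cauchyKernel δ z), rectInt_cauchyKernel (expDecayOn_kernel hproper h hδ) hz] at key
  linear_combination key

end Scalar

section Vector

variable {E : Type*} [AddCommGroup E] [Module ℂ E] [UniformSpace E]
  [IsUniformAddGroup E] [ContinuousSMul ℂ E] [PolynormableSpace ℂ E]
  {c d lo hi : EReal} {y₀ y₁ δ : ℝ}

/-- If the Fourier transform of `[F]` vanishes, the Cauchy integral of `F` with decreasing kernel
over the boundary of a box extends `F` holomorphically to the whole box. -/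
theorem exists_extension_openBox [T2Space E] (hE : IsSequentiallyComplete E) (hcd : c ≤ d)
    (hproper : Icc c d ≠ univ) {F : Oexp E (Icc c d)} (h0 : IsFourierTransform (BV.mk F) 0)
    (hδ : -(δ * I) ∈ fourierDomain c d) (h : Around c d lo hi y₀ y₁) :
    ∃ T : ℂ → E, (∀ e : E →L[ℂ] ℂ, DifferentiableOn ℂ (fun z => e (T z)) (openBox lo hi y₀ y₁)) ∧
      (∀ z ∈ openBox lo hi y₀ y₁, z ∉ finitePart (Icc c d) → T z = (F : ℂ → E) z) ∧
      ∀ p : Seminorm ℂ E, Continuous p → ∃ C : ℝ, 0 ≤ C ∧ ∀ r : ℝ, 0 < r →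
        ∀ z ∈ openBox lo hi y₀ y₁,
          (∀ w ∈ closedBox lo hi y₀ y₁ \ openBox lo hi y₀ y₁, r ≤ ‖w - z‖) →
          p (T z) ≤ C * (Real.exp (δ * z.re) / r) := by
  have hs := h.support_subset hcd
  have hT := tame_rectContour lo hi y₀ y₁
  have hcont : ∀ z ∈ openBox lo hi y₀ y₁, ContinuousOn
      (fun w => cauchyKernel δ z w • (F : ℂ → E) w) (support (rectContour lo hi y₀ y₁)) := by
    intro z hz w hw
    have h1 : w ≠ z := by
      rintro rfl
      exact (hs hw).2 hz
    exact ((differentiableAt_cauchyKernel h1).continuousAt.smul (F.2.1.continuousAt fun hw' =>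
      (hs hw).2 (h.finitePart_subset hw'))).continuousWithinAt
  have hdist : ∀ z ∈ openBox lo hi y₀ y₁, ∃ r : ℝ, 0 < r ∧
      ∀ w ∈ closedBox lo hi y₀ y₁ \ openBox lo hi y₀ y₁, r ≤ ‖w - z‖ := fun z hz =>
    exists_le_norm_sub (isClosed_collar _ _ _ _ _ _ _ _) fun hz' => hz'.2 hz
  have hbd : ∀ p : Seminorm ℂ E, Continuous p → ∃ C δ' : ℝ, 0 < δ' ∧
      ∀ w ∈ closedBox lo hi y₀ y₁ \ openBox lo hi y₀ y₁,
        ‖Complex.exp (-(I * w * (-(δ * I))))‖ * p ((F : ℂ → E) w) ≤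
          C * Real.exp (-δ' * |w.re|) := fun p hp =>
    ExpDecayOn.mul_dual F.2.2 (exists_forall_collar_subset_S h)
      ((expDecayOn_kernel hproper h hδ).mono sdiff_subset) hp
  have hex : ∀ z : ℂ, ∃ v : E, z ∈ openBox lo hi y₀ y₁ →
      HasContourIntegral (rectContour lo hi y₀ y₁)
        (fun w => cauchyKernel δ z w • (F : ℂ → E) w) v := by
    intro z
    by_cases hz : z ∈ openBox lo hi y₀ y₁
    · obtain ⟨r, hr, hzr⟩ := hdist z hz
      obtain ⟨v, hv⟩ := exists_hasContourIntegral hE hT (hcont z hz) fun p hp => by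
        obtain ⟨C, δ', hδ', hC⟩ := hbd p hp
        exact ⟨_, δ', hδ', fun w hw => seminorm_cauchyKernel_smul_le hC hr hzr (hs hw)⟩
      exact ⟨v, fun _ => hv⟩
    · exact ⟨0, fun h => absurd h hz⟩
  choose v hv using hex
  have hκ : -(2 * Real.pi * I) ≠ 0 := by simp [Real.pi_ne_zero]
  have hTe : ∀ z ∈ openBox lo hi y₀ y₁, ∀ e : E →L[ℂ] ℂ,
      e ((-(2 * Real.pi * I))⁻¹ • v z) = (-(2 * Real.pi * I))⁻¹ *
        cint (rectContour lo hi y₀ y₁) (fun w => cauchyKernel δ z w * e ((F : ℂ → E) w)) := by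
    intro z hz e
    rw [map_smul, smul_eq_mul, ← (hv z hz).cint_eq e]
    simp only [map_smul, smul_eq_mul]
  have hdiff : ∀ e : E →L[ℂ] ℂ, DifferentiableOn ℂ
      (fun z => e ((-(2 * Real.pi * I))⁻¹ • v z)) (openBox lo hi y₀ y₁) := by
    intro e
    refine DifferentiableOn.congr (DifferentiableOn.const_mul ?_ _) fun z hz => hTe z hz e
    refine differentiableOn_cint hT (isOpen_openBox _ _ _ _) (fun w hw z hz => ?_)
      (fun z hz => ?_) fun z₀ hz₀ => ?_
    · have h1 : w - z ≠ 0 := by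
        rw [sub_ne_zero]
        rintro rfl
        exact (hs hw).2 hz
      exact (DifferentiableAt.mul_const (DifferentiableAt.div (by fun_prop) (by fun_prop) h1)
        _).differentiableWithinAt
    · simpa only [Function.comp_def, map_smul, smul_eq_mul] using
        e.continuous.comp_continuousOn (hcont z hz)
    · obtain ⟨r, hr, hzr⟩ := hdist z₀ hz₀
      obtain ⟨p, hp, hpe⟩ := seminorm_dual_continuous e
      obtain ⟨C, δ', hδ', hC⟩ := hbd p hp
      have hC0 : ∀ w ∈ closedBox lo hi y₀ y₁ \ openBox lo hi y₀ y₁, 0 ≤ C := by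
        intro w hw
        have := (mul_nonneg (norm_nonneg _) (apply_nonneg p _)).trans (hC w hw)
        exact nonneg_of_mul_nonneg_left this (Real.exp_pos _)
      refine ⟨Real.exp (|δ| * (|z₀.re| + r)) / (r / 2) * C, δ', hδ', ?_⟩
      filter_upwards [Metric.ball_mem_nhds z₀ (half_pos hr)] with z hz w hw
      rw [Metric.mem_ball] at hz
      have h1 : ∀ w ∈ closedBox lo hi y₀ y₁ \ openBox lo hi y₀ y₁, r / 2 ≤ ‖w - z‖ := by
        intro w hw
        have h2 := hzr w hw
        have h3 := norm_sub_le_norm_sub_add_norm_sub w z z₀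
        rw [dist_eq_norm] at hz
        linarith
      have h4 := seminorm_cauchyKernel_smul_le hC (half_pos hr) h1 (hs hw)
      rw [hpe, map_smul, smul_eq_mul] at h4
      refine h4.trans ?_
      have h5 : δ * z.re ≤ |δ| * (|z₀.re| + r) := by
        refine (le_abs_self _).trans ?_
        rw [abs_mul]
        gcongr
        have h6 := abs_re_sub_le_dist z z₀
        have h7 := abs_sub_abs_le_abs_sub z.re z₀.re
        linarith
      have := hC0 w (hs hw)
      gcongr
  refine ⟨fun z => (-(2 * Real.pi * I))⁻¹ • v z, hdiff, fun z hz hzK => ?_, fun p hp => ?_⟩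
  · refine eq_of_dual_eq fun e => ?_
    refine eq_of_eq_of_im_ne_zero (f := fun z => e ((-(2 * Real.pi * I))⁻¹ • v z))
      (g := fun z => e ((F : ℂ → E) z))
      ((hdiff e).differentiableAt ((isOpen_openBox _ _ _ _).mem_nhds hz)).continuousAt
      (F.2.1.differentiableAt_dual e hzK).continuousAt ?_
    filter_upwards [(isOpen_openBox _ _ _ _).mem_nhds hz] with w hw him
    rw [hTe w hw, cint_cauchyKernel_mul hcd hproper h0 e hδ h hw him, inv_mul_cancel_left₀ hκ]
  · obtain ⟨C, δ', hδ', hC⟩ := hbd p hp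
    refine ⟨‖(-(2 * Real.pi * I) : ℂ)⁻¹‖ * |C| * expMass (rectContour lo hi y₀ y₁) δ',
      mul_nonneg (by positivity) (expMass_nonneg _ _), fun r hr z hz hzr => ?_⟩
    rw [map_smul_eq_mul]
    have h1 := (hv z hz).seminorm_le hT hp hδ' (C := Real.exp (δ * z.re) / r * |C|) fun w hw => by
      refine seminorm_cauchyKernel_smul_le (C := |C|) (fun w hw => (hC w hw).trans ?_) hr hzr
        (hs hw)
      gcongr
      exact le_abs_self C
    refine (mul_le_mul_of_nonneg_left h1 (norm_nonneg _)).trans_eq ?_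
    ring

/-- The kernel `e^{-δ(w - z)}` with `δ = σ t` decreases towards the infinite end of `[c, d]` for a
sign `σ` and all `t > 0`. -/
theorem exists_sign_fourierDomain (hproper : Icc c d ≠ univ) :
    ∃ σ : ℝ, |σ| = 1 ∧ ∀ t : ℝ, 0 < t → -((σ * t : ℝ) * I) ∈ fourierDomain c d := by
  by_cases hc : c = ⊥
  · have hd : d ≠ ⊤ := by
      rintro rfl
      exact hproper (by rw [hc, Icc_bot_top])
    exact ⟨-1, by simp, fun t ht => by simp [fourierDomain, hd, ht]⟩
  · exact ⟨1, by simp, fun t ht => by simp [fourierDomain, hc, ht]⟩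

theorem one_le_norm_sub_of_mem_openBox {z w : ℂ} (hz : z ∈ openBox lo hi y₀ y₁)
    (hw : w ∉ openBox (lo + (-1 : ℝ)) (hi + (1 : ℝ)) (y₀ - 1) (y₁ + 1)) : 1 ≤ ‖w - z‖ := by
  refine le_norm_of_not_mem_openBox fun h => hw ?_
  obtain ⟨z1, z2, z3, z4⟩ := hz
  obtain ⟨w1, w2, w3, w4⟩ := h
  rw [EReal.coe_lt_coe_iff] at w1 w2
  refine ⟨?_, ?_, by linarith, by linarith⟩
  · induction lo with
    | bot => simp
    | top => simp at z1
    | coe lo =>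
      rw [EReal.coe_lt_coe_iff] at z1
      rw [← EReal.coe_add, EReal.coe_lt_coe_iff]
      linarith
  · induction hi with
    | bot => simp at z2
    | top => rw [EReal.top_add_coe]; exact EReal.coe_lt_top _
    | coe hi =>
      rw [EReal.coe_lt_coe_iff] at z2
      rw [← EReal.coe_add, EReal.coe_lt_coe_iff]
      linarith

/-- A class with vanishing Fourier transform is zero. -/
theorem mk_eq_zero_of_isFourierTransform_zero [T2Space E] (hE : IsSequentiallyComplete E)
    (hcd : c ≤ d) (hproper : Icc c d ≠ univ) {F : Oexp E (Icc c d)}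
    (h0 : IsFourierTransform (BV.mk F) 0) : BV.mk F = 0 := by
  obtain ⟨lo, hi, y₀, y₁, h⟩ := exists_around hcd
  have h' : Around c d (lo + (-1 : ℝ)) (hi + (1 : ℝ)) (y₀ - 1) (y₁ + 1) :=
    h.enlarge (by norm_num) (by norm_num) (by linarith) (by linarith)
  obtain ⟨σ, hσ, hdom⟩ := exists_sign_fourierDomain hproper
  have hopen := isOpen_openBox (lo + (-1 : ℝ)) (hi + (1 : ℝ)) (y₀ - 1) (y₁ + 1)
  have hK := (isClosed_finitePart c d).isOpen_compl
  classical
  obtain ⟨T, hT, hTF, -⟩ := exists_extension_openBox hE hcd hproper h0 (hdom 1 one_pos) h'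
  obtain ⟨H, hHdef⟩ : ∃ H : ℂ → E, H = fun z => if z ∈ finitePart (Icc c d) then T z else
    (F : ℂ → E) z := ⟨_, rfl⟩
  have hHF : ∀ z ∉ finitePart (Icc c d), H z = (F : ℂ → E) z := fun z hz => by
    rw [hHdef]; exact if_neg hz
  have hHT : ∀ z ∈ openBox (lo + (-1 : ℝ)) (hi + (1 : ℝ)) (y₀ - 1) (y₁ + 1), H z = T z := by
    intro z hz
    by_cases hzK : z ∈ finitePart (Icc c d)
    · rw [hHdef]; exact if_pos hzK
    · rw [hHF z hzK, hTF z hz hzK]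
  have hsub : openBox lo hi y₀ y₁ ⊆
      openBox (lo + (-1 : ℝ)) (hi + (1 : ℝ)) (y₀ - 1) (y₁ + 1) := by
    intro z hz
    by_contra hz'
    have := one_le_norm_sub_of_mem_openBox hz hz'
    rw [sub_self, norm_zero] at this
    linarith
  -- The extension does not depend on the rate of decay of the kernel, so that it grows more slowly
  -- than any exponential in the smaller box.
  have hgrow : ∀ t : ℝ, 0 < t → ∀ p : Seminorm ℂ E, Continuous p → ∃ C : ℝ, 0 ≤ C ∧
      ∀ z ∈ openBox lo hi y₀ y₁, p (H z) ≤ C * Real.exp (t * |z.re|) := by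
    intro t ht p hp
    obtain ⟨T', hT', hTF', hbd⟩ := exists_extension_openBox hE hcd hproper h0 (hdom t ht) h'
    obtain ⟨C, hC0, hC⟩ := hbd p hp
    refine ⟨C, hC0, fun z hz => ?_⟩
    have heq : H z = T' z := by
      rw [hHT z (hsub hz)]
      refine eq_of_dual_eq fun e => eq_of_eq_of_im_ne_zero (f := fun z => e (T z))
        (g := fun z => e (T' z)) ((hT e).differentiableAt (hopen.mem_nhds (hsub hz))).continuousAt
        ((hT' e).differentiableAt (hopen.mem_nhds (hsub hz))).continuousAt ?_
      filter_upwards [hopen.mem_nhds (hsub hz)] with w hw him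
      have hwK : w ∉ finitePart (Icc c d) := fun hw' => him hw'.1
      rw [hTF w hw hwK, hTF' w hw hwK]
    rw [heq]
    refine (hC 1 one_pos z (hsub hz) fun w hw =>
      one_le_norm_sub_of_mem_openBox hz hw.2).trans ?_
    rw [div_one]
    refine mul_le_mul_of_nonneg_left (Real.exp_le_exp.2 ?_) hC0
    refine (le_abs_self _).trans_eq ?_
    rw [abs_mul, abs_mul, hσ, one_mul, abs_of_pos ht]
  -- `H` is the function `F`, continued across `[c, d]` by `T`.
  have hHol : HolomorphicOn H (finitePart ∅)ᶜ := by
    have huniv : (finitePart ∅)ᶜ = univ := by ext; simp [finitePart]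
    rw [huniv]
    refine holomorphicOn_of_weak hE isOpen_univ (fun e z _ => ?_) fun p hp z _ => ?_
    · by_cases hzK : z ∈ finitePart (Icc c d)
      · have hz := hopen.mem_nhds (hsub (h.finitePart_subset hzK))
        refine (((hT e).differentiableAt hz).congr_of_eventuallyEq
          ?_).differentiableWithinAt
        filter_upwards [hz] with w hw
        rw [hHT w hw]
      · refine ((F.2.1.differentiableAt_dual e hzK).congr_of_eventuallyEq
          ?_).differentiableWithinAt
        filter_upwards [hK.mem_nhds hzK] with w hw
        rw [hHF w hw]
    · by_cases hzK : z ∈ finitePart (Icc c d)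
      · obtain ⟨C, hC0, hC⟩ := hgrow 1 one_pos p hp
        refine ⟨C * Real.exp (1 * (|z.re| + 1)), ?_⟩
        filter_upwards [(isOpen_openBox _ _ _ _).mem_nhds (h.finitePart_subset hzK),
          Metric.ball_mem_nhds z one_pos] with w hw hw'
        refine (hC w hw).trans ?_
        have h1 := abs_re_sub_le_dist w z
        have h2 := abs_sub_abs_le_abs_sub w.re z.re
        rw [Metric.mem_ball] at hw'
        gcongr
        linarith
      · refine ⟨p ((F : ℂ → E) z) + 1, ?_⟩
        have h1 : ContinuousAt (fun w => p ((F : ℂ → E) w)) z :=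
          hp.continuousAt.comp (F.2.1.continuousAt hzK)
        filter_upwards [hK.mem_nhds hzK, h1.eventually_lt continuousAt_const
          (lt_add_one (p ((F : ℂ → E) z)))] with w hw hw'
        rw [hHF w hw]
        exact hw'.le
  have hSlow : SlowGrowth ∅ H := by
    intro n hn p hp
    have hn0 : (0 : ℝ) < 1 / n := by
      have : (1 : ℝ) ≤ n := by exact_mod_cast hn
      positivity
    obtain ⟨C₁, hC₁0, hC₁⟩ := F.2.2.exists_le (exists_forall_strip_subset_S h n) hp hn0
    obtain ⟨C₂, hC₂0, hC₂⟩ := hgrow _ hn0 p hp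
    refine ⟨max C₁ C₂, fun z hz => ?_⟩
    rw [S_empty, mem_ofPred_eq] at hz
    rw [neg_mul, Real.exp_neg, ← div_eq_mul_inv, div_le_iff₀ (Real.exp_pos _)]
    by_cases hzb : z ∈ openBox lo hi y₀ y₁
    · refine (hC₂ z hzb).trans ?_
      gcongr
      exact le_max_right _ _
    · rw [hHF z fun hzK => hzb (h.finitePart_subset hzK)]
      refine (hC₁ z ⟨hz.le, hzb⟩).trans ?_
      gcongr
      exact le_max_left _ _
  rw [BV.mk, Submodule.mkQ_apply, Submodule.Quotient.mk_eq_zero]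
  exact ⟨H, ⟨hHol, hSlow⟩, fun z hz => (hHF z hz).symm⟩

/-- The Fourier transform is injective. -/
theorem IsFourierTransform.eq_of_eqOn [T2Space E] (hE : IsSequentiallyComplete E)
    (hcd : c ≤ d) (hproper : Icc c d ≠ univ) {f g : BV E (Icc c d)} {φ ψ : ℂ → E}
    (hf : IsFourierTransform f φ) (hg : IsFourierTransform g ψ)
    (h : EqOn φ ψ (fourierDomain c d)) : f = g := by
  obtain ⟨F, rfl⟩ := BV.exists_rep f
  obtain ⟨G, rfl⟩ := BV.exists_rep g
  obtain ⟨lo, hi, y₀, y₁, hA⟩ := exists_around hcd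
  have hs := hA.support_subset hcd
  have hT := tame_rectContour lo hi y₀ y₁
  have h0 : IsFourierTransform (BV.mk (F - G)) 0 := by
    rw [isFourierTransform_iff hcd hproper _ _ hA]
    intro ζ hζ e
    have h1 := (isFourierTransform_iff hcd hproper F φ hA).1 hf ζ hζ e
    have h2 := (isFourierTransform_iff hcd hproper G ψ hA).1 hg ζ hζ e
    rw [Pi.zero_apply, map_zero, ← sub_eq_zero.2 (congrArg e (h hζ)), ← h1, ← h2,
      ← cint_sub (integrableOn_fourier hproper F e hζ hT hA hA hs)
        (integrableOn_fourier hproper G e hζ hT hA hA hs)]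
    refine cint_congr hT fun z _ => ?_
    rw [← mul_sub, ← map_sub]
    rfl
  have := mk_eq_zero_of_isFourierTransform_zero hE hcd hproper h0
  rwa [BV.mk, map_sub, sub_eq_zero] at this

end Vector

end Injectivity

end FourierHyperfunction

theorem mainTheorem10
    {E E₁ E₂ : Type*}
    [AddCommGroup E] [Module ℂ E] [UniformSpace E] [IsUniformAddGroup E] [ContinuousSMul ℂ E]
    [LocallyConvexSpace ℝ E] [T2Space E]
    [AddCommGroup E₁] [Module ℂ E₁] [UniformSpace E₁] [IsUniformAddGroup E₁]
    [ContinuousSMul ℂ E₁] [LocallyConvexSpace ℝ E₁] [T2Space E₁]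
    [AddCommGroup E₂] [Module ℂ E₂] [UniformSpace E₂] [IsUniformAddGroup E₂]
    [ContinuousSMul ℂ E₂] [LocallyConvexSpace ℝ E₂] [T2Space E₂]
    (hE : IsSequentiallyComplete E) (hE₁ : IsSequentiallyComplete E₁)
    (hE₂ : IsSequentiallyComplete E₂)
    (B : E₁ →ₗ[ℂ] E₂ →ₗ[ℂ] E)
    (hB : ∀ p : Seminorm ℂ E, Continuous p →
      ∃ (q : Seminorm ℂ E₁) (r : Seminorm ℂ E₂) (D : ℝ), Continuous q ∧ Continuous r ∧ 0 < D ∧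
        ∀ x y, p (B x y) ≤ D * q x * r y)
    (a b : ℝ) (hab : a ≤ b) (c d : EReal) (hcd : c ≤ d) (hproper : Icc c d ≠ univ) :
    ∃ conv : FourierHyperfunction.BV E₁ (Icc (a : EReal) b) →
        FourierHyperfunction.BV E₂ (Icc c d) → FourierHyperfunction.BV E (Icc (a + c) (b + d)),
      (∀ (F : FourierHyperfunction.Oexp E₁ (Icc (a : EReal) b))
          (G : FourierHyperfunction.Oexp E₂ (Icc c d)),
        ∃ H : FourierHyperfunction.Oexp E (Icc (a + c) (b + d)),
          FourierHyperfunction.IsContourConvolution B a b c d (F : ℂ → E₁) (G : ℂ → E₂)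
            (H : ℂ → E) ∧
          conv (FourierHyperfunction.BV.mk F) (FourierHyperfunction.BV.mk G) =
            FourierHyperfunction.BV.mk H) ∧
      ∀ f g h, FourierHyperfunction.IsFourierConvolution B f g h ↔ h = conv f g := by
  open FourierHyperfunction in
  have := polynormableSpace_complex E
  have := polynormableSpace_complex E₁
  have := polynormableSpace_complex E₂
  have hab' : (a : EReal) ≤ b := EReal.coe_le_coe_iff.2 hab
  have hcd' : (a : EReal) + c ≤ b + d := add_le_add hab' hcd
  have habp : Icc (a : EReal) b ≠ univ := Icc_coe_ne_univ a b
  have hproper' := Icc_add_ne_univ (a := a) (b := b) hproper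
  have hex : ∀ (F : Oexp E₁ (Icc (a : EReal) b)) (G : Oexp E₂ (Icc c d)),
      ∃ H : Oexp E (Icc (a + c) (b + d)),
        IsContourConvolution B a b c d (F : ℂ → E₁) (G : ℂ → E₂) (H : ℂ → E) :=
    exists_isContourConvolution hE hab hB
  choose conv₀ hconv₀ using hex
  choose rep₁ hrep₁ using fun f : BV E₁ (Icc (a : EReal) b) => BV.exists_rep f
  choose rep₂ hrep₂ using fun g : BV E₂ (Icc c d) => BV.exists_rep g
  refine ⟨fun f g => BV.mk (conv₀ (rep₁ f) (rep₂ g)), fun F G => ⟨conv₀ F G, hconv₀ F G, ?_⟩,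
    fun f g h => ⟨?_, ?_⟩⟩
  · -- Both sides have the Fourier transform `B (φ ζ) (ψ ζ)`.
    obtain ⟨φ, hφ⟩ := exists_isFourierTransform hE₁ hab' habp (BV.mk F)
    obtain ⟨ψ, hψ⟩ := exists_isFourierTransform hE₂ hcd hproper (BV.mk G)
    exact IsFourierTransform.eq_of_eqOn hE hcd' hproper'
      ((hconv₀ _ _).isFourierTransform hab hcd hproper hB ((hrep₁ (BV.mk F)).symm ▸ hφ)
        ((hrep₂ (BV.mk G)).symm ▸ hψ))
      ((hconv₀ F G).isFourierTransform hab hcd hproper hB hφ hψ) fun ζ _ => rfl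
  · rintro ⟨φ, ψ, hφ, hψ, hh⟩
    exact IsFourierTransform.eq_of_eqOn hE hcd' hproper' hh
      ((hconv₀ _ _).isFourierTransform hab hcd hproper hB ((hrep₁ f).symm ▸ hφ)
        ((hrep₂ g).symm ▸ hψ)) fun ζ _ => rfl
  · rintro rfl
    obtain ⟨φ, hφ⟩ := exists_isFourierTransform hE₁ hab' habp f
    obtain ⟨ψ, hψ⟩ := exists_isFourierTransform hE₂ hcd hproper g
    exact ⟨φ, ψ, hφ, hψ, (hconv₀ _ _).isFourierTransform hab hcd hproper hB
      ((hrep₁ f).symm ▸ hφ) ((hrep₂ g).symm ▸ hψ)⟩
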